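/- Let $\mathbb F\in\{\mathbb R,\mathbb C,\mathbb H\}$, $n\ge 1$, and let $H=SO_0(n,1),\ SU(n,1),\ Sp(n,1)$ respectively, with $\rho=\frac{n-1}2,\ n,\ 2n+1$. Let $S$ be the unit sphere of $\mathbb F^n$ with surface measure $ds$; $H$ acts on $S$ by $g\cdot u=(au+b)(cu+d)^{-1}$, $g=\begin{bmatrix}a&b\\c&d\end{bmatrix}$, and for $\lambda\in\mathbb R$ put $$(\pi_\lambda(g)f)(u)=|cu+d|^{-\lambda}f\big((au+b)(cu+d)^{-1}\big),\qquad g^{-1}=\begin{bmatrix}a&b\\c&d\end{bmatrix}.$$ Let $D$ be, respectively, the unit ball of $\mathbb C^n$, the product of two unit balls in $\mathbb C^n\oplus\overline{\mathbb C^n}$, and the ball $\{z^*z<1\}$ in $M_{2n,2}(\mathbb C)$, and let $$h(z,w)=1-\langle z,w\rangle,\qquad h(z,w)=(1-\langle z_1,w_1\rangle)(1-\langle w_2,z_2\rangle),\qquad h(z,w)=\det(1-w^*z).$$ The sphere $S$ lies in the boundary of $D$ (by $s\mapsto s$, $s\mapsto (s,s)$, and by replacing quaternions by complex $2\times2$ matrices),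 and $H$ acts on $D$ by fractional linear transformations as a subgroup of $G=SU(n,1),\ SU(n,1)\times SU(n,1)$ (diagonally), $SU(2n,2)$. Let $j(g,z)$ denote the automorphy factor $\det(cz+d)$ (for $\mathbb F=\mathbb C$: $(cz_1+d)\overline{(cz_2+d)}$). Let $\nu>0$ if $\mathbb F=\mathbb R,\mathbb C$ and $\nu>1$ if $\mathbb F=\mathbb H$, and put $\mu=\nu$ if $\mathbb F=\mathbb R$, $\mu=2\nu$ if $\mathbb F=\mathbb C,\mathbb H$. Then $h(z,w)^{-\nu}$ is a positive definite kernel on $D$. Let $\mathcal H_\nu$ be the Hilbert space of functions on $D$ with this reproducing kernel; $(U_\nu(g)\varphi)(z)=j(g^{-1},z)^{-\nu}\varphi(g^{-1}z)$ is a unitary representation of $H$ on $\mathcal H_\nu$. For $f\in C(S)$ put $$J_\nu f(z)=\int_S f(s)\,h(z,s)^{-\nu}\,ds,\qquad z\in D.$$ (1) The function $J_\nu 1$ belongs to $\mathcal H_\nu$ if and only if $\mu<\rho$, that is, if and only if $\nu<\frac{n-1}2$ ($\mathbb F=\mathbb R$), $2\nu<n$ ($\mathbb F=\mathbb C$), $2\nu<2n+1$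 ($\mathbb F=\mathbb H$). (2) Let $\mu<\rho$. Let $(\Lambda_\mu f)(x)=\int_S f(u)\,|1-\langle x,u\rangle|^{-\mu}\,du$ be the Knapp–Stein operator, where $\langle x,u\rangle=\sum_i\bar u_ix_i$. The complementary series $\pi_{2\rho-\mu}$ and $\pi_\mu$ exist: they are the Hilbert spaces obtained by completing $C(S)$ in the norm $\|f\|_{2\rho-\mu}=(\Lambda_\mu f,f)^{1/2}$, and by completing the space of those $g\in C(S)$ for which $\|g\|_\mu=\sup\{|(g,f)|:\ f\in C(S),\ \|f\|_{2\rho-\mu}\le1\}$ is finite in that norm, where $(f,g)=\int_S f\bar g\,ds$; moreover $\|\Lambda_\mu f\|_\mu=\|f\|_{2\rho-\mu}$ whenever $f,\Lambda_\mu f\in C(S)$. The group $H$ acts on them unitarily through $\pi_{2\rho-\mu}$ and $\pi_\mu$. The pairing $(f,g)$ is $H$-invariant and identifies (conjugate linearly and isometrically) $\pi_{2\rho-\mu}$ with the dual space of $\pi_\mu$. The restriction to $S$ of those elements of $\mathcal H_\nu$ that extend holomorphically to a neighbourhood of $\overline D$ extends uniquely to a bounded operator $R:\mathcal H_\nu\to\pi_\mu$,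 and $R$ is $H$-intertwining. With the above identification, the adjoint $R^*:\pi_{2\rho-\mu}\to\mathcal H_\nu$ of $R$ is given by the integral operator $J_\nu$, that is, $R^*f=J_\nu f$ for $f\in C(S)$, and it intertwines $\pi_{2\rho-\mu}$ with the restriction of $U_\nu$ to $H$. -/

import Mathlib

open MeasureTheory Matrix
open scoped ComplexOrder ComplexConjugate Quaternion

noncomputable section

namespace RankOne

/-! ### Indefinite unitary groups over `ℝ`, `ℂ`, `ℍ` -/

/-- The matrix `diag(1, …, 1, -1, …, -1)` of signature `(p, q)`. -/
def sig (p q R : Type) [DecidableEq p] [DecidableEq q] [Ring R] : Matrix (p ⊕ q) (p ⊕ q) R :=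
  fromBlocks 1 0 0 (-1)

/-- `g` preserves the (skew-)Hermitian form `|x₁|² + ⋯ + |x_p|² - |x_{p+1}|² - ⋯ - |x_{p+q}|²`. -/
def Preserves {p q R : Type} [Fintype p] [Fintype q] [DecidableEq p] [DecidableEq q] [Ring R]
    [StarRing R] (g : Matrix (p ⊕ q) (p ⊕ q) R) : Prop :=
  gᴴ * sig p q R * g = sig p q R

/-- The group of all invertible matrices over `R` preserving the form of signature `(p, q)`. -/
def indefUnitary (p q R : Type) [Fintype p] [Fintype q] [DecidableEq p] [DecidableEq q] [Ring R]
    [StarRing R] : Subgroup (Matrix (p ⊕ q) (p ⊕ q) R)ˣ where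
  carrier := {g | Preserves (g : Matrix (p ⊕ q) (p ⊕ q) R)}
  one_mem' := by simp [Preserves]
  mul_mem' := by
    intro a b ha hb
    simp only [Set.mem_ofPred_eq, Preserves] at ha hb ⊢
    calc ((a * b : (Matrix (p ⊕ q) (p ⊕ q) R)ˣ) : Matrix (p ⊕ q) (p ⊕ q) R)ᴴ * sig p q R *
          ((a * b : (Matrix (p ⊕ q) (p ⊕ q) R)ˣ) : Matrix (p ⊕ q) (p ⊕ q) R)
        = (b : Matrix (p ⊕ q) (p ⊕ q) R)ᴴ * ((a : Matrix (p ⊕ q) (p ⊕ q) R)ᴴ * sig p q R *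
            (a : Matrix (p ⊕ q) (p ⊕ q) R)) * (b : Matrix (p ⊕ q) (p ⊕ q) R) := by
          simp only [Units.val_mul, conjTranspose_mul, Matrix.mul_assoc]
      _ = sig p q R := by rw [ha, hb]
  inv_mem' := by
    intro a ha
    simp only [Set.mem_ofPred_eq, Preserves] at ha ⊢
    have h1 : (a : Matrix (p ⊕ q) (p ⊕ q) R) * ((a⁻¹ : (Matrix (p ⊕ q) (p ⊕ q) R)ˣ) :
        Matrix (p ⊕ q) (p ⊕ q) R) = 1 := a.mul_inv
    have h2 : ((a⁻¹ : (Matrix (p ⊕ q) (p ⊕ q) R)ˣ) : Matrix (p ⊕ q) (p ⊕ q) R)ᴴ *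
        (a : Matrix (p ⊕ q) (p ⊕ q) R)ᴴ = 1 := by
      rw [← conjTranspose_mul, h1, conjTranspose_one]
    calc ((a⁻¹ : (Matrix (p ⊕ q) (p ⊕ q) R)ˣ) : Matrix (p ⊕ q) (p ⊕ q) R)ᴴ * sig p q R *
          ((a⁻¹ : (Matrix (p ⊕ q) (p ⊕ q) R)ˣ) : Matrix (p ⊕ q) (p ⊕ q) R)
        = (((a⁻¹ : (Matrix (p ⊕ q) (p ⊕ q) R)ˣ) : Matrix (p ⊕ q) (p ⊕ q) R)ᴴ *
            (a : Matrix (p ⊕ q) (p ⊕ q) R)ᴴ) * sig p q R *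
          ((a : Matrix (p ⊕ q) (p ⊕ q) R) * ((a⁻¹ : (Matrix (p ⊕ q) (p ⊕ q) R)ˣ) :
            Matrix (p ⊕ q) (p ⊕ q) R)) := by
          conv_lhs => rw [← ha]
          simp only [Matrix.mul_assoc]
      _ = sig p q R := by rw [h1, h2, Matrix.one_mul, Matrix.mul_one]

/-- The form-preserving matrices of determinant one, over a commutative ring. -/
def specialIndefUnitary (p q R : Type) [Fintype p] [Fintype q] [DecidableEq p] [DecidableEq q]
    [CommRing R] [StarRing R] : Subgroup (Matrix (p ⊕ q) (p ⊕ q) R)ˣ :=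
  indefUnitary p q R ⊓ (Units.map (detMonoidHom (n := p ⊕ q) (R := R))).ker

/-- The identity component of a matrix group. -/
def idComponent {A : Type} [Ring A] [TopologicalSpace A] [IsTopologicalRing A]
    (G : Subgroup Aˣ) : Subgroup Aˣ :=
  (Subgroup.connectedComponentOfOne G).map G.subtype

/-! ### The unit sphere of `𝔽ⁿ` and the action of the group on it -/

/-- In `ℝ`, `ℂ` and `ℍ` one has `x̄ x = |x|²`. -/
class NormSqStar (F : Type) [NormedDivisionRing F] [StarRing F] [NormedAlgebra ℝ F] : Prop where
  star_mul_self : ∀ x : F, star x * x = algebraMap ℝ F (‖x‖ ^ 2)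

instance : NormSqStar ℝ where
  star_mul_self x := by simp [sq]

instance : NormSqStar ℂ where
  star_mul_self x := by simp [Complex.conj_mul']

instance : NormSqStar ℍ[ℝ] where
  star_mul_self x := by
    rw [Quaternion.star_mul_self, Quaternion.normSq_eq_norm_mul_self, ← sq]
    rfl

instance : MeasurableSpace ℍ[ℝ] := borel _

instance : BorelSpace ℍ[ℝ] := ⟨rfl⟩

/-- The unit sphere `S` in `𝔽ⁿ`. -/
abbrev USphere (F : Type) [NormedDivisionRing F] (n : ℕ) : Type :=
  Metric.sphere (0 : EuclideanSpace F (Fin n)) 1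

section SphereAction

variable {F : Type} [NormedDivisionRing F] [StarRing F] {n : ℕ}

/-- `a u + b` for `g = [a b; c d]`. -/
def sNum (g : Matrix (Fin n ⊕ Unit) (Fin n ⊕ Unit) F) (u : Fin n → F) (i : Fin n) : F :=
  (g.toBlocks₁₁ *ᵥ u) i + g.toBlocks₁₂ i ()

/-- `c u + d` for `g = [a b; c d]`. -/
def sDen (g : Matrix (Fin n ⊕ Unit) (Fin n ⊕ Unit) F) (u : Fin n → F) : F :=
  (g.toBlocks₂₁ *ᵥ u) () + g.toBlocks₂₂ () ()

theorem mulVec_elim (g : Matrix (Fin n ⊕ Unit) (Fin n ⊕ Unit) F) (u : Fin n → F) :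
    g *ᵥ Sum.elim u (fun _ => 1) = Sum.elim (sNum g u) (fun _ => sDen g u) := by
  conv_lhs => rw [← fromBlocks_toBlocks g]
  rw [fromBlocks_mulVec]
  funext i
  rcases i with i | i <;> simp [sNum, sDen, mulVec, dotProduct]

theorem sDen_eq_sNum [NormedAlgebra ℝ F] [NormSqStar F]
    (g : Matrix (Fin n ⊕ Unit) (Fin n ⊕ Unit) F) (hg : Preserves g) (u : Fin n → F)
    (hu : ∑ i, ‖u i‖ ^ 2 = 1) : ∑ i, ‖sNum g u i‖ ^ 2 = ‖sDen g u‖ ^ 2 := by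
  have key : ∀ (x : Fin n → F) (y : F),
      star (Sum.elim x (fun _ : Unit => y)) ⬝ᵥ
        (sig (Fin n) Unit F *ᵥ Sum.elim x (fun _ : Unit => y)) =
      algebraMap ℝ F (∑ i, ‖x i‖ ^ 2 - ‖y‖ ^ 2) := by
    intro x y
    rw [sig, fromBlocks_mulVec]
    simp [dotProduct, NormSqStar.star_mul_self, map_sum, sub_eq_add_neg, neg_mulVec]
  have h1 := key u 1
  have h2 := key (sNum g u) (sDen g u)
  rw [← mulVec_elim] at h2
  have h3 : star (g *ᵥ Sum.elim u (fun _ : Unit => (1 : F))) ⬝ᵥ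
      (sig (Fin n) Unit F *ᵥ (g *ᵥ Sum.elim u (fun _ : Unit => (1 : F)))) =
      star (Sum.elim u (fun _ : Unit => (1 : F))) ⬝ᵥ
        (sig (Fin n) Unit F *ᵥ Sum.elim u (fun _ : Unit => (1 : F))) := by
    rw [star_mulVec, ← dotProduct_mulVec, mulVec_mulVec, mulVec_mulVec, hg]
  rw [h3, h1] at h2
  have h4 := (algebraMap ℝ F).injective h2
  rw [hu] at h4
  simp at h4
  linarith

theorem sDen_ne_zero [NormedAlgebra ℝ F] [NormSqStar F]
    (g : (Matrix (Fin n ⊕ Unit) (Fin n ⊕ Unit) F)ˣ)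
    (hg : Preserves (g : Matrix (Fin n ⊕ Unit) (Fin n ⊕ Unit) F)) (u : Fin n → F)
    (hu : ∑ i, ‖u i‖ ^ 2 = 1) : sDen (g : Matrix (Fin n ⊕ Unit) (Fin n ⊕ Unit) F) u ≠ 0 := by
  intro h0
  have h1 := sDen_eq_sNum (g : Matrix (Fin n ⊕ Unit) (Fin n ⊕ Unit) F) hg u hu
  rw [h0] at h1
  simp only [norm_zero, ne_eq, OfNat.ofNat_ne_zero, not_false_eq_true, zero_pow] at h1
  rw [Finset.sum_eq_zero_iff_of_nonneg (fun i _ => by positivity)] at h1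
  have h2 : (g : Matrix (Fin n ⊕ Unit) (Fin n ⊕ Unit) F) *ᵥ Sum.elim u (fun _ => 1) = 0 := by
    rw [mulVec_elim]
    funext i
    rcases i with i | i
    · simpa using h1 i (Finset.mem_univ i)
    · simpa using h0
  have h3 : Sum.elim u (fun _ : Unit => (1 : F)) = 0 := by
    have h4 := congrArg (fun v => ((g⁻¹ : (Matrix (Fin n ⊕ Unit) (Fin n ⊕ Unit) F)ˣ) :
      Matrix (Fin n ⊕ Unit) (Fin n ⊕ Unit) F) *ᵥ v) h2
    simpa [mulVec_mulVec] using h4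
  have h5 := congrFun h3 (Sum.inr ())
  simp at h5

theorem sphere_sum (u : USphere F n) : ∑ i, ‖u.1 i‖ ^ 2 = 1 := by
  have h : ‖u.1‖ = 1 := by simpa using u.2
  rw [← PiLp.norm_sq_eq_of_L2, h]
  norm_num

theorem continuous_sNum (g : Matrix (Fin n ⊕ Unit) (Fin n ⊕ Unit) F) (i : Fin n) :
    Continuous fun u : USphere F n => sNum g (fun j => u.1 j) i := by
  unfold sNum mulVec dotProduct
  fun_prop

theorem continuous_sDen (g : Matrix (Fin n ⊕ Unit) (Fin n ⊕ Unit) F) :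
    Continuous fun u : USphere F n => sDen g (fun j => u.1 j) := by
  unfold sDen mulVec dotProduct
  fun_prop

/-- The action `u ↦ (a u + b)(c u + d)⁻¹` of `g = [a b; c d]` on the sphere. -/
def sphereAct [NormedAlgebra ℝ F] [NormSqStar F]
    (g : (Matrix (Fin n ⊕ Unit) (Fin n ⊕ Unit) F)ˣ)
    (hg : Preserves (g : Matrix (Fin n ⊕ Unit) (Fin n ⊕ Unit) F)) :
    C(USphere F n, USphere F n) where
  toFun u := ⟨WithLp.toLp 2 fun i => sNum g.1 (fun j => u.1 j) i * (sDen g.1 (fun j => u.1 j))⁻¹, by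
    have h0 := sDen_ne_zero g hg (fun j => u.1 j) (sphere_sum u)
    have h1 := sDen_eq_sNum g.1 hg (fun j => u.1 j) (sphere_sum u)
    rw [mem_sphere_zero_iff_norm, ← sq_eq_sq₀ (norm_nonneg _) zero_le_one,
      PiLp.norm_sq_eq_of_L2]
    simp only [norm_mul, norm_inv, mul_pow, ← Finset.sum_mul, h1]
    have : ‖sDen g.1 (fun j => u.1 j)‖ ≠ 0 := norm_ne_zero_iff.mpr h0
    field_simp⟩
  continuous_toFun := by
    refine Continuous.subtype_mk ?_ _
    refine (PiLp.continuous_toLp 2 _).comp (continuous_pi fun i => ?_)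
    exact (continuous_sNum g.1 i).mul
      ((continuous_sDen g.1).inv₀ fun u => sDen_ne_zero g hg _ (sphere_sum u))

/-- The function `u ↦ |c u + d|` on the sphere. -/
def sphereFactor (g : (Matrix (Fin n ⊕ Unit) (Fin n ⊕ Unit) F)ˣ) : C(USphere F n, ℝ) where
  toFun u := ‖sDen g.1 (fun j => u.1 j)‖
  continuous_toFun := (continuous_sDen g.1).norm

/-- `|1 - ⟨x, u⟩|` with the `𝔽`-valued inner product `⟨x, u⟩ = ∑ ūᵢ xᵢ`. -/
def sphereKernel (x u : USphere F n) : ℝ := ‖1 - ∑ i, star (u.1 i) * x.1 i‖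

end SphereAction

/-! ### Complex matrix balls -/

section MatrixBall

variable {p q : Type} [Fintype p] [Fintype q] [DecidableEq p] [DecidableEq q]

/-- The ball `{z | z* z < 1}` of complex `p × q` matrices. -/
def matBall (p q : Type) [Fintype p] [Fintype q] [DecidableEq p] [DecidableEq q] :
    Set (Matrix p q ℂ) :=
  {z | (1 - zᴴ * z).PosDef}

/-- `a z + b` for `g = [a b; c d]`. -/
def mNum (g : Matrix (p ⊕ q) (p ⊕ q) ℂ) (z : Matrix p q ℂ) : Matrix p q ℂ :=
  g.toBlocks₁₁ * z + g.toBlocks₁₂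

/-- `c z + d` for `g = [a b; c d]`. -/
def mDen (g : Matrix (p ⊕ q) (p ⊕ q) ℂ) (z : Matrix p q ℂ) : Matrix q q ℂ :=
  g.toBlocks₂₁ * z + g.toBlocks₂₂

/-- The fractional linear transformation `z ↦ (a z + b)(c z + d)⁻¹`. -/
def mobius (g : Matrix (p ⊕ q) (p ⊕ q) ℂ) (z : Matrix p q ℂ) : Matrix p q ℂ :=
  mNum g z * (mDen g z)⁻¹

theorem mNum_mDen (g : Matrix (p ⊕ q) (p ⊕ q) ℂ) (hg : Preserves g) (z : Matrix p q ℂ) :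
    (mDen g z)ᴴ * mDen g z - (mNum g z)ᴴ * mNum g z = 1 - zᴴ * z := by
  have h : (fromBlocks g.toBlocks₁₁ g.toBlocks₁₂ g.toBlocks₂₁ g.toBlocks₂₂)ᴴ * sig p q ℂ *
      fromBlocks g.toBlocks₁₁ g.toBlocks₁₂ g.toBlocks₂₁ g.toBlocks₂₂ = sig p q ℂ := by
    rw [fromBlocks_toBlocks]; exact hg
  rw [sig, fromBlocks_conjTranspose, fromBlocks_multiply, fromBlocks_multiply,
    fromBlocks_inj] at h
  simp only [Matrix.mul_one, Matrix.mul_zero, add_zero, zero_add, Matrix.mul_neg,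
    Matrix.neg_mul] at h
  obtain ⟨h1, h2, h3, h4⟩ := h
  unfold mNum mDen
  generalize g.toBlocks₁₁ = a at *
  generalize g.toBlocks₁₂ = b at *
  generalize g.toBlocks₂₁ = c at *
  generalize g.toBlocks₂₂ = d at *
  have e1 : cᴴ * c = aᴴ * a - 1 := by rw [← h1]; abel
  have e2 : cᴴ * d = aᴴ * b := by
    have := h2; rw [← sub_eq_add_neg, sub_eq_zero] at this; exact this.symm
  have e3 : dᴴ * c = bᴴ * a := by
    have := h3; rw [← sub_eq_add_neg, sub_eq_zero] at this; exact this.symm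
  have e4 : dᴴ * d = bᴴ * b + 1 := by
    have : bᴴ * b = -1 + dᴴ * d := by rw [← h4]; abel
    rw [this]; abel
  simp only [conjTranspose_add, conjTranspose_mul, Matrix.add_mul, Matrix.mul_add]
  have f1 : zᴴ * cᴴ * (c * z) = zᴴ * aᴴ * (a * z) - zᴴ * z := by
    rw [Matrix.mul_assoc, ← Matrix.mul_assoc cᴴ, e1]
    simp only [Matrix.sub_mul, Matrix.mul_sub, Matrix.one_mul, Matrix.mul_assoc]
  have f2 : zᴴ * cᴴ * d = zᴴ * aᴴ * b := by rw [Matrix.mul_assoc, e2, Matrix.mul_assoc]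
  have f3 : dᴴ * (c * z) = bᴴ * (a * z) := by rw [← Matrix.mul_assoc, e3, Matrix.mul_assoc]
  rw [f1, f2, f3, e4]
  abel

theorem isUnit_mDen (g : Matrix (p ⊕ q) (p ⊕ q) ℂ) (hg : Preserves g) (z : Matrix p q ℂ)
    (hz : z ∈ matBall p q) : IsUnit (mDen g z) := by
  have h : ((mDen g z)ᴴ * mDen g z).PosDef := by
    have h1 : (mDen g z)ᴴ * mDen g z = (1 - zᴴ * z) + (mNum g z)ᴴ * mNum g z := by
      rw [← mNum_mDen g hg z]; abel
    rw [h1]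
    exact PosDef.add_posSemidef hz (posSemidef_conjTranspose_mul_self _)
  have h2 := h.isUnit
  rw [isUnit_iff_isUnit_det, det_mul] at h2
  rw [isUnit_iff_isUnit_det]
  exact isUnit_of_mul_isUnit_right h2

theorem mobius_mem (g : Matrix (p ⊕ q) (p ⊕ q) ℂ) (hg : Preserves g) (z : Matrix p q ℂ)
    (hz : z ∈ matBall p q) : mobius g z ∈ matBall p q := by
  have hu := isUnit_mDen g hg z hz
  have hdet := (isUnit_iff_isUnit_det _).mp hu
  have h1 : 1 - (mobius g z)ᴴ * mobius g z =
      ((mDen g z)⁻¹)ᴴ * (1 - zᴴ * z) * (mDen g z)⁻¹ := by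
    rw [← mNum_mDen g hg z, mobius, conjTranspose_mul, Matrix.mul_sub, Matrix.sub_mul]
    congr 1
    · rw [Matrix.mul_assoc, Matrix.mul_assoc, mul_nonsing_inv _ hdet, Matrix.mul_one,
        ← conjTranspose_mul, mul_nonsing_inv _ hdet, conjTranspose_one]
    · simp only [Matrix.mul_assoc]
  show (1 - (mobius g z)ᴴ * mobius g z).PosDef
  rw [h1]
  refine PosDef.conjTranspose_mul_mul_same hz ?_
  have hinv : IsUnit (mDen g z)⁻¹ := by
    rw [isUnit_nonsing_inv_iff]; exact hu
  exact mulVec_injective_of_isUnit hinv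

end MatrixBall


/-! ### Complexification of real and quaternionic matrices -/

section Complexify

/-- The embedding `ℍ → M₂(ℂ)`, `a + bi + cj + dk ↦ [a + ib, c + id; -c + id, a - ib]`. -/
def quatMat : ℍ[ℝ] →+* Matrix (Fin 2) (Fin 2) ℂ where
  toFun x := !![(x.re : ℂ) + x.imI * Complex.I, (x.imJ : ℂ) + x.imK * Complex.I;
    -(x.imJ : ℂ) + x.imK * Complex.I, (x.re : ℂ) - x.imI * Complex.I]
  map_one' := by ext i j; fin_cases i <;> fin_cases j <;> simp
  map_zero' := by ext i j; fin_cases i <;> fin_cases j <;> simp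
  map_add' x y := by
    ext i j; fin_cases i <;> fin_cases j <;> simp <;> ring
  map_mul' x y := by
    ext i j
    fin_cases i <;> fin_cases j <;> simp [Matrix.mul_apply, Fin.sum_univ_two] <;> ring_nf <;>
      simp [Complex.I_sq] <;> ring

theorem quatMat_star (x : ℍ[ℝ]) : quatMat (star x) = (quatMat x)ᴴ := by
  ext i j
  fin_cases i <;> fin_cases j <;> simp [quatMat, conjTranspose_apply] <;> ring

/-- Index bookkeeping: `2(n+1) = 2n + 2`. -/
def quatIdx (n : ℕ) : (Fin n × Fin 2) ⊕ Fin 2 ≃ (Fin n ⊕ Unit) × Fin 2 where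
  toFun := Sum.elim (fun x => (Sum.inl x.1, x.2)) (fun k => (Sum.inr (), k))
  invFun x := match x with
    | (Sum.inl i, k) => Sum.inl (i, k)
    | (Sum.inr _, k) => Sum.inr k
  left_inv x := by rcases x with x | x <;> rfl
  right_inv x := by rcases x with ⟨x | x, k⟩ <;> rfl

/-- Replace every quaternionic entry of a matrix by its complex `2 × 2` block. -/
def quatCplx {n : ℕ} (g : Matrix (Fin n ⊕ Unit) (Fin n ⊕ Unit) ℍ[ℝ]) :
    Matrix ((Fin n × Fin 2) ⊕ Fin 2) ((Fin n × Fin 2) ⊕ Fin 2) ℂ :=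
  Matrix.of fun i j => quatMat (g (quatIdx n i).1 (quatIdx n j).1) (quatIdx n i).2 (quatIdx n j).2

theorem quatCplx_mul {n : ℕ} (g h : Matrix (Fin n ⊕ Unit) (Fin n ⊕ Unit) ℍ[ℝ]) :
    quatCplx (g * h) = quatCplx g * quatCplx h := by
  ext i j
  simp only [quatCplx, Matrix.mul_apply, of_apply, map_sum, map_mul, Matrix.sum_apply]
  rw [← (quatIdx n).symm.sum_comp, Fintype.sum_prod_type]
  simp

theorem quatCplx_conjTranspose {n : ℕ} (g : Matrix (Fin n ⊕ Unit) (Fin n ⊕ Unit) ℍ[ℝ]) :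
    quatCplx gᴴ = (quatCplx g)ᴴ := by
  ext i j
  simp only [quatCplx, of_apply, conjTranspose_apply, quatMat_star]

theorem quatCplx_sig (n : ℕ) :
    quatCplx (sig (Fin n) Unit ℍ[ℝ]) = sig (Fin n × Fin 2) (Fin 2) ℂ := by
  ext i j
  rcases i with ⟨i, k⟩ | k <;> rcases j with ⟨j, l⟩ | l
  · by_cases h : i = j
    · simp [quatCplx, sig, quatIdx, h, Matrix.one_apply]
    · simp [quatCplx, sig, quatIdx, h, Matrix.one_apply]
  · simp [quatCplx, sig, quatIdx]
  · simp [quatCplx, sig, quatIdx]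
  · simp [quatCplx, sig, quatIdx]

theorem preserves_quatCplx {n : ℕ} (g : Matrix (Fin n ⊕ Unit) (Fin n ⊕ Unit) ℍ[ℝ])
    (hg : Preserves g) : Preserves (quatCplx g) := by
  unfold Preserves
  rw [← quatCplx_conjTranspose, ← quatCplx_sig, ← quatCplx_mul, ← quatCplx_mul, hg]

/-- A real matrix regarded as a complex matrix. -/
def realCplx {n : ℕ} (g : Matrix (Fin n ⊕ Unit) (Fin n ⊕ Unit) ℝ) :
    Matrix (Fin n ⊕ Unit) (Fin n ⊕ Unit) ℂ :=
  g.map Complex.ofRealHom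

theorem preserves_realCplx {n : ℕ} (g : Matrix (Fin n ⊕ Unit) (Fin n ⊕ Unit) ℝ)
    (hg : Preserves g) : Preserves (realCplx g) := by
  have h1 : (realCplx g)ᴴ = gᴴ.map Complex.ofRealHom := by
    ext i j; simp [realCplx]
  have h2 : sig (Fin n) Unit ℂ = (sig (Fin n) Unit ℝ).map Complex.ofRealHom := by
    ext i j
    rcases i with i | i <;> rcases j with j | j <;> simp [sig, Matrix.one_apply, apply_ite]
  unfold Preserves
  rw [h1, h2, realCplx, ← Matrix.map_mul, ← Matrix.map_mul, hg]

end Complexify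

/-! ### The geometric data `S ⊂ ∂D ⊂ V`, `H ⊂ G` -/

/-- The data attached to a rank one group `H = SO₀(n, 1; 𝔽)` inside the Hermitian group `G`. Only
the three instances constructed below are ever used. -/
structure Model where
  /-- the sphere `S = L/M` -/
  S : Type
  [topS : TopologicalSpace S]
  [compS : CompactSpace S]
  [measS : MeasurableSpace S]
  [borelS : BorelSpace S]
  /-- the surface measure `ds` -/
  sigma : Measure S
  [finS : IsFiniteMeasure sigma]
  /-- `|1 - ⟨x, u⟩|` on `S × S` -/
  kn : S → S → ℝ
  /-- the complex vector space containing the bounded domain `D = G/K` -/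
  V : Type
  [normV : NormedAddCommGroup V]
  [spaceV : NormedSpace ℂ V]
  /-- the bounded domain -/
  D : Set V
  /-- `Φ : V → ℂ` counts as holomorphic when `Φ ∘ coord` is; it is the identity except for `𝔽 = ℂ`,
  where it conjugates the second factor of `ℂⁿ ⊕ conj(ℂⁿ)` -/
  coord : V → V
  /-- the embedding of `S` in the boundary of `D` -/
  emb : S → V
  /-- the polynomial `h(z, w)` -/
  h : V → V → ℂ
  /-- the group `H` -/
  H : Type
  [groupH : Group H]
  /-- `g ↦ (u ↦ (a u + b)(c u + d)⁻¹)` -/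
  actS : H → C(S, S)
  /-- `g ↦ (u ↦ |c u + d|)` -/
  facS : H → C(S, ℝ)
  facS_ne : ∀ g u, facS g u ≠ 0
  /-- the action of `H ⊂ G` on `D` -/
  actD : H → D → D
  /-- the automorphy factor `det(c z + d)` of `H ⊂ G` on `D` -/
  facD : H → D → ℂ

attribute [instance] Model.topS Model.compS Model.measS Model.borelS Model.finS Model.normV
  Model.spaceV Model.groupH

section Models

attribute [local instance] Matrix.normedAddCommGroup Matrix.normedSpace

theorem mem_of_mem_idComponent {A : Type} [Ring A] [TopologicalSpace A] [IsTopologicalRing A]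
    {G : Subgroup Aˣ} {g : Aˣ} (hg : g ∈ idComponent G) : g ∈ G := by
  obtain ⟨x, _, rfl⟩ := hg
  exact x.2

/-- `H = SO₀(n, 1) ⊂ G = SU(n, 1)`, acting on the unit ball `D` of `ℂⁿ`. -/
def realModel (n : ℕ) : Model where
  S := USphere ℝ n
  sigma := (volume : Measure (EuclideanSpace ℝ (Fin n))).toSphere
  kn := sphereKernel
  V := Matrix (Fin n) Unit ℂ
  D := matBall (Fin n) Unit
  coord := id
  emb s := Matrix.of fun i _ => (s.1 i : ℂ)
  h z w := (1 - wᴴ * z).det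
  H := idComponent (specialIndefUnitary (Fin n) Unit ℝ)
  actS g := sphereAct g.1 (mem_of_mem_idComponent g.2).1
  facS g := sphereFactor g.1
  facS_ne g u := norm_ne_zero_iff.mpr
    (sDen_ne_zero g.1 (mem_of_mem_idComponent g.2).1 _ (sphere_sum u))
  actD g z := ⟨mobius (realCplx g.1.1) z.1, mobius_mem _
    (preserves_realCplx _ (mem_of_mem_idComponent g.2).1) _ z.2⟩
  facD g z := (mDen (realCplx g.1.1) z.1).det

/-- `H = SU(n, 1)` diagonally in `G = SU(n, 1) × SU(n, 1)`, acting on `D ⊂ ℂⁿ ⊕ conj(ℂⁿ)`, the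
product of two unit balls. -/
def complexModel (n : ℕ) : Model where
  S := USphere ℂ n
  sigma := (volume : Measure (EuclideanSpace ℂ (Fin n))).toSphere
  kn := sphereKernel
  V := Matrix (Fin n) Unit ℂ × Matrix (Fin n) Unit ℂ
  D := matBall (Fin n) Unit ×ˢ matBall (Fin n) Unit
  coord z := (z.1, z.2.map conj)
  emb s := (Matrix.of fun i _ => s.1 i, Matrix.of fun i _ => s.1 i)
  h z w := (1 - w.1ᴴ * z.1).det * (1 - z.2ᴴ * w.2).det
  H := idComponent (specialIndefUnitary (Fin n) Unit ℂ)
  actS g := sphereAct g.1 (mem_of_mem_idComponent g.2).1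
  facS g := sphereFactor g.1
  facS_ne g u := norm_ne_zero_iff.mpr
    (sDen_ne_zero g.1 (mem_of_mem_idComponent g.2).1 _ (sphere_sum u))
  actD g z := ⟨(mobius g.1.1 z.1.1, mobius g.1.1 z.1.2),
    mobius_mem _ (mem_of_mem_idComponent g.2).1 _ z.2.1,
    mobius_mem _ (mem_of_mem_idComponent g.2).1 _ z.2.2⟩
  facD g z := (mDen g.1.1 z.1.1).det * conj (mDen g.1.1 z.1.2).det

/-- `H = Sp(n, 1) ⊂ G = SU(2n, 2)`, acting on the matrix ball `D` in `M_{2n,2}(ℂ)`. -/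
def quaternionModel (n : ℕ) : Model where
  S := USphere ℍ[ℝ] n
  sigma := (volume : Measure (EuclideanSpace ℍ[ℝ] (Fin n))).toSphere
  kn := sphereKernel
  V := Matrix (Fin n × Fin 2) (Fin 2) ℂ
  D := matBall (Fin n × Fin 2) (Fin 2)
  coord := id
  emb s := Matrix.of fun i k => quatMat (s.1 i.1) i.2 k
  h z w := (1 - wᴴ * z).det
  H := idComponent (indefUnitary (Fin n) Unit ℍ[ℝ])
  actS g := sphereAct g.1 (mem_of_mem_idComponent g.2)
  facS g := sphereFactor g.1
  facS_ne g u := norm_ne_zero_iff.mpr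
    (sDen_ne_zero g.1 (mem_of_mem_idComponent g.2) _ (sphere_sum u))
  actD g z := ⟨mobius (quatCplx g.1.1) z.1, mobius_mem _
    (preserves_quatCplx _ (mem_of_mem_idComponent g.2)) _ z.2⟩
  facD g z := (mDen (quatCplx g.1.1) z.1).det

end Models

/-- The three base fields. -/
inductive BaseField
  | real
  | complex
  | quaternion

/-- The geometric data for `H = SO₀(n, 1; 𝔽)`. -/
def model : BaseField → ℕ → Model
  | .real => realModel
  | .complex => complexModel
  | .quaternion => quaternionModel

/-- The lower end of the continuous part of the Wallach set. -/
def wallach : BaseField → ℝ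
  | .real => 0
  | .complex => 0
  | .quaternion => 1

/-- The half sum of positive roots `ρ = ρ_H`. -/
def rho : BaseField → ℕ → ℝ
  | .real, n => (n - 1) / 2
  | .complex, n => n
  | .quaternion, n => 2 * n + 1

/-- The parameter `μ` attached to `ν`. -/
def mu : BaseField → ℝ → ℝ
  | .real, ν => ν
  | .complex, ν => 2 * ν
  | .quaternion, ν => 2 * ν

/-! ### Hilbert completions -/

/-- A Hilbert space completion of a complex vector space `A` with respect to the (semi)norm `N`. -/
structure HilbertCompletion (A : Type) [AddCommGroup A] [Module ℂ A] (N : A → ℝ) where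
  carrier : Type
  [normedAddCommGroup : NormedAddCommGroup carrier]
  [innerProductSpace : InnerProductSpace ℂ carrier]
  [completeSpace : CompleteSpace carrier]
  ι : A →ₗ[ℂ] carrier
  norm_ι : ∀ a, ‖ι a‖ = N a
  dense : DenseRange ι

attribute [instance] HilbertCompletion.normedAddCommGroup HilbertCompletion.innerProductSpace
  HilbertCompletion.completeSpace

namespace Model

variable (M : Model)

/-- The reproducing kernel `h(z, w)^{-ν}`. The values `h(z, w)` avoid the closed negative half-line,
so the principal power is the holomorphic branch with value `1` at `w = 0`. -/
def kernel (ν : ℝ) (z w : M.D) : ℂ := M.h z w ^ (-ν : ℂ)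

/-- The spherical principal series action
`(π_λ(g) f)(u) = |c u + d|^{-λ} f((a u + b)(c u + d)⁻¹)`, `g⁻¹ = [a b; c d]`, on `C(S)`. -/
def ps (l : ℝ) (g : M.H) (f : C(M.S, ℂ)) : C(M.S, ℂ) where
  toFun u := ((M.facS g⁻¹ u ^ (-l) : ℝ) : ℂ) * f (M.actS g⁻¹ u)
  continuous_toFun := by
    refine (Complex.continuous_ofReal.comp ?_).mul (f.continuous.comp (M.actS g⁻¹).continuous)
    exact (M.facS g⁻¹).continuous.rpow_const fun u => Or.inl (M.facS_ne g⁻¹ u)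

/-- The pairing `(f, g) = ∫_S f ḡ ds`. -/
def pairing (f g : C(M.S, ℂ)) : ℂ := ∫ s, f s * conj (g s) ∂M.sigma

/-- The Knapp-Stein operator `(Λ_μ f)(x) = ∫_S f(u) |1 - ⟨x, u⟩|^{-μ} du`. -/
def knappStein (μ : ℝ) (f : C(M.S, ℂ)) (x : M.S) : ℂ :=
  ∫ u, f u * ((M.kn x u ^ (-μ) : ℝ) : ℂ) ∂M.sigma

/-- The norm `(Λ_μ f, f)^{1/2}` of the complementary series with parameter `2ρ - μ`. -/
def upperNorm (μ : ℝ) (f : C(M.S, ℂ)) : ℝ :=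
  √(∫ x, M.knappStein μ f x * conj (f x) ∂M.sigma).re

/-- The complementary series `π_{2ρ-μ}` for `μ < ρ`: the completion of `C(S)` in the norm
`(Λ_μ f, f)^{1/2}`. -/
abbrev UpperSeries (μ : ℝ) : Type 1 := HilbertCompletion C(M.S, ℂ) (M.upperNorm μ)

theorem integrable_mul_conj (f g : C(M.S, ℂ)) :
    Integrable (fun s => f s * conj (g s)) M.sigma :=
  (f.continuous.mul (Complex.continuous_conj.comp g.continuous)).integrable_of_hasCompactSupport
    (HasCompactSupport.of_compactSpace _)

/-- The continuous functions `g` for which the invariant norm of `π_μ` is finite. -/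
def lowerSpace (μ : ℝ) : Submodule ℂ C(M.S, ℂ) where
  carrier := {g | ∃ C : ℝ, ∀ f, ‖M.pairing g f‖ ≤ C * M.upperNorm μ f}
  zero_mem' := ⟨0, fun f => by simp [pairing]⟩
  add_mem' := by
    rintro a b ⟨C, hC⟩ ⟨C', hC'⟩
    refine ⟨C + C', fun f => ?_⟩
    have h : M.pairing (a + b) f = M.pairing a f + M.pairing b f := by
      unfold pairing
      rw [← integral_add (M.integrable_mul_conj a f) (M.integrable_mul_conj b f)]
      simp [add_mul]
    rw [h, add_mul]
    exact (norm_add_le _ _).trans (add_le_add (hC f) (hC' f))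
  smul_mem' := by
    rintro c a ⟨C, hC⟩
    refine ⟨‖c‖ * C, fun f => ?_⟩
    have h : M.pairing (c • a) f = c * M.pairing a f := by
      unfold pairing
      rw [← integral_const_mul]
      simp [mul_assoc]
    rw [h, norm_mul, mul_assoc]
    exact mul_le_mul_of_nonneg_left (hC f) (norm_nonneg c)

/-- The norm `(Λ_μ⁻¹ g, g)^{1/2}` of the complementary series with parameter `μ < ρ`, written as
`sup {|(g, f)| : (Λ_μ f, f) ≤ 1}`. (The Knapp-Stein operator `Λ_{2ρ-μ} : π_μ → π_{2ρ-μ}`, obtained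
by continuation in the parameter, is a multiple of the inverse of `Λ_μ : π_{2ρ-μ} → π_μ`.) -/
def lowerNorm (μ : ℝ) (g : M.lowerSpace μ) : ℝ :=
  sSup {t : ℝ | ∃ f, M.upperNorm μ f ≤ 1 ∧ t = ‖M.pairing g f‖}

/-- The complementary series `π_μ` for `μ < ρ`. -/
abbrev LowerSeries (μ : ℝ) : Type 1 := HilbertCompletion (M.lowerSpace μ) (M.lowerNorm μ)

/-- `F : D → ℂ` extends to a holomorphic function on a neighbourhood of the closure of `D`, and `g`
is the restriction of that extension to `S`. -/
def IsRestriction (F : M.D → ℂ) (g : C(M.S, ℂ)) : Prop :=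
  ∃ (W : Set M.V) (Φ : M.V → ℂ), IsOpen W ∧ closure M.D ⊆ W ∧
    DifferentiableOn ℂ (Φ ∘ M.coord) (M.coord ⁻¹' W) ∧
    (∀ z : M.D, Φ z = F z) ∧ ∀ s, g s = Φ (M.emb s)

/-- The integral operator `(J_ν f)(z) = ∫_S f(s) h(z, s)^{-ν} ds`. -/
def J (ν : ℝ) (f : C(M.S, ℂ)) (z : M.D) : ℂ :=
  ∫ s, f s * M.h z (M.emb s) ^ (-ν : ℂ) ∂M.sigma

end Model

end RankOne

end

noncomputable section

namespace RankOne

open MeasureTheory Matrix Filter Topology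
open scoped ComplexOrder ComplexConjugate Quaternion ENNReal

section

/-! ### Weighted composition operators on reproducing kernel Hilbert spaces -/

section WeightedComposition

/-! On the sphere the reproducing kernel becomes the Knapp–Stein kernel: `h(rs, tu)^{-ν} = |1 -
rt⟨s, u⟩|^{-μ}`, where `⟨s, u⟩` is `𝔽`-valued. In `H_ν` consider the averages `∫ f(s) K_{rs} ds` for
`r < 1`. The inner product of the averages with radii `r` and `t` depends on the radii only through
`rt`, and it tends to `(Λ_μ f, f')` as `rt → 1` when `|1 - ⟨s, u⟩|^{-μ}` is integrable on `S × S`.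
Hence the averages form a Cauchy sequence, their limit is the function `J_ν f`, and `‖J_ν f‖² = (Λ_μ
f, f)`. This single computation (`exists_J`) yields the positivity of the Knapp–Stein form, the
existence of `π_{2ρ-μ}` as the closure of the range of `J_ν`, and an isometry `J` of `π_{2ρ-μ}` into
`H_ν`.

The pairing of an average with `φ` is `∫ f̄(s) φ(rs) ds`. For `φ` holomorphic across the closure of
`D` its limit is an integral over the sphere, so `J* φ` represents the restriction of `φ`. The norm
of `π_μ` is the dual norm, hence Riesz representation identifies `π_μ` isometrically with
`π_{2ρ-μ}`; the image is dense because the kernel functions `K_z` themselves extend across the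
boundary and `J` is injective. The operator `R` is `J*` read through this identification. It is
unique because the `K_z` span a dense subspace. Unitarity of `π_{2ρ-μ}` is inherited from `U_ν`
through `J`, and that of `π_μ` follows by transport.

If conversely `J_ν 1` lies in `H_ν`, put `G(r) = ∬ |1 - r⟨s, u⟩|^{-μ}`. Cauchy–Schwarz against the
average of radius `r` gives `G(r)² ≤ C G(r²)`, and iteration gives `G ≤ C` (`le_of_sq_le_mul_sq`).
Boundedness of `G` forces `μ < ρ`.

The analysis on the sphere rests on the Jacobian `|cu + d|^{-2ρ}` of the action
(`integral_sphereAct`). It comes from the linear action on `𝔽ⁿ × 𝔽`, which preserves Lebesgue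
measure: dividing out the last coordinate gives the Jacobian on the ball (`lintegral_ballAct`), and
measures concentrating at the boundary carry it to the sphere. Applied to a boost it evaluates `∫ |1
- r⟨u, e⟩|^{-2ρ} du` exactly (`integral_radialKernel`), and this controls both directions of the
integrability criterion.

Positivity of `h^{-ν}` uses `B^{-ν} = Γ(ν)⁻¹ ∫ t^{ν-1} e^{-tB} dt`. For the quaternionic case the
determinant is split into an entry and its Schur complement, and `e^{-tB}` for the Schur complement
arises from a Gaussian integral over `ℂ`; the leftover power of the entry is `-(ν - 1)`, whence `ν >
1`. Identities for principal powers are obtained from multiplicative ones by connectedness of `D`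
(`cpow_mul_of_preconnected`). -/

theorem norm_linearCombination_eq {X H H' : Type*} [NormedAddCommGroup H] [InnerProductSpace ℂ H]
    [NormedAddCommGroup H'] [InnerProductSpace ℂ H'] (u : X → H) (v : X → H')
    (h : ∀ x y, inner ℂ (u x) (u y) = inner ℂ (v x) (v y)) (c : X →₀ ℂ) :
    ‖Finsupp.linearCombination ℂ u c‖ = ‖Finsupp.linearCombination ℂ v c‖ := by
  have key : inner ℂ (Finsupp.linearCombination ℂ u c) (Finsupp.linearCombination ℂ u c) =
      inner ℂ (Finsupp.linearCombination ℂ v c) (Finsupp.linearCombination ℂ v c) := by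
    simp only [Finsupp.linearCombination_apply, Finsupp.sum_inner, Finsupp.inner_sum,
      inner_smul_left, inner_smul_right, h]
  rw [inner_self_eq_norm_sq_to_K, inner_self_eq_norm_sq_to_K] at key
  have : ‖Finsupp.linearCombination ℂ u c‖ ^ 2 = ‖Finsupp.linearCombination ℂ v c‖ ^ 2 := by
    exact_mod_cast key
  exact (sq_eq_sq₀ (norm_nonneg _) (norm_nonneg _)).mp this

variable {X H : Type} [NormedAddCommGroup H] [InnerProductSpace ℂ H] [CompleteSpace H]
  [RKHS ℂ H X ℂ]

theorem inner_kerFun_one (x : X) (φ : H) : inner ℂ (RKHS.kerFun H x (1 : ℂ)) φ = φ x := by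
  simp

theorem inner_kerFun_kerFun (x y : X) :
    inner ℂ (RKHS.kerFun H x (1 : ℂ)) (RKHS.kerFun H y (1 : ℂ)) = RKHS.kernel H x y (1 : ℂ) := by
  rw [inner_kerFun_one, RKHS.kerFun_apply]

variable (H) in
theorem denseRange_kerFun :
    DenseRange (Finsupp.linearCombination ℂ fun x => RKHS.kerFun H x (1 : ℂ)) := by
  have h := RKHS.kerFun_dense H
  rw [DenseRange, ← LinearMap.coe_range, Finsupp.range_linearCombination,
    Submodule.dense_iff_topologicalClosure_eq_top, ← h]
  congr 1
  apply le_antisymm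
  · refine Submodule.span_mono ?_
    rintro _ ⟨x, rfl⟩
    exact ⟨x, 1, rfl⟩
  · refine Submodule.span_le.mpr ?_
    rintro _ ⟨x, v, rfl⟩
    have : RKHS.kerFun H x v = v • RKHS.kerFun H x (1 : ℂ) := by
      rw [← map_smul]; simp
    rw [this]
    exact Submodule.smul_mem _ _ (Submodule.subset_span ⟨x, rfl⟩)

/-- The operator is built as an adjoint. The assumed kernel identity says that `K_x ↦ conj (m x)
K_{a x}` preserves the Gram matrix of the kernel functions, so it extends from their dense span to
an isometry of `H`. Its adjoint is a contraction and, by the reproducing property, is weighted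
composition. -/
theorem exists_weightedComp (m : X → ℂ) (a : X → X)
    (hK : ∀ x y, m x * conj (m y) * RKHS.kernel H (a x) (a y) (1 : ℂ) =
      RKHS.kernel H x y (1 : ℂ)) :
    ∃ T : H →L[ℂ] H, (∀ φ, ‖T φ‖ ≤ ‖φ‖) ∧ ∀ φ x, T φ x = m x * φ (a x) := by
  set e := Finsupp.linearCombination ℂ fun x => RKHS.kerFun H x (1 : ℂ)
  set f := Finsupp.linearCombination ℂ fun x => conj (m x) • RKHS.kerFun H (a x) (1 : ℂ)
  have hn : ∀ c, ‖f c‖ ≤ 1 * ‖e c‖ := fun c => by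
    rw [one_mul]
    refine (norm_linearCombination_eq _ _ (fun x y => ?_) c).le
    rw [inner_smul_left, inner_smul_right, inner_kerFun_kerFun, inner_kerFun_kerFun, ← hK x y]
    simp [mul_assoc]
  have hd : DenseRange e := denseRange_kerFun H
  set V := f.extendOfNorm e
  have hV : ‖V‖ ≤ 1 := LinearMap.opNorm_extendOfNorm_le hd zero_le_one hn
  refine ⟨V.adjoint, fun φ => ?_, fun φ x => ?_⟩
  · refine (V.adjoint.le_of_opNorm_le ?_ φ).trans_eq (one_mul _)
    rwa [LinearIsometryEquiv.norm_map]
  · have h1 : V (RKHS.kerFun H x (1 : ℂ)) = conj (m x) • RKHS.kerFun H (a x) (1 : ℂ) := by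
      have := LinearMap.extendOfNorm_eq hd ⟨1, hn⟩ (Finsupp.single x 1)
      simpa [e, f, V] using this
    rw [← inner_kerFun_one, ContinuousLinearMap.adjoint_inner_right, h1, inner_smul_left,
      inner_kerFun_one]
    simp

/-- A multiplier cocycle under which the kernel is invariant defines a unitary representation. -/
theorem exists_unitary_rep {G : Type} [Group G] (a : G → X → X) (j : G → X → ℂ)
    (ha1 : ∀ x, a 1 x = x) (ha : ∀ g k x, a (g * k) x = a g (a k x))
    (hj1 : ∀ x, j 1 x = 1) (hj : ∀ g k x, j (g * k) x = j g (a k x) * j k x)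
    (hK : ∀ g x y, j g x * conj (j g y) * RKHS.kernel H (a g x) (a g y) (1 : ℂ) =
      RKHS.kernel H x y (1 : ℂ)) :
    ∃ U : G →* (H ≃ₗᵢ[ℂ] H), ∀ g φ x, U g φ x = j g⁻¹ x * φ (a g⁻¹ x) := by
  choose T hT1 hT2 using fun g => exists_weightedComp (H := H) (j g⁻¹) (a g⁻¹) (hK g⁻¹)
  have hmul : ∀ g k φ, T (g * k) φ = T g (T k φ) := by
    intro g k φ
    ext x
    rw [hT2, hT2, hT2, _root_.mul_inv_rev, hj, ha]
    ring
  have hone : ∀ φ, T 1 φ = φ := by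
    intro φ
    ext x
    rw [hT2, inv_one, ha1, hj1, one_mul]
  have hinv : ∀ g φ, T g (T g⁻¹ φ) = φ := fun g φ => by rw [← hmul, mul_inv_cancel, hone]
  have hinv' : ∀ g φ, T g⁻¹ (T g φ) = φ := fun g φ => by rw [← hmul, inv_mul_cancel, hone]
  -- The inverse `T g⁻¹` is a contraction as well, so `T g` is isometric.
  have hle : ∀ g φ, ‖φ‖ ≤ ‖T g φ‖ := fun g φ => by
    have := hT1 g⁻¹ (T g φ)
    rwa [hinv'] at this
  let U : G → (H ≃ₗᵢ[ℂ] H) := fun g =>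
    { toLinearEquiv :=
        { (T g : H →ₗ[ℂ] H) with
          invFun := T g⁻¹
          left_inv := hinv' g
          right_inv := hinv g }
      norm_map' := fun φ => le_antisymm (hT1 g φ) (hle g φ) }
  refine ⟨{ toFun := U, map_one' := ?_, map_mul' := fun g k => ?_ }, hT2⟩
  · ext1 φ; exact hone φ
  · ext1 φ; exact hmul g k φ

end WeightedComposition

end

section

/-! ### Sequences controlled by their Gram matrix -/

section Gram

variable {H : Type*} [NormedAddCommGroup H] [InnerProductSpace ℂ H]

theorem norm_sub_eq_sqrt_inner (a b : H) :
    ‖a - b‖ = √(inner ℂ a a - inner ℂ a b - inner ℂ b a + inner ℂ b b : ℂ).re := by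
  rw [← inner_sub_sub_self, ← RCLike.re_eq_complex_re, inner_self_eq_norm_sq,
    Real.sqrt_sq (norm_nonneg _)]

/-- The square of `‖u y - u x‖` is an alternating sum of four values of the Gram kernel. It is
continuous in `y` and vanishes at `y = x`. -/
theorem continuous_of_continuous_inner {X : Type*} [TopologicalSpace X] {u : X → H}
    (h : Continuous fun p : X × X => inner ℂ (u p.1) (u p.2)) : Continuous u := by
  rw [continuous_iff_continuousAt]
  intro x
  rw [ContinuousAt, tendsto_iff_norm_sub_tendsto_zero]
  have h2 : Continuous fun y => ‖u y - u x‖ := by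
    simp only [norm_sub_eq_sqrt_inner]
    have h3 : ∀ a b : X → X, Continuous a → Continuous b →
        Continuous fun y => inner ℂ (u (a y)) (u (b y)) := fun a b ha hb =>
      h.comp (ha.prodMk hb)
    exact Real.continuous_sqrt.comp (Complex.continuous_re.comp
      ((((h3 id id continuous_id continuous_id).sub
        (h3 id (fun _ => x) continuous_id continuous_const)).sub
        (h3 (fun _ => x) id continuous_const continuous_id)).add
        (h3 (fun _ => x) (fun _ => x) continuous_const continuous_const)))
  have := h2.tendsto x
  simpa using this

/-- In the expansion of `‖u m - u n‖²` all four inner products have the same limit `L`, with signs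
adding up to zero. The limit has to be a joint one in both indices. -/
theorem cauchySeq_of_tendsto_inner {u : ℕ → H} {L : ℂ}
    (h : Tendsto (fun p : ℕ × ℕ => inner ℂ (u p.1) (u p.2)) atTop (𝓝 L)) : CauchySeq u := by
  rw [cauchySeq_iff_tendsto_dist_atTop_0]
  simp only [dist_eq_norm, norm_sub_eq_sqrt_inner]
  have h1 : Tendsto (fun p : ℕ × ℕ => (p.1, p.1)) atTop atTop := by
    rw [← prod_atTop_atTop_eq]; exact tendsto_fst.prodMk tendsto_fst
  have h2 : Tendsto (fun p : ℕ × ℕ => (p.2, p.2)) atTop atTop := by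
    rw [← prod_atTop_atTop_eq]; exact tendsto_snd.prodMk tendsto_snd
  have h3 : Tendsto (fun p : ℕ × ℕ => (p.2, p.1)) atTop atTop := by
    rw [← prod_atTop_atTop_eq]; exact tendsto_snd.prodMk tendsto_fst
  have h4 := (((h.comp h1).sub h).sub (h.comp h3)).add (h.comp h2)
  have h5 := (Real.continuous_sqrt.comp Complex.continuous_re).continuousAt.tendsto.comp h4
  simpa [Function.comp_def] using h5

end Gram

/-- The properties of a model on which the construction of the intertwining operators rests:
covariance of the kernel in the domain and up to the boundary, the Jacobian of the action on the
sphere, and the integrability of the boundary kernel. The function `k r s t` is the value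
`|1 - r⟨s, t⟩|`. -/
structure Model.IsCovariant (M : Model) (k : ℝ → M.S → M.S → ℝ) (ν μ ρ : ℝ) : Prop where
  secondCountable : SecondCountableTopology M.S
  psd : (Matrix.of (M.kernel ν)).PosSemidef
  actD_one : ∀ z, M.actD 1 z = z
  actD_mul : ∀ g g' z, M.actD (g * g') z = M.actD g (M.actD g' z)
  facD_one : ∀ z, M.facD 1 z ^ (-ν : ℂ) = 1
  facD_mul : ∀ g g' z, M.facD (g * g') z ^ (-ν : ℂ) =
    M.facD g (M.actD g' z) ^ (-ν : ℂ) * M.facD g' z ^ (-ν : ℂ)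
  kernel_act : ∀ g z w, M.facD g z ^ (-ν : ℂ) * conj (M.facD g w ^ (-ν : ℂ)) *
    M.kernel ν (M.actD g z) (M.actD g w) = M.kernel ν z w
  actS_one : ∀ s, M.actS 1 s = s
  actS_mul : ∀ g g' s, M.actS (g * g') s = M.actS g (M.actS g' s)
  facS_pos : ∀ g s, 0 < M.facS g s
  facS_one : ∀ s, M.facS 1 s = 1
  facS_mul : ∀ g g' s, M.facS (g * g') s = M.facS g (M.actS g' s) * M.facS g' s
  boundary_act : ∀ g (z : M.D) s, M.facD g z ^ (-ν : ℂ) *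
    M.h (M.actD g z) (M.emb (M.actS g s)) ^ (-ν : ℂ) * ((M.facS g s ^ (-μ) : ℝ) : ℂ) =
    M.h z (M.emb s) ^ (-ν : ℂ)
  integral_act : ∀ g (f : C(M.S, ℂ)),
    ∫ s, ((M.facS g s ^ (-(2 * ρ)) : ℝ) : ℂ) * f (M.actS g s) ∂M.sigma = ∫ s, f s ∂M.sigma
  smul_emb_mem : ∀ r : ℝ, 0 ≤ r → r < 1 → ∀ s, r • M.emb s ∈ M.D
  continuous_emb : Continuous M.emb
  continuous_h : Continuous fun p : M.V × M.V => M.h p.1 p.2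
  slit : ∀ z ∈ M.D, ∀ w ∈ closure M.D, M.h z w ∈ Complex.slitPlane
  conj_h : ∀ z w, conj (M.h z w) = M.h w z
  h_smul_emb : ∀ r : ℝ, 0 ≤ r → r < 1 → ∀ t : ℝ, 0 ≤ t → t ≤ 1 → ∀ s u,
    M.h (r • M.emb s) (t • M.emb u) ^ (-ν : ℂ) = ((k (r * t) s u ^ (-μ) : ℝ) : ℂ)
  continuous_k : Continuous fun p : ℝ × M.S × M.S => k p.1 p.2.1 p.2.2
  k_zero : ∀ s u, k 0 s u = 1
  k_one : ∀ s u, k 1 s u = M.kn s u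
  kn_le : ∀ r : ℝ, 0 ≤ r → r ≤ 1 → ∀ s u, M.kn s u ≤ 2 * k r s u
  mu_pos : 0 < μ
  kn_pos : μ < ρ → ∀ᵐ p ∂M.sigma.prod M.sigma, 0 < M.kn p.1 p.2
  integrable_kn : μ < ρ → Integrable (fun p : M.S × M.S => M.kn p.1 p.2 ^ (-μ))
    (M.sigma.prod M.sigma)
  lt_of_bounded : (∃ C, ∀ r : ℝ, 0 ≤ r → r < 1 →
    ∫ x, ∫ u, k r x u ^ (-μ) ∂M.sigma ∂M.sigma ≤ C) → μ < ρ
  continuous_coord : Continuous M.coord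
  coord_coord : ∀ z, M.coord (M.coord z) = z
  differentiable_h : ∀ w, Differentiable ℂ fun z => M.h (M.coord z) w

/-! ### Radial approach to the boundary sphere. -/

namespace Model.IsCovariant

variable {M : Model} {k : ℝ → M.S → M.S → ℝ} {ν μ ρ : ℝ} (hM : M.IsCovariant k ν μ ρ)
include hM

theorem emb_mem_closure (s : M.S) : M.emb s ∈ closure M.D := by
  have h1 : Tendsto (fun r : ℝ => r • M.emb s) (𝓝[<] 1) (𝓝 (M.emb s)) := by
    have : Continuous fun r : ℝ => r • M.emb s := by fun_prop
    simpa using (this.tendsto 1).mono_left nhdsWithin_le_nhds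
  refine mem_closure_of_tendsto h1 ?_
  filter_upwards [Ioo_mem_nhdsLT (show (0 : ℝ) < 1 by norm_num)] with r hr
  exact hM.smul_emb_mem r hr.1.le hr.2 s

theorem smul_emb_mem_closure {r : ℝ} (h0 : 0 ≤ r) (h1 : r ≤ 1) (s : M.S) :
    r • M.emb s ∈ closure M.D := by
  rcases h1.eq_or_lt with rfl | h1
  · simpa using hM.emb_mem_closure s
  · exact subset_closure (hM.smul_emb_mem r h0 h1 s)

/-- The point `r s` of the domain. -/
def point (r : Set.Ico (0 : ℝ) 1) (s : M.S) : M.D :=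
  ⟨(r : ℝ) • M.emb s, hM.smul_emb_mem r r.2.1 r.2.2 s⟩

theorem continuous_point (r : Set.Ico (0 : ℝ) 1) : Continuous (hM.point r) :=
  (hM.continuous_emb.const_smul (r : ℝ)).subtype_mk _

theorem continuous_kernel : Continuous fun p : M.D × M.D => M.kernel ν p.1 p.2 := by
  unfold Model.kernel
  refine Continuous.cpow ?_ continuous_const fun p =>
    hM.slit _ p.1.2 _ (subset_closure p.2.2)
  exact hM.continuous_h.comp
    ((continuous_subtype_val.comp continuous_fst).prodMk (continuous_subtype_val.comp continuous_snd))

theorem continuous_h_smul_emb (z : M.D) :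
    Continuous fun p : Set.Icc (0 : ℝ) 1 × M.S =>
      M.h z ((p.1 : ℝ) • M.emb p.2) ^ (-ν : ℂ) := by
  refine Continuous.cpow ?_ continuous_const fun p =>
    hM.slit _ z.2 _ (hM.smul_emb_mem_closure p.1.2.1 p.1.2.2 p.2)
  exact hM.continuous_h.comp (continuous_const.prodMk
    ((continuous_subtype_val.comp continuous_fst).smul (hM.continuous_emb.comp continuous_snd)))

theorem conj_cpow_h {z w : M.V} (hz : z ∈ M.D) (hw : w ∈ closure M.D) :
    conj (M.h z w ^ (-ν : ℂ)) = M.h w z ^ (-ν : ℂ) := by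
  rw [← hM.conj_h z w, Complex.conj_cpow _ _ (Complex.slitPlane_arg_ne_pi (hM.slit z hz w hw))]
  simp

end Model.IsCovariant

end

section

namespace Model.IsCovariant

variable {M : Model} {k : ℝ → M.S → M.S → ℝ} {ν μ ρ : ℝ} (hM : M.IsCovariant k ν μ ρ)
include hM

/-! ### Convergence of the Gram integrals -/

/-- From `kn ≤ 2 k r` and `μ > 0` one has `k r ^ (-μ) ≤ 2 ^ μ * kn ^ (-μ)`. The majorant does not
depend on `r`, so it serves both integrability and dominated convergence. -/
theorem integrable_gram (hμ : μ < ρ) {r : ℝ} (h0 : 0 ≤ r) (h1 : r ≤ 1) (f' f : C(M.S, ℂ)) :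
    AEStronglyMeasurable (fun p : M.S × M.S =>
      conj (f' p.1) * f p.2 * ((k r p.1 p.2 ^ (-μ) : ℝ) : ℂ)) (M.sigma.prod M.sigma) ∧
    (∀ᵐ p ∂M.sigma.prod M.sigma, ‖conj (f' p.1) * f p.2 * ((k r p.1 p.2 ^ (-μ) : ℝ) : ℂ)‖ ≤
      ‖f'‖ * ‖f‖ * (2 ^ μ * M.kn p.1 p.2 ^ (-μ))) := by
  have := hM.secondCountable
  constructor
  · have h1 : Measurable fun p : M.S × M.S => k r p.1 p.2 :=
      (hM.continuous_k.comp (continuous_const.prodMk continuous_id)).measurable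
    have h2 : Measurable fun p : M.S × M.S => conj (f' p.1) * f p.2 := by
      apply Continuous.measurable
      fun_prop
    exact (h2.mul (Complex.measurable_ofReal.comp (h1.pow_const _))).aestronglyMeasurable
  · filter_upwards [hM.kn_pos hμ] with p hp
    have h2 : M.kn p.1 p.2 / 2 ≤ k r p.1 p.2 := by
      have := hM.kn_le r h0 h1 p.1 p.2; linarith
    have h3 : k r p.1 p.2 ^ (-μ) ≤ 2 ^ μ * M.kn p.1 p.2 ^ (-μ) := by
      calc k r p.1 p.2 ^ (-μ) ≤ (M.kn p.1 p.2 / 2) ^ (-μ) :=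
            Real.rpow_le_rpow_of_nonpos (by positivity) h2 (by linarith [hM.mu_pos])
        _ = 2 ^ μ * M.kn p.1 p.2 ^ (-μ) := by
            rw [Real.div_rpow hp.le (by norm_num), Real.rpow_neg (by norm_num : (0 : ℝ) ≤ 2),
              div_inv_eq_mul, mul_comm]
    rw [norm_mul, norm_mul, RCLike.norm_conj, Complex.norm_real, Real.norm_of_nonneg
      (Real.rpow_nonneg (le_trans (by positivity) h2) _)]
    have := f'.norm_coe_le_norm p.1
    have := f.norm_coe_le_norm p.2
    have : 0 ≤ k r p.1 p.2 ^ (-μ) := Real.rpow_nonneg (le_trans (by positivity) h2) _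
    gcongr

theorem integrable_gram' (hμ : μ < ρ) {r : ℝ} (h0 : 0 ≤ r) (h1 : r ≤ 1) (f' f : C(M.S, ℂ)) :
    Integrable (fun p : M.S × M.S =>
      conj (f' p.1) * f p.2 * ((k r p.1 p.2 ^ (-μ) : ℝ) : ℂ)) (M.sigma.prod M.sigma) :=
  (((hM.integrable_kn hμ).const_mul _).const_mul _).mono' (hM.integrable_gram hμ h0 h1 f' f).1
    (hM.integrable_gram hμ h0 h1 f' f).2

theorem tendsto_gram (hμ : μ < ρ) (f' f : C(M.S, ℂ)) :
    Tendsto (fun r : ℝ => ∫ p : M.S × M.S,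
      conj (f' p.1) * f p.2 * ((k r p.1 p.2 ^ (-μ) : ℝ) : ℂ) ∂M.sigma.prod M.sigma)
      (𝓝[Set.Icc 0 1] 1) (𝓝 (∫ p : M.S × M.S,
      conj (f' p.1) * f p.2 * ((M.kn p.1 p.2 ^ (-μ) : ℝ) : ℂ) ∂M.sigma.prod M.sigma)) := by
  refine tendsto_integral_filter_of_dominated_convergence
    (fun p => ‖f'‖ * ‖f‖ * (2 ^ μ * M.kn p.1 p.2 ^ (-μ))) ?_ ?_
    (((hM.integrable_kn hμ).const_mul _).const_mul _) ?_
  · filter_upwards [self_mem_nhdsWithin] with r hr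
    exact (hM.integrable_gram hμ hr.1 hr.2 f' f).1
  · filter_upwards [self_mem_nhdsWithin] with r hr
    exact (hM.integrable_gram hμ hr.1 hr.2 f' f).2
  · filter_upwards [hM.kn_pos hμ] with p hp
    refine Tendsto.const_mul _ (Tendsto.mono_left ?_ nhdsWithin_le_nhds)
    have h1 : Tendsto (fun r : ℝ => k r p.1 p.2) (𝓝 1) (𝓝 (M.kn p.1 p.2)) := by
      rw [← hM.k_one]
      exact (hM.continuous_k.comp (continuous_id.prodMk continuous_const)).tendsto (1 : ℝ)
    exact (Complex.continuous_ofReal.tendsto _).comp (h1.rpow_const (Or.inl hp.ne'))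

/-! ### The vectors `∫ f(s) K_{rs} ds` -/

section Average

variable {Hν : Type} [NormedAddCommGroup Hν] [InnerProductSpace ℂ Hν] [CompleteSpace Hν]
  [RKHS ℂ Hν M.D ℂ]

variable (Hν) in
/-- The vector `∫_S f(s) K_{rs} ds`. -/
def average (r : Set.Ico (0 : ℝ) 1) (f : C(M.S, ℂ)) : Hν :=
  ∫ s, f s • RKHS.kerFun Hν (hM.point r s) (1 : ℂ) ∂M.sigma

variable (hK : ∀ z w, RKHS.kernel Hν z w 1 = M.kernel ν z w)
include hK

theorem continuous_kerFun : Continuous fun z : M.D => RKHS.kerFun Hν z (1 : ℂ) := by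
  apply continuous_of_continuous_inner
  simpa only [inner_kerFun_kerFun, hK] using hM.continuous_kernel

theorem inner_average (r : Set.Ico (0 : ℝ) 1) (f : C(M.S, ℂ)) (φ : Hν) :
    inner ℂ (hM.average Hν r f) φ = ∫ s, conj (f s) * φ (hM.point r s) ∂M.sigma := by
  have hc : Continuous fun s => f s • RKHS.kerFun Hν (hM.point r s) (1 : ℂ) :=
    f.continuous.smul ((hM.continuous_kerFun hK).comp (hM.continuous_point r))
  have hi : Integrable (fun s => f s • RKHS.kerFun Hν (hM.point r s) (1 : ℂ)) M.sigma :=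
    hc.integrable_of_hasCompactSupport (HasCompactSupport.of_compactSpace _)
  rw [← inner_conj_symm, average, ← integral_inner hi, ← integral_conj]
  refine integral_congr_ae (ae_of_all _ fun s => ?_)
  simp only [inner_conj_symm, inner_smul_left, inner_kerFun_one]

theorem average_apply (r : Set.Ico (0 : ℝ) 1) (f : C(M.S, ℂ)) (z : M.D) :
    hM.average Hν r f z = ∫ s, f s * M.h z ((r : ℝ) • M.emb s) ^ (-ν : ℂ) ∂M.sigma := by
  rw [← inner_kerFun_one, ← inner_conj_symm, hM.inner_average hK, ← integral_conj]
  refine integral_congr_ae (ae_of_all _ fun s => ?_)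
  simp only [map_mul, Complex.conj_conj, RKHS.kerFun_apply, hK, Model.kernel, point]
  rw [hM.conj_cpow_h (hM.smul_emb_mem r r.2.1 r.2.2 s) (subset_closure z.2)]

/-- Two applications of the reproducing property leave the kernel at `(rx, tu)`, which involves only
`r * t`. This makes the joint limit in `r` and `t` an ordinary limit `r * t → 1`. -/
theorem inner_average_average (r t : Set.Ico (0 : ℝ) 1) (f' f : C(M.S, ℂ)) :
    inner ℂ (hM.average Hν r f') (hM.average Hν t f) =
      ∫ x, ∫ u, conj (f' x) * f u * ((k (r * t) x u ^ (-μ) : ℝ) : ℂ) ∂M.sigma ∂M.sigma := by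
  rw [hM.inner_average hK]
  refine integral_congr_ae (ae_of_all _ fun x => ?_)
  simp only [hM.average_apply hK, point, hM.h_smul_emb r r.2.1 r.2.2 t t.2.1 t.2.2.le]
  rw [← integral_const_mul]
  simp only [mul_assoc]

-- The integrand extends continuously to the compact space `[0, 1] × S`, because `z` is interior and
-- `h z` avoids the cut on all of the closure of `D`. A constant therefore dominates.
omit hK in
theorem tendsto_integral_h (f : C(M.S, ℂ)) (z : M.D) :
    Tendsto (fun r : ℝ => ∫ s, f s * M.h z (r • M.emb s) ^ (-ν : ℂ) ∂M.sigma)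
      (𝓝[Set.Icc 0 1] 1) (𝓝 (M.J ν f z)) := by
  have hc := hM.continuous_h_smul_emb z
  obtain ⟨C, hC⟩ := isCompact_univ.exists_bound_of_continuousOn hc.continuousOn
  refine tendsto_integral_filter_of_dominated_convergence (fun _ => ‖f‖ * C) ?_ ?_
    (integrable_const _) ?_
  · filter_upwards [self_mem_nhdsWithin] with r hr
    have : Continuous fun s => f s * M.h z (r • M.emb s) ^ (-ν : ℂ) :=
      f.continuous.mul (hc.comp (continuous_const (y := (⟨r, hr⟩ : Set.Icc (0 : ℝ) 1)).prodMk
        continuous_id))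
    exact (this.integrable_of_hasCompactSupport (HasCompactSupport.of_compactSpace _)).1
  · filter_upwards [self_mem_nhdsWithin] with r hr
    refine ae_of_all _ fun s => ?_
    rw [norm_mul]
    exact mul_le_mul (f.norm_coe_le_norm s) (hC (⟨r, hr⟩, s) (Set.mem_univ _)) (norm_nonneg _)
      (norm_nonneg _)
  · refine ae_of_all _ fun s => Tendsto.const_mul _ ?_
    have h1 : Tendsto (fun r : ℝ => M.h z (r • M.emb s)) (𝓝 1) (𝓝 (M.h z (M.emb s))) := by
      have : Continuous fun r : ℝ => M.h z (r • M.emb s) :=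
        hM.continuous_h.comp (continuous_const.prodMk (continuous_id.smul continuous_const))
      simpa using this.tendsto 1
    exact ((h1.mono_left nhdsWithin_le_nhds).cpow tendsto_const_nhds
      (hM.slit _ z.2 _ (hM.emb_mem_closure s)))

end Average

end Model.IsCovariant

end

/-! ### Passage to the boundary and the membership criterion for `J_ν 1`. -/

section

/-- A sequence of radii converging to `1`. -/
def radius (n : ℕ) : Set.Ico (0 : ℝ) 1 :=
  ⟨n / (n + 1), by positivity, by rw [div_lt_one (by positivity)]; linarith⟩

theorem tendsto_radius : Tendsto (fun n => (radius n : ℝ)) atTop (𝓝[Set.Icc 0 1] 1) :=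
  tendsto_nhdsWithin_iff.mpr ⟨tendsto_natCast_div_add_atTop 1,
    Eventually.of_forall fun n => ⟨(radius n).2.1, (radius n).2.2.le⟩⟩

theorem tendsto_radius_mul :
    Tendsto (fun p : ℕ × ℕ => (radius p.1 : ℝ) * radius p.2) atTop (𝓝[Set.Icc 0 1] 1) := by
  rw [tendsto_nhdsWithin_iff]
  constructor
  · have h : Tendsto (fun n => (radius n : ℝ)) atTop (𝓝 1) :=
      tendsto_radius.mono_right nhdsWithin_le_nhds
    rw [← prod_atTop_atTop_eq]
    simpa using (h.comp tendsto_fst).mul (h.comp tendsto_snd)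
  · exact Eventually.of_forall fun p => ⟨mul_nonneg (radius p.1).2.1 (radius p.2).2.1,
      mul_le_one₀ (radius p.1).2.2.le (radius p.2).2.1 (radius p.2).2.2.le⟩

/-- If `q = G r / C` exceeded `1`, iterating the inequality along `r, r², r⁴, …` would give `G (r ^
2 ^ n) / C ≥ q ^ 2 ^ n → ∞`. But `r ^ 2 ^ n → 0`, and near `0` the function `G` is at most `B`. -/
theorem le_of_sq_le_mul_sq {G : ℝ → ℝ} {C B δ : ℝ} (hC : 0 < C) (hδ : 0 < δ)
    (hB : ∀ r, 0 ≤ r → r < δ → G r ≤ B)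
    (hG : ∀ r, 0 ≤ r → r < 1 → G r ^ 2 ≤ C * G (r ^ 2)) {r : ℝ} (h0 : 0 ≤ r) (h1 : r < 1) :
    G r ≤ C := by
  by_contra! h
  set q := G r / C with hq
  have hq1 : 1 < q := by rwa [hq, one_lt_div hC]
  have key : ∀ n : ℕ, q ^ 2 ^ n ≤ G (r ^ 2 ^ n) / C := by
    intro n
    induction n with
    | zero => simp [hq]
    | succ n ih =>
      have h2 := hG (r ^ 2 ^ n) (by positivity) (pow_lt_one₀ h0 h1 (by positivity))
      rw [pow_succ, pow_mul, pow_mul]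
      calc (q ^ 2 ^ n) ^ 2 ≤ (G (r ^ 2 ^ n) / C) ^ 2 := by
            gcongr
        _ = G (r ^ 2 ^ n) ^ 2 / C / C := by ring
        _ ≤ (C * G ((r ^ 2 ^ n) ^ 2)) / C / C := by gcongr
        _ = _ := by field_simp
  have h3 : Tendsto (fun n : ℕ => 2 ^ n) atTop (atTop : Filter ℕ) :=
    tendsto_pow_atTop_atTop_of_one_lt (by norm_num)
  have h4 : ∀ᶠ n : ℕ in atTop, r ^ 2 ^ n < δ :=
    ((tendsto_pow_atTop_nhds_zero_of_lt_one h0 h1).comp h3).eventually (gt_mem_nhds hδ)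
  have h5 : ∀ᶠ n : ℕ in atTop, B / C < q ^ 2 ^ n :=
    ((tendsto_pow_atTop_atTop_of_one_lt hq1).comp h3).eventually (eventually_gt_atTop _)
  obtain ⟨n, hn4, hn5⟩ := (h4.and h5).exists
  have h6 := hB _ (by positivity) hn4
  have h7 := key n
  have : G (r ^ 2 ^ n) / C ≤ B / C := by gcongr
  linarith

namespace Model.IsCovariant

variable {M : Model} {k : ℝ → M.S → M.S → ℝ} {ν μ ρ : ℝ} (hM : M.IsCovariant k ν μ ρ)
  {Hν : Type} [NormedAddCommGroup Hν] [InnerProductSpace ℂ Hν] [CompleteSpace Hν]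
  [RKHS ℂ Hν M.D ℂ] (hK : ∀ z w, RKHS.kernel Hν z w 1 = M.kernel ν z w)
include hM

include hK in
/-- The operator `J_ν` on continuous functions takes its values in the reproducing kernel space,
and its Gram form is the one of the Knapp-Stein operator. -/
theorem exists_J (hμ : μ < ρ) : ∃ J : C(M.S, ℂ) →ₗ[ℂ] Hν, (∀ f z, J f z = M.J ν f z) ∧
    (∀ f' f, inner ℂ (J f') (J f) = ∫ x, M.knappStein μ f x * conj (f' x) ∂M.sigma) ∧
    ∀ f φ, Tendsto (fun n => ∫ s, conj (f s) * φ (hM.point (radius n) s) ∂M.sigma) atTop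
      (𝓝 (inner ℂ (J f) φ)) := by
  have := hM.secondCountable
  have hgram : ∀ f' f, Tendsto (fun p : ℕ × ℕ =>
      inner ℂ (hM.average Hν (radius p.1) f') (hM.average Hν (radius p.2) f)) atTop
      (𝓝 (∫ x, M.knappStein μ f x * conj (f' x) ∂M.sigma)) := by
    intro f' f
    have h1 : ∀ p : ℕ × ℕ,
        inner ℂ (hM.average Hν (radius p.1) f') (hM.average Hν (radius p.2) f) =
        ∫ q : M.S × M.S, conj (f' q.1) * f q.2 *
          ((k (radius p.1 * radius p.2) q.1 q.2 ^ (-μ) : ℝ) : ℂ) ∂M.sigma.prod M.sigma := by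
      intro p
      rw [hM.inner_average_average hK]
      exact (integral_prod _ (hM.integrable_gram' hμ
        (mul_nonneg (radius p.1).2.1 (radius p.2).2.1)
        (mul_le_one₀ (radius p.1).2.2.le (radius p.2).2.1 (radius p.2).2.2.le) f' f)).symm
    have h2 : ∫ x, M.knappStein μ f x * conj (f' x) ∂M.sigma = ∫ q : M.S × M.S,
        conj (f' q.1) * f q.2 * ((M.kn q.1 q.2 ^ (-μ) : ℝ) : ℂ) ∂M.sigma.prod M.sigma := by
      have h3 := hM.integrable_gram' hμ zero_le_one le_rfl f' f
      simp only [hM.k_one] at h3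
      rw [integral_prod _ h3]
      refine integral_congr_ae (ae_of_all _ fun x => ?_)
      simp only [Model.knappStein]
      rw [mul_comm, ← integral_const_mul]
      simp only [mul_assoc]
    rw [h2]
    simp only [h1]
    exact (hM.tendsto_gram hμ f' f).comp tendsto_radius_mul
  -- Convergence of the Gram matrix makes the averages a Cauchy sequence; no estimate of norms in
  -- `Hν` is needed.
  have hlim : ∀ f, ∃ φ : Hν, Tendsto (fun n => hM.average Hν (radius n) f) atTop (𝓝 φ) :=
    fun f => cauchySeq_tendsto_of_complete (cauchySeq_of_tendsto_inner (hgram f f))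
  choose J hJ using hlim
  have hJz : ∀ f z, J f z = M.J ν f z := by
    intro f z
    -- Point evaluations are continuous on `Hν`, so the limit vector is identified pointwise with
    -- the integral operator.
    refine tendsto_nhds_unique (((RKHS.continuous_eval z).tendsto _).comp (hJ f)) ?_
    simp only [Function.comp_def, hM.average_apply hK]
    exact (hM.tendsto_integral_h f z).comp tendsto_radius
  have hdiag : Tendsto (fun n : ℕ => (n, n)) atTop atTop := by
    rw [← prod_atTop_atTop_eq]; exact tendsto_id.prodMk tendsto_id
  have hJi : ∀ f φ, Tendsto (fun n => ∫ s, conj (f s) * φ (hM.point (radius n) s) ∂M.sigma) atTop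
      (𝓝 (inner ℂ (J f) φ)) := by
    intro f φ
    simp only [← hM.inner_average hK]
    exact (hJ f).inner tendsto_const_nhds
  have hint : ∀ (f : C(M.S, ℂ)) (z : M.D),
      Integrable (fun s => f s * M.h z (M.emb s) ^ (-ν : ℂ)) M.sigma := by
    intro f z
    have hc := (hM.continuous_h_smul_emb z).comp
      ((continuous_const (y := (1 : Set.Icc (0 : ℝ) 1))).prodMk continuous_id)
    simp only [Function.comp_def, Set.Icc.coe_one, one_smul] at hc
    exact (f.continuous.mul hc).integrable_of_hasCompactSupport
      (HasCompactSupport.of_compactSpace _)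
  refine ⟨⟨⟨J, fun f g => ?_⟩, fun c f => ?_⟩, hJz, fun f' f => ?_, hJi⟩
  · ext z
    simp only [RKHS.coe_add, Pi.add_apply, hJz, Model.J]
    rw [← integral_add (hint f z) (hint g z)]
    simp only [ContinuousMap.add_apply, add_mul]
  · ext z
    simp only [RKHS.coe_smul, Pi.smul_apply, hJz, Model.J, RingHom.id_apply, smul_eq_mul]
    rw [← integral_const_mul]
    simp only [ContinuousMap.smul_apply, smul_eq_mul, mul_assoc]
  · have h1 := (hgram f' f).comp hdiag
    have h2 := (hJ f').inner (𝕜 := ℂ) (hJ f)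
    exact tendsto_nhds_unique h2 h1

-- Put `G r = ∬ k r x u ^ (-μ)`. Pairing `φ` with the average of `1` at radius `r` gives `G r`,
-- while the squared norm of that average is `G (r²)`. Cauchy–Schwarz yields the hypothesis of
-- `le_of_sq_le_mul_sq`, so `G` is bounded on `[0, 1)`.
include hK in
theorem lt_of_J_one_mem {φ : Hν} (hφ : ∀ z, φ z = M.J ν 1 z) : μ < ρ := by
  have := hM.secondCountable
  set G : ℝ → ℝ := fun r => ∫ x, ∫ u, k r x u ^ (-μ) ∂M.sigma ∂M.sigma with hGdef
  have hGC : ∀ r : ℝ, ∫ x, ∫ u, ((k r x u ^ (-μ) : ℝ) : ℂ) ∂M.sigma ∂M.sigma = (G r : ℂ) := by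
    intro r
    simp only [hGdef, integral_complex_ofReal]
  have h1 : ∀ r : Set.Ico (0 : ℝ) 1, inner ℂ (hM.average Hν r 1) φ = (G r : ℂ) := by
    intro r
    rw [hM.inner_average hK, ← hGC]
    refine integral_congr_ae (ae_of_all _ fun x => ?_)
    simp only [hφ, Model.J, point, ContinuousMap.one_apply, map_one, one_mul]
    refine integral_congr_ae (ae_of_all _ fun u => ?_)
    have := hM.h_smul_emb r r.2.1 r.2.2 1 zero_le_one le_rfl x u
    simpa using this
  have h2 : ∀ r : Set.Ico (0 : ℝ) 1, ‖hM.average Hν r 1‖ ^ 2 = G ((r : ℝ) * r) := by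
    intro r
    have h := hM.inner_average_average hK r r 1 1
    simp only [ContinuousMap.one_apply, map_one, one_mul] at h
    rw [hGC, inner_self_eq_norm_sq_to_K] at h
    refine Complex.ofReal_injective ?_
    rw [← h]
    simp
  -- Adding `1` to the norm keeps the constant positive even for `φ = 0`.
  have h3 : ∀ r, 0 ≤ r → r < 1 → G r ^ 2 ≤ (‖φ‖ + 1) ^ 2 * G (r ^ 2) := by
    intro r h0 h1'
    have h4 := norm_inner_le_norm (𝕜 := ℂ) (hM.average Hν ⟨r, h0, h1'⟩ 1) φ
    rw [h1, Complex.norm_real, Real.norm_eq_abs] at h4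
    have h5 := h2 ⟨r, h0, h1'⟩
    simp only at h5 h4
    rw [sq r, ← h5, ← sq_abs (G r), ← mul_pow]
    refine pow_le_pow_left₀ (abs_nonneg _) (h4.trans ?_) 2
    rw [mul_comm]
    gcongr
    linarith
  have hc : Continuous fun p : M.S × M.S => k 0 p.1 p.2 :=
    hM.continuous_k.comp (continuous_const.prodMk continuous_id)
  -- Since `k 0 = 1` and `S × S` is compact, the kernel stays above `1 / 2` for small `r`; this
  -- supplies the bound on `G` near `0`.
  have hU : ∃ δ > 0, ∀ r : ℝ, 0 ≤ r → r < δ → ∀ x u, 1 / 2 < k r x u := by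
    have h6 : ∀ᶠ r in 𝓝 (0 : ℝ), ∀ p ∈ (Set.univ : Set (M.S × M.S)), 1 / 2 < k r p.1 p.2 := by
      refine isCompact_univ.eventually_forall_of_forall_eventually fun p _ => ?_
      refine (hM.continuous_k.tendsto (0, p)).eventually (lt_mem_nhds ?_)
      simp only [hM.k_zero]
      norm_num
    obtain ⟨δ, hδ, h7⟩ := Metric.eventually_nhds_iff.mp h6
    refine ⟨δ, hδ, fun r h0 hr x u => h7 ?_ (x, u) (Set.mem_univ _)⟩
    simpa [abs_of_nonneg h0] using hr
  obtain ⟨δ, hδ, hkδ⟩ := hU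
  refine hM.lt_of_bounded ⟨(‖φ‖ + 1) ^ 2, fun r h0 h1' =>
    le_of_sq_le_mul_sq (B := 2 ^ μ * M.sigma.real Set.univ * M.sigma.real Set.univ)
      (by positivity) hδ (fun t ht0 htδ => ?_) h3 h0 h1'⟩
  have h8 : ∀ x u, ‖k t x u ^ (-μ)‖ ≤ 2 ^ μ := by
    intro x u
    have h9 := hkδ t ht0 htδ x u
    rw [Real.norm_of_nonneg (Real.rpow_nonneg (by linarith) _)]
    calc k t x u ^ (-μ) ≤ (1 / 2 : ℝ) ^ (-μ) :=
          Real.rpow_le_rpow_of_nonpos (by norm_num) h9.le (by linarith [hM.mu_pos])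
      _ = 2 ^ μ := by rw [Real.rpow_neg (by norm_num), one_div, Real.inv_rpow (by norm_num), inv_inv]
  refine (Real.le_norm_self _).trans ((norm_integral_le_of_norm_le_const (ae_of_all _ fun x => ?_)))
  exact norm_integral_le_of_norm_le_const (ae_of_all _ fun u => h8 x u)

end Model.IsCovariant

end

/-! ### Duality of the two complementary series. -/

section

/-- A closed invariant subspace, given as the range of an isometry, carries a unitary
representation. -/
theorem exists_rep_of_isometry {G E H : Type} [Group G] [NormedAddCommGroup E]
    [InnerProductSpace ℂ E] [NormedAddCommGroup H] [InnerProductSpace ℂ H] (J : E →ₗᵢ[ℂ] H)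
    (U : G →* (H ≃ₗᵢ[ℂ] H)) (h : ∀ g x, ∃ y, J y = U g (J x)) :
    ∃ π : G →* (E ≃ₗᵢ[ℂ] E), ∀ g x, J (π g x) = U g (J x) := by
  choose P hP using h
  have hadd : ∀ g x y, P g (x + y) = P g x + P g y := fun g x y =>
    J.injective (by simp only [hP, map_add])
  have hsmul : ∀ g (c : ℂ) x, P g (c • x) = c • P g x := fun g c x =>
    J.injective (by simp only [hP, map_smul])
  have hmul : ∀ g k x, P (g * k) x = P g (P k x) := fun g k x =>
    J.injective (by simp only [hP, map_mul]; rfl)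
  have hone : ∀ x, P 1 x = x := fun x => J.injective (by simp only [hP, map_one]; rfl)
  let π : G → (E ≃ₗᵢ[ℂ] E) := fun g =>
    { toFun := P g
      invFun := P g⁻¹
      map_add' := hadd g
      map_smul' := hsmul g
      left_inv := fun x => by rw [← hmul, inv_mul_cancel, hone]
      right_inv := fun x => by rw [← hmul, mul_inv_cancel, hone]
      norm_map' := fun x => by
        show ‖P g x‖ = ‖x‖
        rw [← J.norm_map, hP, LinearIsometryEquiv.norm_map, J.norm_map] }
  refine ⟨{ toFun := π, map_one' := ?_, map_mul' := fun g k => ?_ }, hP⟩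
  · ext1 x; exact hone x
  · ext1 x; exact hmul g k x

namespace Model

variable {M : Model}

theorem conj_pairing (f g : C(M.S, ℂ)) : conj (M.pairing f g) = M.pairing g f := by
  unfold pairing
  rw [← integral_conj]
  simp [mul_comm]

theorem pairing_add_left (a b f : C(M.S, ℂ)) :
    M.pairing (a + b) f = M.pairing a f + M.pairing b f := by
  unfold pairing
  rw [← integral_add (M.integrable_mul_conj a f) (M.integrable_mul_conj b f)]
  simp [add_mul]

theorem pairing_smul_left (c : ℂ) (a f : C(M.S, ℂ)) :
    M.pairing (c • a) f = c * M.pairing a f := by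
  unfold pairing
  rw [← integral_const_mul]
  simp [mul_assoc]

section Lower

variable {μ : ℝ} (E' : M.UpperSeries μ)

/-- The continuous functions in the dual of the complementary series. -/
theorem mem_lowerSpace_of_inner {g : C(M.S, ℂ)} {t : E'.carrier}
    (h : ∀ f, inner ℂ (E'.ι f) t = M.pairing g f) : g ∈ M.lowerSpace μ :=
  ⟨‖t‖, fun f => by
    rw [← h, mul_comm, ← E'.norm_ι]
    exact norm_inner_le_norm _ _⟩

/-- Membership in the lower space is exactly boundedness of `f ↦ (f, g)` in the upper norm, so this
functional extends to the completion and the Riesz theorem applies. The pairing is conjugated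
because `g` sits in its antilinear slot. -/
theorem exists_riesz {g : C(M.S, ℂ)} (hg : g ∈ M.lowerSpace μ) :
    ∃ t : E'.carrier, ∀ f, inner ℂ (E'.ι f) t = M.pairing g f := by
  obtain ⟨C, hC⟩ := hg
  let l : C(M.S, ℂ) →ₗ[ℂ] ℂ :=
    { toFun := fun f => M.pairing f g
      map_add' := fun a b => pairing_add_left a b g
      map_smul' := fun c a => pairing_smul_left c a g }
  have hl : ∀ f, ‖l f‖ ≤ C * ‖E'.ι f‖ := fun f => by
    rw [E'.norm_ι, ← RCLike.norm_conj]
    show ‖conj (M.pairing f g)‖ ≤ _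
    rw [conj_pairing]
    exact hC f
  refine ⟨(InnerProductSpace.toDual ℂ E'.carrier).symm (l.extendOfNorm E'.ι), fun f => ?_⟩
  rw [← inner_conj_symm, InnerProductSpace.toDual_symm_apply,
    LinearMap.extendOfNorm_eq E'.dense ⟨C, hl⟩]
  exact conj_pairing f g

theorem eq_of_inner_ι {t t' : E'.carrier} (h : ∀ f, inner ℂ (E'.ι f) t = inner ℂ (E'.ι f) t') :
    t = t' := by
  refine ext_inner_left ℂ fun x => ?_
  refine E'.dense.induction_on (p := fun x => inner ℂ x t = inner ℂ x t') x ?_ h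
  exact isClosed_eq (by fun_prop) (by fun_prop)

/-- The Riesz representative in the complementary series `π_{2ρ-μ}` of an element of `π_μ`. -/
def riesz : M.lowerSpace μ →ₗ[ℂ] E'.carrier where
  toFun g := (exists_riesz E' g.2).choose
  map_add' a b := eq_of_inner_ι E' fun f => by
    rw [inner_add_right, (exists_riesz E' a.2).choose_spec, (exists_riesz E' b.2).choose_spec,
      (exists_riesz E' (a + b).2).choose_spec]
    exact pairing_add_left _ _ _
  map_smul' c a := eq_of_inner_ι E' fun f => by
    rw [RingHom.id_apply, inner_smul_right, (exists_riesz E' a.2).choose_spec,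
      (exists_riesz E' (c • a).2).choose_spec]
    exact pairing_smul_left _ _ _

theorem inner_riesz (g : M.lowerSpace μ) (f : C(M.S, ℂ)) :
    inner ℂ (E'.ι f) (riesz E' g) = M.pairing g f :=
  (exists_riesz E' g.2).choose_spec f

theorem exists_riesz_eq {g : C(M.S, ℂ)} {t : E'.carrier}
    (h : ∀ f, inner ℂ (E'.ι f) t = M.pairing g f) :
    ∃ hg : g ∈ M.lowerSpace μ, riesz E' ⟨g, hg⟩ = t :=
  ⟨mem_lowerSpace_of_inner E' h, eq_of_inner_ι E' fun f => by rw [inner_riesz, h]⟩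

/-- Cauchy–Schwarz bounds the supremum. For the other inequality a function of nonzero upper norm is
rescaled to norm one, the resulting estimate passes to the completion by density, and it is then
tested on the Riesz vector itself. -/
theorem norm_riesz (g : M.lowerSpace μ) : ‖riesz E' g‖ = M.lowerNorm μ g := by
  have hub : ∀ t ∈ {t : ℝ | ∃ f, M.upperNorm μ f ≤ 1 ∧ t = ‖M.pairing g f‖},
      t ≤ ‖riesz E' g‖ := by
    rintro _ ⟨f, hf, rfl⟩
    rw [← inner_riesz E']
    refine (norm_inner_le_norm _ _).trans ?_
    rw [E'.norm_ι]
    exact mul_le_of_le_one_left (norm_nonneg _) hf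
  have hne : {t : ℝ | ∃ f, M.upperNorm μ f ≤ 1 ∧ t = ‖M.pairing g f‖}.Nonempty :=
    ⟨_, 0, by rw [← E'.norm_ι]; simp, rfl⟩
  refine le_antisymm ?_ (csSup_le hne hub)
  have h1 : ∀ f, ‖inner ℂ (E'.ι f) (riesz E' g)‖ ≤ M.lowerNorm μ g * ‖E'.ι f‖ := by
    intro f
    rcases eq_or_ne (E'.ι f) 0 with h0 | h0
    · simp [h0]
    · have hpos : 0 < ‖E'.ι f‖ := norm_pos_iff.mpr h0
      have h2 := le_csSup ⟨_, hub⟩ (show ‖M.pairing g (((‖E'.ι f‖⁻¹ : ℝ) : ℂ) • f)‖ ∈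
        {t : ℝ | ∃ f, M.upperNorm μ f ≤ 1 ∧ t = ‖M.pairing g f‖} from ⟨_, by
          rw [← E'.norm_ι, map_smul, norm_smul, Complex.norm_real, norm_inv, norm_norm,
            inv_mul_cancel₀ hpos.ne'], rfl⟩)
      rw [← inner_riesz E', map_smul, inner_smul_left, norm_mul, RCLike.norm_conj,
        Complex.norm_real, norm_inv, norm_norm, inv_mul_le_iff₀ hpos, mul_comm] at h2
      exact h2
  have h3 : ∀ x, ‖inner ℂ x (riesz E' g)‖ ≤ M.lowerNorm μ g * ‖x‖ := fun x =>
    E'.dense.induction_on (p := fun x => ‖inner ℂ x (riesz E' g)‖ ≤ M.lowerNorm μ g * ‖x‖) x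
      (isClosed_le (by fun_prop) (by fun_prop)) h1
  rcases eq_or_ne (riesz E' g) 0 with h0 | h0
  · rw [h0, norm_zero]
    refine Real.sSup_nonneg ?_
    rintro _ ⟨f, -, rfl⟩
    exact norm_nonneg _
  · have h4 := h3 (riesz E' g)
    rw [inner_self_eq_norm_sq_to_K] at h4
    have hpos : 0 < ‖riesz E' g‖ := norm_pos_iff.mpr h0
    simp only [norm_pow, Complex.coe_algebraMap, Complex.norm_real, norm_norm] at h4
    rw [sq] at h4
    exact le_of_mul_le_mul_right h4 hpos

end Lower

end Model

namespace Model.IsCovariant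

variable {M : Model} {k : ℝ → M.S → M.S → ℝ} {ν μ ρ : ℝ} (hM : M.IsCovariant k ν μ ρ)
include hM

/-! ### Invariance under the spherical principal series -/

theorem facS_inv_mul (g : M.H) (s : M.S) : M.facS g⁻¹ (M.actS g s) * M.facS g s = 1 := by
  rw [← hM.facS_mul, inv_mul_cancel, hM.facS_one]

theorem actS_inv_act (g : M.H) (s : M.S) : M.actS g⁻¹ (M.actS g s) = s := by
  rw [← hM.actS_mul, inv_mul_cancel, hM.actS_one]

/-- Substituting `s ↦ g s` produces the Jacobian `facS g s ^ (-2ρ)`. The cocycle identity turns the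
weight of `g⁻¹` at `g s` into `facS g s ^ μ`, and the exponents combine to `-(2ρ - μ)`. -/
theorem pairing_ps (g : M.H) (f f' : C(M.S, ℂ)) :
    M.pairing (M.ps μ g f) f' = M.pairing f (M.ps (2 * ρ - μ) g⁻¹ f') := by
  have h := hM.integral_act g (M.ps μ g f * star f')
  unfold pairing
  rw [show (∫ s, (M.ps μ g f) s * conj (f' s) ∂M.sigma) =
    ∫ s, (M.ps μ g f * star f') s ∂M.sigma from rfl, ← h]
  refine integral_congr_ae (ae_of_all _ fun s => ?_)
  have hp := hM.facS_pos g s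
  have h1 : M.facS g⁻¹ (M.actS g s) = (M.facS g s)⁻¹ :=
    eq_inv_of_mul_eq_one_left (hM.facS_inv_mul g s)
  have h2 : M.facS g s ^ (-(2 * ρ)) * (M.facS g s)⁻¹ ^ (-μ) = M.facS g s ^ (-(2 * ρ - μ)) := by
    rw [Real.inv_rpow hp.le, Real.rpow_neg hp.le μ, inv_inv, ← Real.rpow_add hp]
    congr 1
    ring
  show _ * ((((M.facS g⁻¹ (M.actS g s) ^ (-μ) : ℝ) : ℂ) * f (M.actS g⁻¹ (M.actS g s))) *
    star (f' (M.actS g s))) = f s * conj (((M.facS g⁻¹⁻¹ s ^ (-(2 * ρ - μ)) : ℝ) : ℂ) *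
      f' (M.actS g⁻¹⁻¹ s))
  rw [h1, hM.actS_inv_act, inv_inv, map_mul, Complex.conj_ofReal, ← h2]
  push_cast
  simp only [RCLike.star_def]
  ring

/-- Boundary covariance of the kernel contributes `facS ^ (-μ)`. Together with the weight `-(2ρ -
μ)` of the representation this is `facS ^ (-2ρ)`, the Jacobian of the action. -/
theorem J_ps (g : M.H) (f : C(M.S, ℂ)) (z : M.D) :
    M.J ν (M.ps (2 * ρ - μ) g f) z =
      M.facD g⁻¹ z ^ (-ν : ℂ) * M.J ν f (M.actD g⁻¹ z) := by
  have hc := (hM.continuous_h_smul_emb (M.actD g⁻¹ z)).comp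
    ((continuous_const (y := (1 : Set.Icc (0 : ℝ) 1))).prodMk continuous_id)
  simp only [Function.comp_def, Set.Icc.coe_one, one_smul, id] at hc
  have h := hM.integral_act g⁻¹ (f * ⟨_, hc⟩)
  unfold Model.J
  rw [show (∫ s, f s * M.h (M.actD g⁻¹ z) (M.emb s) ^ (-ν : ℂ) ∂M.sigma) =
    ∫ s, (f * ⟨_, hc⟩ : C(M.S, ℂ)) s ∂M.sigma from rfl, ← h, ← integral_const_mul]
  refine integral_congr_ae (ae_of_all _ fun s => ?_)
  have hp := hM.facS_pos g⁻¹ s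
  have h2 : M.facS g⁻¹ s ^ (-(2 * ρ - μ)) * M.facS g⁻¹ s ^ (-μ) = M.facS g⁻¹ s ^ (-(2 * ρ)) := by
    rw [← Real.rpow_add hp]
    congr 1
    ring
  show ((M.facS g⁻¹ s ^ (-(2 * ρ - μ)) : ℝ) : ℂ) * f (M.actS g⁻¹ s) * M.h z (M.emb s) ^ (-ν : ℂ) =
    M.facD g⁻¹ z ^ (-ν : ℂ) * (((M.facS g⁻¹ s ^ (-(2 * ρ)) : ℝ) : ℂ) * (f (M.actS g⁻¹ s) *
      M.h (M.actD g⁻¹ z) (M.emb (M.actS g⁻¹ s)) ^ (-ν : ℂ)))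
  rw [← hM.boundary_act g⁻¹ z s, ← h2]
  push_cast
  ring

/-! ### Restriction to the sphere -/

/-- The principal power `h(·, z)^{-ν}` is holomorphic on the preimage of the slit plane, an open set
containing the closure of `D`. -/
theorem exists_isRestriction_kernel (z : M.D) :
    ∃ f, M.IsRestriction (fun w => M.kernel ν w z) f := by
  have hs : ∀ w ∈ closure M.D, M.h w z ∈ Complex.slitPlane := by
    intro w hw
    have h1 := hM.slit z z.2 w hw
    rw [← hM.conj_h z w, Complex.mem_slitPlane_iff]
    rw [Complex.mem_slitPlane_iff] at h1
    simpa using h1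
  have hch : Continuous fun v => M.h v z :=
    hM.continuous_h.comp (continuous_id.prodMk continuous_const)
  refine ⟨⟨fun s => M.h (M.emb s) z ^ (-ν : ℂ), ?_⟩, {v | M.h v z ∈ Complex.slitPlane},
    fun v => M.h v z ^ (-ν : ℂ), Complex.isOpen_slitPlane.preimage hch, hs, ?_, fun _ => rfl,
    fun _ => rfl⟩
  · exact (hch.comp hM.continuous_emb).cpow continuous_const fun s =>
      hs _ (hM.emb_mem_closure s)
  · exact (hM.differentiable_h z).differentiableOn.cpow (differentiableOn_const _) fun v hv => hv

/-- The extension is continuous on the compact set of points `r s` with `0 ≤ r ≤ 1`, hence bounded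
there, and dominated convergence applies. With the last clause of `exists_J` this identifies the
adjoint of `J_ν` with restriction to the sphere. -/
theorem tendsto_restriction {F : M.D → ℂ} {g : C(M.S, ℂ)} (h : M.IsRestriction F g)
    (f : C(M.S, ℂ)) :
    Tendsto (fun n => ∫ s, conj (f s) * F (hM.point (radius n) s) ∂M.sigma) atTop
      (𝓝 (M.pairing g f)) := by
  obtain ⟨W, Φ, hW, hDW, hΦ, hF, hg⟩ := h
  -- Holomorphy is known for `Φ ∘ coord`. As `coord` is a continuous involution, continuity descends
  -- to `Φ`.
  have hΦc : ContinuousOn Φ W := by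
    have h1 := hΦ.continuousOn.comp (t := M.coord ⁻¹' W) (s := W)
      hM.continuous_coord.continuousOn (fun v hv => by
        show M.coord (M.coord v) ∈ W
        rwa [hM.coord_coord])
    refine h1.congr fun v _ => ?_
    simp only [Function.comp, hM.coord_coord]
  have hc : Continuous fun p : Set.Icc (0 : ℝ) 1 × M.S => Φ ((p.1 : ℝ) • M.emb p.2) := by
    refine hΦc.comp_continuous ((continuous_subtype_val.comp continuous_fst).smul
      (hM.continuous_emb.comp continuous_snd)) fun p =>
      hDW (hM.smul_emb_mem_closure p.1.2.1 p.1.2.2 p.2)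
  obtain ⟨C, hC⟩ := isCompact_univ.exists_bound_of_continuousOn hc.continuousOn
  let r : ℕ → Set.Icc (0 : ℝ) 1 := fun n => ⟨radius n, (radius n).2.1, (radius n).2.2.le⟩
  have hr : Tendsto r atTop (𝓝 1) := by
    rw [tendsto_subtype_rng]
    exact tendsto_radius.mono_right nhdsWithin_le_nhds
  have hFr : ∀ n s, F (hM.point (radius n) s) = Φ ((r n : ℝ) • M.emb s) := fun n s => (hF _).symm
  have hgs : ∀ s, g s = Φ (((1 : Set.Icc (0 : ℝ) 1) : ℝ) • M.emb s) := fun s => by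
    rw [hg, Set.Icc.coe_one, one_smul]
  unfold Model.pairing
  refine tendsto_integral_of_dominated_convergence (fun _ => ‖f‖ * C) (fun n => ?_)
    (integrable_const _) (fun n => ae_of_all _ fun s => ?_) (ae_of_all _ fun s => ?_)
  · simp only [hFr]
    have : Continuous fun s => conj (f s) * Φ ((r n : ℝ) • M.emb s) :=
      (Complex.continuous_conj.comp f.continuous).mul
        (hc.comp ((continuous_const (y := r n)).prodMk continuous_id))
    exact (this.integrable_of_hasCompactSupport (HasCompactSupport.of_compactSpace _)).1
  · rw [norm_mul, RCLike.norm_conj, hFr]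
    exact mul_le_mul (f.norm_coe_le_norm s) (hC (r n, s) (Set.mem_univ _)) (norm_nonneg _)
      (norm_nonneg _)
  · rw [mul_comm (g s), hgs]
    simp only [hFr]
    exact Tendsto.const_mul _ ((hc.comp (continuous_id.prodMk continuous_const)).tendsto
      (1 : Set.Icc (0 : ℝ) 1) |>.comp hr)

end Model.IsCovariant

end

/-! ### The complementary series, the restriction operator and its adjoint. -/

section

theorem inner_rep_inv {G H : Type} [Group G] [NormedAddCommGroup H] [InnerProductSpace ℂ H]
    (U : G →* (H ≃ₗᵢ[ℂ] H)) (g : G) (x y : H) :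
    inner ℂ (U g x) y = inner ℂ x (U g⁻¹ y) := by
  have h : U g⁻¹ (U g x) = x := by
    rw [show U g⁻¹ (U g x) = (U g⁻¹ * U g) x from rfl, ← map_mul, inv_mul_cancel, map_one]
    rfl
  rw [← (U g⁻¹).inner_map_map, h]

namespace Model.IsCovariant

variable {M : Model} {k : ℝ → M.S → M.S → ℝ} {ν μ ρ : ℝ} (hM : M.IsCovariant k ν μ ρ)
  {Hν : Type} [NormedAddCommGroup Hν] [InnerProductSpace ℂ Hν] [CompleteSpace Hν]
  [RKHS ℂ Hν M.D ℂ] (hK : ∀ z w, RKHS.kernel Hν z w 1 = M.kernel ν z w)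
include hM

include hK in
theorem exists_isRestriction_kerFun (z : M.D) :
    ∃ f, M.IsRestriction (RKHS.kerFun Hν z (1 : ℂ)) f := by
  obtain ⟨f, hf⟩ := hM.exists_isRestriction_kernel z
  refine ⟨f, ?_⟩
  have : ⇑(RKHS.kerFun Hν z (1 : ℂ)) = fun w => M.kernel ν w z := by
    funext w
    rw [RKHS.kerFun_apply, hK]
  rwa [this]

section

variable (J₀ : C(M.S, ℂ) →ₗ[ℂ] Hν)
  (hJi : ∀ f' f, inner ℂ (J₀ f') (J₀ f) = ∫ x, M.knappStein μ f x * conj (f' x) ∂M.sigma)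
include hJi

omit hM [CompleteSpace Hν] [RKHS ℂ Hν M.D ℂ] in
theorem norm_J_eq_upperNorm (f : C(M.S, ℂ)) : ‖J₀ f‖ = M.upperNorm μ f := by
  rw [Model.upperNorm, ← hJi, ← RCLike.re_eq_complex_re, inner_self_eq_norm_sq,
    Real.sqrt_sq (norm_nonneg _)]

-- The closure of the range of `J₀` inside `Hν` is the completion. That the Knapp–Stein form is
-- positive is implicit in its being a Gram form.
omit hM [RKHS ℂ Hν M.D ℂ] in
theorem nonempty_upperSeries : Nonempty (M.UpperSeries μ) := by
  let V := (LinearMap.range J₀).topologicalClosure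
  have : CompleteSpace V :=
    (Submodule.isClosed_topologicalClosure (LinearMap.range J₀)).completeSpace_coe
  have hV : ∀ f, J₀ f ∈ V := fun f => Submodule.le_topologicalClosure _ ⟨f, rfl⟩
  refine ⟨{ carrier := V, ι := J₀.codRestrict V hV, norm_ι := norm_J_eq_upperNorm J₀ hJi,
            dense := ?_ }⟩
  intro x
  rw [Metric.mem_closure_range_iff]
  intro ε hε
  have hx : (x : Hν) ∈ closure (Set.range J₀) := x.2
  obtain ⟨f, hf⟩ := Metric.mem_closure_range_iff.mp hx ε hε
  exact ⟨f, hf⟩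

omit hM [RKHS ℂ Hν M.D ℂ] in
/-- The isometric extension of `J_ν` to the complementary series. -/
theorem exists_extension_J (E' : M.UpperSeries μ) :
    ∃ J : E'.carrier →ₗᵢ[ℂ] Hν, ∀ f, J (E'.ι f) = J₀ f := by
  have hn : ∀ f, ‖J₀ f‖ = ‖E'.ι f‖ := fun f => by
    rw [norm_J_eq_upperNorm J₀ hJi, E'.norm_ι]
  have h1 : ∀ f, J₀.extendOfNorm E'.ι (E'.ι f) = J₀ f :=
    LinearMap.extendOfNorm_eq E'.dense ⟨1, fun f => by rw [hn, one_mul]⟩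
  refine ⟨⟨(J₀.extendOfNorm E'.ι : E'.carrier →ₗ[ℂ] Hν), fun x => ?_⟩, h1⟩
  refine E'.dense.induction_on (p := fun x => ‖J₀.extendOfNorm E'.ι x‖ = ‖x‖) x
    (isClosed_eq (by fun_prop) (by fun_prop)) fun f => ?_
  rw [h1, hn]

variable (hJt : ∀ f φ, Tendsto (fun n => ∫ s, conj (f s) * φ (hM.point (radius n) s) ∂M.sigma)
    atTop (𝓝 (inner ℂ (J₀ f) φ)))
include hJt

-- The numbers `∫ conj (f' s) φ(rs) ds` converge both to `⟨J f', φ⟩`, by construction of `J`, and to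
-- the pairing of the restriction with `f'`. Hence the adjoint of `J` applied to `φ` is the Riesz
-- vector of the restriction.
omit hJi in
theorem riesz_restriction (E' : M.UpperSeries μ) (J : E'.carrier →ₗᵢ[ℂ] Hν)
    (hJ : ∀ f, J (E'.ι f) = J₀ f) {φ : Hν} {f : C(M.S, ℂ)} (h : M.IsRestriction φ f) :
    ∃ hf : f ∈ M.lowerSpace μ, riesz E' ⟨f, hf⟩ = J.toContinuousLinearMap.adjoint φ := by
  refine exists_riesz_eq E' fun f' => ?_
  rw [ContinuousLinearMap.adjoint_inner_right]
  show inner ℂ (J (E'.ι f')) φ = _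
  rw [hJ]
  exact tendsto_nhds_unique (hJt f' φ) (hM.tendsto_restriction h f')

include hK

/-- Each kernel function `K_z` restricts to the sphere, and its Riesz vector is `J* K_z`. A vector
`x` orthogonal to all of these satisfies `(J x)(z) = 0` for every `z`, and `J` is injective. -/
theorem denseRange_riesz (E' : M.UpperSeries μ) : DenseRange (riesz E') := by
  obtain ⟨J, hJ⟩ := exists_extension_J J₀ hJi E'
  rw [DenseRange, ← LinearMap.coe_range, Submodule.dense_iff_topologicalClosure_eq_top,
    Submodule.topologicalClosure_eq_top_iff, Submodule.eq_bot_iff]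
  intro x hx
  have h0 : J x = 0 := by
    ext z
    obtain ⟨f, hf⟩ := hM.exists_isRestriction_kerFun hK z
    obtain ⟨hf', h1⟩ := hM.riesz_restriction J₀ hJt E' J hJ hf
    have h2 := (Submodule.mem_orthogonal _ x).mp hx _ ⟨⟨f, hf'⟩, rfl⟩
    rw [h1, ContinuousLinearMap.adjoint_inner_left, inner_kerFun_one] at h2
    rw [RKHS.coe_zero]
    exact h2
  exact J.injective (h0.trans (map_zero J).symm)

end

-- Everything is transported from `Hν` by the isometry `J`. Its range is invariant under `U`, giving
-- `π'`. The isometry `T` extending `riesz` identifies `π_μ` with `π_{2ρ-μ}`, giving `π`, the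
-- duality `Δ x' x = ⟨x', T x⟩` and the operator `R = T⁻¹ J*`.
include hK in
theorem exists_complementarySeries (hμ : μ < ρ) (U : M.H →* (Hν ≃ₗᵢ[ℂ] Hν))
    (hU : ∀ g φ z, U g φ z = M.facD g⁻¹ z ^ (-ν : ℂ) * φ (M.actD g⁻¹ z)) :
    Nonempty (M.UpperSeries μ) ∧ Nonempty (M.LowerSeries μ) ∧
      ∀ (E' : M.UpperSeries μ) (E : M.LowerSeries μ),
        ∃ (π' : M.H →* (E'.carrier ≃ₗᵢ[ℂ] E'.carrier))
          (π : M.H →* (E.carrier ≃ₗᵢ[ℂ] E.carrier))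
          (Δ : E'.carrier ≃ₗᵢ⋆[ℂ] StrongDual ℂ E.carrier)
          (R : Hν →L[ℂ] E.carrier) (J : E'.carrier →L[ℂ] Hν),
          (∀ g f, π' g (E'.ι f) = E'.ι (M.ps (2 * ρ - μ) g f)) ∧
          (∀ g (f : M.lowerSpace μ), ∃ hf : M.ps μ g f ∈ M.lowerSpace μ,
            π g (E.ι f) = E.ι ⟨M.ps μ g f, hf⟩) ∧
          (∀ f f' : C(M.S, ℂ), (∀ s, f s = M.knappStein μ f' s) →
            ∃ hf : f ∈ M.lowerSpace μ, ‖E.ι ⟨f, hf⟩‖ = ‖E'.ι f'‖) ∧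
          (∀ (f : M.lowerSpace μ) f', Δ (E'.ι f') (E.ι f) = M.pairing f f') ∧
          (∀ g x x', Δ (π' g x') (π g x) = Δ x' x) ∧
          (∀ R' : Hν →L[ℂ] E.carrier,
            (∀ (φ : Hν) f, M.IsRestriction φ f →
              ∃ hf : f ∈ M.lowerSpace μ, R' φ = E.ι ⟨f, hf⟩) ↔ R' = R) ∧
          (∀ g φ, R (U g φ) = π g (R φ)) ∧
          (∀ x' φ, inner ℂ (J x') φ = Δ x' (R φ)) ∧
          (∀ f z, J (E'.ι f) z = M.J ν f z) ∧
          (∀ g x', J (π' g x') = U g (J x')) := by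
  obtain ⟨J₀, hJz, hJi, hJt⟩ := hM.exists_J hK hμ
  have hne : Nonempty (M.UpperSeries μ) := nonempty_upperSeries J₀ hJi
  refine ⟨hne, ?_, fun E' E => ?_⟩
  -- The lower series may be modelled on the Hilbert space of the upper one, with the Riesz map as
  -- embedding.
  · obtain ⟨E'⟩ := hne
    exact ⟨{ carrier := E'.carrier, ι := riesz E', norm_ι := norm_riesz E',
             dense := hM.denseRange_riesz hK J₀ hJi hJt E' }⟩
  obtain ⟨J, hJ⟩ := exists_extension_J J₀ hJi E'
  -- the representation on the upper series
  have hJU : ∀ g f, U g (J (E'.ι f)) = J (E'.ι (M.ps (2 * ρ - μ) g f)) := by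
    intro g f
    ext z
    rw [hU, hJ, hJ, hJz, hJz, hM.J_ps]
  obtain ⟨π', hπ'⟩ := exists_rep_of_isometry J U fun g x => by
    have hcl : IsClosed {x | U g (J x) ∈ Set.range J} :=
      J.isometry.isClosedEmbedding.isClosed_range.preimage (by fun_prop)
    exact E'.dense.induction_on (p := fun x => U g (J x) ∈ Set.range J) x hcl
      fun f => ⟨_, (hJU g f).symm⟩
  have hπ'ι : ∀ g f, π' g (E'.ι f) = E'.ι (M.ps (2 * ρ - μ) g f) := fun g f =>
    J.injective (by rw [hπ', hJU])
  -- the identification of the lower series with the upper one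
  have hdense := hM.denseRange_riesz hK J₀ hJi hJt E'
  let T : E.carrier ≃ₗᵢ[ℂ] E'.carrier :=
    (LinearEquiv.refl ℂ (M.lowerSpace μ)).extendOfIsometry E.ι (riesz E') E.dense hdense
      fun g => by rw [LinearEquiv.refl_apply, norm_riesz, E.norm_ι]
  have hT : ∀ g, T (E.ι g) = riesz E' g := fun g =>
    LinearEquiv.extendOfIsometry_eq _ _ _ _ _ _ g
  obtain ⟨π, hπ⟩ := exists_rep_of_isometry T.toLinearIsometry π' fun g x =>
    ⟨T.symm (π' g (T x)), by simp⟩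
  replace hπ : ∀ g x, T (π g x) = π' g (T x) := hπ
  let Δ : E'.carrier ≃ₗᵢ⋆[ℂ] StrongDual ℂ E.carrier :=
    T.symm.trans (InnerProductSpace.toDual ℂ E.carrier)
  have hΔ : ∀ x' x, Δ x' x = inner ℂ x' (T x) := by
    intro x' x
    show inner ℂ (T.symm x') x = _
    rw [← T.inner_map_map, T.apply_symm_apply]
  let R : Hν →L[ℂ] E.carrier :=
    (T.symm : E'.carrier →L[ℂ] E.carrier) ∘L J.toContinuousLinearMap.adjoint
  have hTR : ∀ φ, T (R φ) = J.toContinuousLinearMap.adjoint φ := fun φ => T.apply_symm_apply _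
  have hJR : ∀ x' φ, inner ℂ (J x') φ = inner ℂ x' (T (R φ)) := by
    intro x' φ
    rw [hTR, ContinuousLinearMap.adjoint_inner_right]
    rfl
  have hinv := inner_rep_inv π'
  have hUinv := inner_rep_inv U
  have hRres : ∀ (φ : Hν) f, M.IsRestriction φ f →
      ∃ hf : f ∈ M.lowerSpace μ, R φ = E.ι ⟨f, hf⟩ := by
    intro φ f h
    obtain ⟨hf, h1⟩ := hM.riesz_restriction J₀ hJt E' J hJ h
    exact ⟨hf, T.injective (by rw [hTR, hT, h1])⟩
  refine ⟨π', π, Δ, R, J.toContinuousLinearMap, hπ'ι, fun g f => ?_, fun f f' h => ?_,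
    fun f f' => ?_, fun g x x' => ?_, fun R' => ⟨fun h => ?_, ?_⟩, fun g φ => ?_,
    fun x' φ => ?_, fun f z => ?_, hπ'⟩
  · obtain ⟨hf, h1⟩ := exists_riesz_eq E' (g := M.ps μ g f) (t := π' g (riesz E' f)) fun f' => by
      rw [← inner_conj_symm, hinv, inner_conj_symm, hπ'ι, inner_riesz, hM.pairing_ps]
    exact ⟨hf, T.injective (by rw [hπ, hT, hT, h1])⟩
  -- The inner product of `J f''` and `J f'` is the Knapp–Stein form, so the Riesz vector of `Λ_μ
  -- f'` is `f'` itself.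
  · obtain ⟨hf, h1⟩ := exists_riesz_eq E' (g := f) (t := E'.ι f') fun f'' => by
      rw [← J.inner_map_map, hJ, hJ, hJi]
      simp only [Model.pairing, h]
    exact ⟨hf, by rw [← T.norm_map, hT, h1]⟩
  · rw [hΔ, hT, inner_riesz]
  · rw [hΔ, hΔ, hπ, LinearIsometryEquiv.inner_map_map]
  -- Both operators are forced on the kernel functions, whose span is dense.
  · refine ContinuousLinearMap.ext fun φ => ?_
    refine (denseRange_kerFun Hν).induction_on (p := fun φ => R' φ = R φ) φ
      (isClosed_eq (by fun_prop) (by fun_prop)) fun c => ?_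
    have h1 : ∀ z, R' (RKHS.kerFun Hν z (1 : ℂ)) = R (RKHS.kerFun Hν z (1 : ℂ)) := by
      intro z
      obtain ⟨f, hf⟩ := hM.exists_isRestriction_kerFun hK z
      obtain ⟨_, h2⟩ := h _ f hf
      obtain ⟨_, h3⟩ := hRres _ f hf
      rw [h2, h3]
    simp only [Finsupp.linearCombination_apply, Finsupp.sum, map_sum, map_smul, h1]
  · rintro rfl
    exact hRres
  · refine T.injective (ext_inner_left ℂ fun x' => ?_)
    rw [hπ, ← hJR, ← inner_conj_symm, hUinv, inner_conj_symm, ← hπ', hJR, ← inner_conj_symm, ← hinv, inner_conj_symm]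
  · rw [hΔ, ← hJR]
    rfl
  · rw [← hJz, ← hJ]
    rfl

include hK in
theorem exists_unitary : ∃ U : M.H →* (Hν ≃ₗᵢ[ℂ] Hν),
    ∀ g φ z, U g φ z = M.facD g⁻¹ z ^ (-ν : ℂ) * φ (M.actD g⁻¹ z) :=
  exists_unitary_rep M.actD (fun g z => M.facD g z ^ (-ν : ℂ)) hM.actD_one hM.actD_mul
    hM.facD_one hM.facD_mul fun g z w => by
      rw [hK, hK]
      exact hM.kernel_act g z w

include hK in
theorem J_one_mem_iff : (∃ φ : Hν, ∀ z, φ z = M.J ν 1 z) ↔ μ < ρ := by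
  constructor
  · rintro ⟨φ, hφ⟩
    exact hM.lt_of_J_one_mem hK hφ
  · intro hμ
    obtain ⟨J₀, hJz, -⟩ := hM.exists_J hK hμ
    exact ⟨J₀ 1, hJz 1⟩

end Model.IsCovariant

end

section

/-! ### Principal powers of automorphy factors -/

/-- A multiplicative identity between continuous functions avoiding the closed negative half-line
passes to principal powers when it does so at one point. -/
theorem cpow_mul_of_preconnected {X : Type*} [TopologicalSpace X] [PreconnectedSpace X]
    {A B C E : X → ℂ} (hA : Continuous A) (hB : Continuous B) (hC : Continuous C)
    (hE : Continuous E) (hA' : ∀ x, A x ∈ Complex.slitPlane) (hB' : ∀ x, B x ∈ Complex.slitPlane)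
    (hC' : ∀ x, C x ∈ Complex.slitPlane) (hE' : ∀ x, E x ∈ Complex.slitPlane)
    (h : ∀ x, A x * B x * C x = E x) {x₀ : X} (hA₀ : 0 < A x₀) (hE₀ : 0 < E x₀) (s : ℂ) (x : X) :
    A x ^ s * B x ^ s * C x ^ s = E x ^ s := by
  have nA := fun x => Complex.slitPlane_ne_zero (hA' x)
  have nB := fun x => Complex.slitPlane_ne_zero (hB' x)
  have nC := fun x => Complex.slitPlane_ne_zero (hC' x)
  have nE := fun x => Complex.slitPlane_ne_zero (hE' x)
  -- The function `θ` measures the discrepancy of the logarithms. It is continuous with values in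
  -- `2πiℤ`, so it vanishes wherever its imaginary part is smaller than `2π`.
  set θ : X → ℂ := fun x =>
    Complex.log (A x) + Complex.log (B x) + Complex.log (C x) - Complex.log (E x) with hθ
  have hθc : Continuous θ := (((hA.clog hA').add (hB.clog hB')).add (hC.clog hC')).sub (hE.clog hE')
  have hexp : ∀ x, Complex.exp (θ x) = 1 := by
    intro x
    rw [hθ]
    simp only [Complex.exp_sub, Complex.exp_add, Complex.exp_log (nA x), Complex.exp_log (nB x),
      Complex.exp_log (nC x), Complex.exp_log (nE x), h, div_self (nE x)]
  have hint : ∀ x, ∃ n : ℤ, θ x = n * (2 * Real.pi * Complex.I) := fun x =>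
    Complex.exp_eq_one_iff.mp (hexp x)
  have hzero : ∀ x, |(θ x).im| < 2 * Real.pi → θ x = 0 := by
    intro x hx
    obtain ⟨n, hn⟩ := hint x
    have him : (θ x).im = n * (2 * Real.pi) := by
      rw [hn]; simp
    rw [him, abs_mul, abs_of_pos Real.two_pi_pos] at hx
    have h1 : |(n : ℝ)| < 1 := by
      by_contra! h2
      nlinarith [Real.two_pi_pos]
    have h2 : n = 0 := by
      rw [← Int.cast_abs] at h1
      have : |n| < 1 := by exact_mod_cast h1
      exact Int.abs_lt_one_iff.mp this
    rw [hn, h2]; simp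
  -- At `x₀` the positive values `A` and `E` have argument zero; the other two arguments lie
  -- strictly between `-π` and `π`.
  have hx₀ : θ x₀ = 0 := by
    apply hzero
    have a1 : Complex.arg (A x₀) = 0 := Complex.arg_eq_zero_iff_zero_le.mpr hA₀.le
    have a2 : Complex.arg (E x₀) = 0 := Complex.arg_eq_zero_iff_zero_le.mpr hE₀.le
    have b1 := Complex.mem_slitPlane_iff_arg.mp (hB' x₀)
    have b2 := Complex.mem_slitPlane_iff_arg.mp (hC' x₀)
    simp only [hθ, Complex.sub_im, Complex.add_im, Complex.log_im, a1, a2]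
    have c1 := Complex.arg_le_pi (B x₀)
    have c2 := Complex.arg_le_pi (C x₀)
    have c3 := Complex.neg_pi_lt_arg (B x₀)
    have c4 := Complex.neg_pi_lt_arg (C x₀)
    have d1 := lt_of_le_of_ne c1 b1.1
    have d2 := lt_of_le_of_ne c2 b2.1
    rw [abs_lt]
    constructor <;> linarith
  have hclopen : IsClopen {x | θ x = 0} := by
    refine ⟨isClosed_eq hθc continuous_const, ?_⟩
    have : {x | θ x = 0} = {x | |(θ x).im| < 2 * Real.pi} := by
      ext x
      refine ⟨fun hx => ?_, hzero x⟩
      simp only [Set.mem_ofPred_eq] at hx ⊢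
      rw [hx]
      simpa using Real.pi_pos
    rw [this]
    exact isOpen_lt (by fun_prop) continuous_const
  have huniv := hclopen.eq_univ ⟨x₀, hx₀⟩
  have hx : θ x = 0 := by
    have : x ∈ {x | θ x = 0} := by rw [huniv]; trivial
    exact this
  rw [Complex.cpow_def_of_ne_zero (nA x), Complex.cpow_def_of_ne_zero (nB x),
    Complex.cpow_def_of_ne_zero (nC x), Complex.cpow_def_of_ne_zero (nE x), ← Complex.exp_add,
    ← Complex.exp_add]
  congr 1
  rw [← add_mul, ← add_mul]
  congr 1
  exact sub_eq_zero.mp hx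

theorem conj_mem_slitPlane {z : ℂ} (hz : z ∈ Complex.slitPlane) : conj z ∈ Complex.slitPlane := by
  rw [Complex.mem_slitPlane_iff] at *
  simpa using hz

theorem mul_mem_slitPlane_of_pos {z : ℂ} {c : ℂ} (hz : z ∈ Complex.slitPlane) (hc : 0 < c) :
    z * c ∈ Complex.slitPlane := by
  obtain ⟨r, hr, rfl⟩ : ∃ r : ℝ, 0 < r ∧ (r : ℂ) = c :=
    ⟨c.re, (Complex.lt_def.mp hc).1, Complex.ext rfl (Complex.lt_def.mp hc).2⟩
  rw [Complex.mem_slitPlane_iff] at *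
  simpa [hr, hr.ne'] using hz

/-- The algebraic properties of a model, with exponent `κ` relating the automorphy factor on the
boundary to the one on the sphere. -/
structure Model.IsAlgebraic (M : Model) (k : ℝ → M.S → M.S → ℝ) (κ : ℕ) : Prop where
  smul_mem : ∀ r : ℝ, 0 ≤ r → r ≤ 1 → ∀ z ∈ M.D, r • z ∈ M.D
  zero_mem : 0 ∈ M.D
  actD_one : ∀ z, M.actD 1 z = z
  actD_mul : ∀ g g' z, M.actD (g * g') z = M.actD g (M.actD g' z)
  continuous_actD : ∀ g, Continuous (M.actD g)
  facD_mul : ∀ g g' z, M.facD (g * g') z = M.facD g (M.actD g' z) * M.facD g' z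
  continuous_facD : ∀ g, Continuous (M.facD g)
  facD_zero_pos : ∀ g, 0 < M.facD g ⟨0, zero_mem⟩
  h_act : ∀ g z w, M.facD g z * conj (M.facD g w) * M.h (M.actD g z) (M.actD g w) = M.h z w
  actS_one : ∀ s, M.actS 1 s = s
  actS_mul : ∀ g g' s, M.actS (g * g') s = M.actS g (M.actS g' s)
  facS_pos : ∀ g s, 0 < M.facS g s
  facS_one : ∀ s, M.facS 1 s = 1
  facS_mul : ∀ g g' s, M.facS (g * g') s = M.facS g (M.actS g' s) * M.facS g' s
  boundary_act : ∀ g (z : M.D) s, M.facD g z * ((M.facS g s ^ κ : ℝ) : ℂ) *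
    M.h (M.actD g z) (M.emb (M.actS g s)) = M.h z (M.emb s)
  smul_emb_mem : ∀ r : ℝ, 0 ≤ r → r < 1 → ∀ s, r • M.emb s ∈ M.D
  continuous_emb : Continuous M.emb
  continuous_h : Continuous fun p : M.V × M.V => M.h p.1 p.2
  slit : ∀ z ∈ M.D, ∀ w ∈ closure M.D, M.h z w ∈ Complex.slitPlane
  conj_h : ∀ z w, conj (M.h z w) = M.h w z
  h_zero : ∀ z, M.h z 0 = 1
  h_smul_emb : ∀ r : ℝ, 0 ≤ r → r ≤ 1 → ∀ t : ℝ, 0 ≤ t → t ≤ 1 → ∀ s u,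
    M.h (r • M.emb s) (t • M.emb u) = ((k (r * t) s u ^ κ : ℝ) : ℂ)
  k_nonneg : ∀ r s u, 0 ≤ k r s u
  continuous_coord : Continuous M.coord
  coord_coord : ∀ z, M.coord (M.coord z) = z
  differentiable_h : ∀ w, Differentiable ℂ fun z => M.h (M.coord z) w

/-- Conditions on kernels `k r`, `0 ≤ r < 1`, with boundary value `kn`, under which the integrability
of `kn ^ (-μ)` is governed by the critical exponent `ρ`. -/
structure IsCriticalFamily {S : Type} [TopologicalSpace S] [MeasurableSpace S] (σ : Measure S)
    (kn : S → S → ℝ) (k : ℝ → S → S → ℝ) (μ ρ : ℝ) : Prop where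
  continuous_k : Continuous fun p : ℝ × S × S => k p.1 p.2.1 p.2.2
  k_zero : ∀ s u, k 0 s u = 1
  k_one : ∀ s u, k 1 s u = kn s u
  kn_le : ∀ r : ℝ, 0 ≤ r → r ≤ 1 → ∀ s u, kn s u ≤ 2 * k r s u
  kn_pos : μ < ρ → ∀ᵐ p ∂σ.prod σ, 0 < kn p.1 p.2
  integrable_kn : μ < ρ → Integrable (fun p : S × S => kn p.1 p.2 ^ (-μ)) (σ.prod σ)
  lt_of_bounded : (∃ C, ∀ r : ℝ, 0 ≤ r → r < 1 → ∫ x, ∫ u, k r x u ^ (-μ) ∂σ ∂σ ≤ C) → μ < ρ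

namespace Model.IsAlgebraic

variable {M : Model} {k : ℝ → M.S → M.S → ℝ} {κ : ℕ} (hM : M.IsAlgebraic k κ)
include hM

theorem zero_h (z : M.V) : M.h 0 z = 1 := by
  rw [← hM.conj_h, hM.h_zero, map_one]

theorem preconnectedSpace : PreconnectedSpace M.D := by
  have h : StarConvex ℝ (0 : M.V) M.D := by
    intro z hz a b ha hb hab
    rw [smul_zero, zero_add]
    exact hM.smul_mem b hb (by linarith) z hz
  exact Subtype.preconnectedSpace (h.isPathConnected hM.zero_mem).isConnected.isPreconnected

theorem emb_mem_closure (s : M.S) : M.emb s ∈ closure M.D := by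
  have h1 : Tendsto (fun r : ℝ => r • M.emb s) (𝓝[<] 1) (𝓝 (M.emb s)) := by
    have : Continuous fun r : ℝ => r • M.emb s := by fun_prop
    simpa using (this.tendsto 1).mono_left nhdsWithin_le_nhds
  refine mem_closure_of_tendsto h1 ?_
  filter_upwards [Ioo_mem_nhdsLT (show (0 : ℝ) < 1 by norm_num)] with r hr
  exact hM.smul_emb_mem r hr.1.le hr.2 s

/-- Take `w = g⁻¹ · 0` in the covariance of `h`. Since `h(·, 0) = 1`, the factor `facD g z` equals
`h(z, g⁻¹ · 0)` times the conjugate of `facD g⁻¹ 0`, a point of the slit plane times a positive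
number. -/
theorem facD_slit (g : M.H) (z : M.D) : M.facD g z ∈ Complex.slitPlane := by
  set o : M.D := ⟨0, hM.zero_mem⟩ with ho
  have h1 := hM.h_act g z (M.actD g⁻¹ o)
  have h2 : M.actD g (M.actD g⁻¹ o) = o := by rw [← hM.actD_mul, mul_inv_cancel, hM.actD_one]
  have h3 : M.facD 1 o = 1 := by
    have h4 := hM.facD_mul 1 1 o
    rw [mul_one, hM.actD_one] at h4
    exact (mul_eq_left₀ (hM.facD_zero_pos 1).ne').mp h4.symm
  have h5 : M.facD g (M.actD g⁻¹ o) * M.facD g⁻¹ o = 1 := by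
    rw [← hM.facD_mul, mul_inv_cancel, h3]
  rw [h2, show M.h (M.actD g z) o = 1 from hM.h_zero _, mul_one] at h1
  have h6 : M.facD g z = M.h z (M.actD g⁻¹ o) * conj (M.facD g⁻¹ o) := by
    rw [← h1, mul_assoc, ← map_mul, h5, map_one, mul_one]
  rw [h6]
  refine mul_mem_slitPlane_of_pos (hM.slit _ z.2 _ (subset_closure (M.actD g⁻¹ o).2)) ?_
  have h7 : 0 < M.facD g⁻¹ o := hM.facD_zero_pos g⁻¹
  have h8 := Complex.lt_def.mp h7
  refine Complex.lt_def.mpr ⟨by simpa using h8.1, ?_⟩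
  have := h8.2
  simp only [Complex.zero_im, Complex.conj_im] at this ⊢
  rw [← this, neg_zero]

theorem facD_one (z : M.D) : M.facD 1 z = 1 := by
  have h4 := hM.facD_mul 1 1 z
  rw [mul_one, hM.actD_one] at h4
  exact (mul_eq_left₀ (Complex.slitPlane_ne_zero (hM.facD_slit 1 z))).mp h4.symm

/-- The domain is star-shaped about `0`, and both `facD g'` and `facD (g * g')` are positive at that
point, so no branch jump occurs. The third factor allowed by `cpow_mul_of_preconnected` is taken to
be `1`. -/
theorem facD_mul_cpow (g g' : M.H) (z : M.D) (s : ℂ) :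
    M.facD (g * g') z ^ s = M.facD g (M.actD g' z) ^ s * M.facD g' z ^ s := by
  have := hM.preconnectedSpace
  have h := cpow_mul_of_preconnected (A := M.facD g') (B := fun z => M.facD g (M.actD g' z))
    (C := fun _ => 1) (E := M.facD (g * g')) (hM.continuous_facD g')
    ((hM.continuous_facD g).comp (hM.continuous_actD g')) continuous_const
    (hM.continuous_facD _) (hM.facD_slit g') (fun _ => hM.facD_slit g _)
    (fun _ => Complex.one_mem_slitPlane) (hM.facD_slit _)
    (fun z => by rw [hM.facD_mul, mul_one, mul_comm]) (hM.facD_zero_pos g') (hM.facD_zero_pos _) s z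
  rw [← h, Complex.one_cpow, mul_one, mul_comm]

theorem h_act_cpow (g : M.H) (z w : M.D) (s : ℝ) :
    M.facD g z ^ (s : ℂ) * conj (M.facD g w ^ (s : ℂ)) *
      M.h (M.actD g z) (M.actD g w) ^ (s : ℂ) = M.h z w ^ (s : ℂ) := by
  have := hM.preconnectedSpace
  have hc : ∀ w : M.D, Continuous fun z : M.D => M.h z w := fun w =>
    hM.continuous_h.comp (continuous_subtype_val.prodMk continuous_const)
  have h := cpow_mul_of_preconnected (A := M.facD g) (B := fun _ => conj (M.facD g w))
    (C := fun z => M.h (M.actD g z) (M.actD g w)) (E := fun z : M.D => M.h z w)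
    (hM.continuous_facD g) continuous_const ((hc _).comp (hM.continuous_actD g)) (hc w)
    (hM.facD_slit g) (fun _ => conj_mem_slitPlane (hM.facD_slit g w))
    (fun z => hM.slit _ (M.actD g z).2 _ (subset_closure (M.actD g w).2))
    (fun z => hM.slit _ z.2 _ (subset_closure w.2)) (fun z => hM.h_act g z w)
    (hM.facD_zero_pos g) (by rw [hM.zero_h]; exact one_pos) (s : ℂ) z
  rw [← h, ← Complex.conj_conj (s : ℂ), ← Complex.conj_cpow _ _
    (Complex.slitPlane_arg_ne_pi (hM.facD_slit g w)), Complex.conj_conj, Complex.conj_ofReal]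

theorem boundary_act_cpow (g : M.H) (z : M.D) (u : M.S) (s : ℝ) :
    M.facD g z ^ (s : ℂ) * M.h (M.actD g z) (M.emb (M.actS g u)) ^ (s : ℂ) *
      ((M.facS g u ^ (κ * s) : ℝ) : ℂ) = M.h z (M.emb u) ^ (s : ℂ) := by
  have := hM.preconnectedSpace
  have hc : ∀ w : M.V, Continuous fun z : M.D => M.h z w := fun w =>
    hM.continuous_h.comp (continuous_subtype_val.prodMk continuous_const)
  have hp : (0 : ℝ) < M.facS g u ^ κ := pow_pos (hM.facS_pos g u) _
  have h := cpow_mul_of_preconnected (A := M.facD g) (B := fun _ => ((M.facS g u ^ κ : ℝ) : ℂ))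
    (C := fun z => M.h (M.actD g z) (M.emb (M.actS g u))) (E := fun z : M.D => M.h z (M.emb u))
    (hM.continuous_facD g) continuous_const ((hc _).comp (hM.continuous_actD g)) (hc _)
    (hM.facD_slit g) (fun _ => Complex.ofReal_mem_slitPlane.mpr hp)
    (fun z => hM.slit _ (M.actD g z).2 _ (hM.emb_mem_closure _))
    (fun z => hM.slit _ z.2 _ (hM.emb_mem_closure _)) (fun z => hM.boundary_act g z u)
    (hM.facD_zero_pos g) (by rw [hM.zero_h]; exact one_pos) (s : ℂ) z
  rw [← h, ← Complex.ofReal_cpow hp.le, ← Real.rpow_natCast_mul (hM.facS_pos g u).le]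
  ring

/-- The algebraic properties of a model, together with positivity of the kernel, the Jacobian on the
sphere and the integrability of the boundary kernel. -/
theorem isCovariant {ν μ ρ : ℝ} (hμν : μ = κ * ν) (hμ : 0 < μ)
    (secondCountable : SecondCountableTopology M.S)
    (psd : (Matrix.of (M.kernel ν)).PosSemidef)
    (integral_act : ∀ g (f : C(M.S, ℂ)),
      ∫ s, ((M.facS g s ^ (-(2 * ρ)) : ℝ) : ℂ) * f (M.actS g s) ∂M.sigma = ∫ s, f s ∂M.sigma)
    (hk : IsCriticalFamily M.sigma M.kn k μ ρ) :
    M.IsCovariant k ν μ ρ where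
  secondCountable := secondCountable
  psd := psd
  actD_one := hM.actD_one
  actD_mul := hM.actD_mul
  facD_one z := by rw [hM.facD_one, Complex.one_cpow]
  facD_mul g g' z := hM.facD_mul_cpow g g' z _
  kernel_act g z w := by
    have := hM.h_act_cpow g z w (-ν)
    push_cast at this
    exact this
  actS_one := hM.actS_one
  actS_mul := hM.actS_mul
  facS_pos := hM.facS_pos
  facS_one := hM.facS_one
  facS_mul := hM.facS_mul
  boundary_act g z s := by
    have := hM.boundary_act_cpow g z s (-ν)
    rw [mul_neg, ← hμν] at this
    simpa only [Complex.ofReal_neg] using this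
  integral_act := integral_act
  smul_emb_mem := hM.smul_emb_mem
  continuous_emb := hM.continuous_emb
  continuous_h := hM.continuous_h
  slit := hM.slit
  conj_h := hM.conj_h
  h_smul_emb r hr0 hr1 t ht0 ht1 s u := by
    have hk := hM.k_nonneg (r * t) s u
    rw [hM.h_smul_emb r hr0 hr1.le t ht0 ht1, ← Complex.ofReal_neg,
      ← Complex.ofReal_cpow (pow_nonneg hk _), ← Real.rpow_natCast_mul hk, hμν, mul_neg]
  continuous_k := hk.continuous_k
  k_zero := hk.k_zero
  k_one := hk.k_one
  kn_le := hk.kn_le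
  mu_pos := hμ
  kn_pos := hk.kn_pos
  integrable_kn := hk.integrable_kn
  lt_of_bounded := hk.lt_of_bounded
  continuous_coord := hM.continuous_coord
  coord_coord := hM.coord_coord
  differentiable_h := hM.differentiable_h

end Model.IsAlgebraic

end

/-! ### Invariance of Lebesgue measure under the linear action on `𝔽ⁿ × 𝔽`. -/

section LinearAction

variable {F : Type} [NormedDivisionRing F] [StarRing F] [NormedAlgebra ℝ F] {n : ℕ}

/-- The real-linear endomorphism of `𝔽ⁿ × 𝔽` given by a matrix. -/
def prodAct (g : Matrix (Fin n ⊕ Unit) (Fin n ⊕ Unit) F) :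
    (EuclideanSpace F (Fin n) × F) →ₗ[ℝ] (EuclideanSpace F (Fin n) × F) where
  toFun p := (WithLp.toLp 2 fun i => (g *ᵥ Sum.elim (fun j => p.1 j) fun _ => p.2) (Sum.inl i),
    (g *ᵥ Sum.elim (fun j => p.1 j) fun _ => p.2) (Sum.inr ()))
  map_add' p q := by
    have h : Sum.elim (fun j => (p + q).1 j) (fun _ : Unit => (p + q).2) =
        Sum.elim (fun j => p.1 j) (fun _ => p.2) + Sum.elim (fun j => q.1 j) (fun _ => q.2) := by
      funext i; rcases i with i | i <;> simp
    rw [h, mulVec_add]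
    rfl
  map_smul' r p := by
    have h : Sum.elim (fun j => (r • p).1 j) (fun _ : Unit => (r • p).2) =
        r • Sum.elim (fun j => p.1 j) (fun _ => p.2) := by
      funext i; rcases i with i | i <;> simp
    rw [h, mulVec_smul]
    rfl

variable [NormSqStar F]

theorem star_dotProduct_sig (x : Fin n → F) (y : F) :
    star (Sum.elim x (fun _ : Unit => y)) ⬝ᵥ
      (sig (Fin n) Unit F *ᵥ Sum.elim x (fun _ : Unit => y)) =
    algebraMap ℝ F (∑ i, ‖x i‖ ^ 2 - ‖y‖ ^ 2) := by
  rw [sig, fromBlocks_mulVec]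
  simp [dotProduct, NormSqStar.star_mul_self, map_sum, sub_eq_add_neg, neg_mulVec]

/-- A form-preserving matrix preserves `|x|² - |y|²` on `𝔽ⁿ × 𝔽`. -/
theorem norm_sq_prodAct {g : Matrix (Fin n ⊕ Unit) (Fin n ⊕ Unit) F} (hg : Preserves g)
    (p : EuclideanSpace F (Fin n) × F) :
    ‖(prodAct g p).1‖ ^ 2 - ‖(prodAct g p).2‖ ^ 2 = ‖p.1‖ ^ 2 - ‖p.2‖ ^ 2 := by
  set v : Fin n ⊕ Unit → F := Sum.elim (fun j => p.1 j) fun _ => p.2 with hv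
  have h2 : Sum.elim (fun j => (prodAct g p).1 j) (fun _ => (prodAct g p).2) = g *ᵥ v := by
    funext i; rcases i with i | i <;> rfl
  have h3 : star (g *ᵥ v) ⬝ᵥ (sig (Fin n) Unit F *ᵥ (g *ᵥ v)) =
      star v ⬝ᵥ (sig (Fin n) Unit F *ᵥ v) := by
    rw [star_mulVec, ← dotProduct_mulVec, mulVec_mulVec, mulVec_mulVec, hg]
  rw [← h2, hv, star_dotProduct_sig, star_dotProduct_sig] at h3
  rw [PiLp.norm_sq_eq_of_L2, PiLp.norm_sq_eq_of_L2]
  exact (algebraMap ℝ F).injective h3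

/-- This makes `𝔽` a real inner product space, so that adjoints and determinants of real-linear maps
become available uniformly over `ℝ`, `ℂ` and `ℍ`. -/
theorem parallelogram (x y : F) :
    ‖x + y‖ * ‖x + y‖ + ‖x - y‖ * ‖x - y‖ = 2 * (‖x‖ * ‖x‖ + ‖y‖ * ‖y‖) := by
  apply (algebraMap ℝ F).injective
  simp only [← sq]
  rw [map_add, map_mul, map_add, ← NormSqStar.star_mul_self, ← NormSqStar.star_mul_self,
    ← NormSqStar.star_mul_self, ← NormSqStar.star_mul_self]
  simp only [star_add, star_sub, map_ofNat]
  noncomm_ring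

variable [FiniteDimensional ℝ F]

/-- The operator `G* J G - J` is symmetric with vanishing quadratic form, hence zero. Taking
determinants gives `det G ² = 1`, because `J` is invertible. -/
theorem abs_det_eq_one_of_norm_sq_sub {E : Type*} [NormedAddCommGroup E] [InnerProductSpace ℝ E]
    [FiniteDimensional ℝ E] {G J : E →ₗ[ℝ] E} (hJ : J.IsSymmetric) (hJJ : J ∘ₗ J = LinearMap.id)
    (h : ∀ v, inner ℝ (J (G v)) (G v) = inner ℝ (J v) v) : |LinearMap.det G| = 1 := by
  have hS : (G.adjoint ∘ₗ J ∘ₗ G - J).IsSymmetric := by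
    intro x y
    simp only [LinearMap.sub_apply, LinearMap.comp_apply, inner_sub_left, inner_sub_right,
      LinearMap.adjoint_inner_left, LinearMap.adjoint_inner_right]
    rw [hJ, hJ]
  have h0 : G.adjoint ∘ₗ J ∘ₗ G - J = 0 := by
    rw [← hS.inner_map_self_eq_zero]
    intro x
    simp only [LinearMap.sub_apply, LinearMap.comp_apply, inner_sub_left,
      LinearMap.adjoint_inner_left, h, sub_self]
  have h1 : LinearMap.det G.adjoint = LinearMap.det G := by
    let b := (stdOrthonormalBasis ℝ E)
    rw [← LinearMap.det_toMatrix b.toBasis, ← LinearMap.det_toMatrix b.toBasis G,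
      LinearMap.toMatrix_adjoint, det_conjTranspose, star_trivial]
  have h2 := congrArg LinearMap.det (sub_eq_zero.mp h0)
  have h3 := congrArg LinearMap.det hJJ
  rw [LinearMap.det_comp, LinearMap.det_id] at h3
  rw [LinearMap.det_comp, LinearMap.det_comp, h1] at h2
  have hJ0 : LinearMap.det J ≠ 0 := left_ne_zero_of_mul_eq_one h3
  have h4 : LinearMap.det G * LinearMap.det G = 1 := by
    apply mul_left_cancel₀ hJ0
    linear_combination h2
  rw [← sq_eq_sq₀ (abs_nonneg _) zero_le_one, sq_abs, sq, h4, one_pow]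

theorem abs_det_prodAct {g : Matrix (Fin n ⊕ Unit) (Fin n ⊕ Unit) F} (hg : Preserves g) :
    |LinearMap.det (prodAct g)| = 1 := by
  let : InnerProductSpace ℝ F := InnerProductSpace.ofNorm ℝ parallelogram
  let e : (EuclideanSpace F (Fin n) × F) ≃ₗ[ℝ] WithLp 2 (EuclideanSpace F (Fin n) × F) :=
    (WithLp.linearEquiv 2 ℝ _).symm
  let J' : (EuclideanSpace F (Fin n) × F) →ₗ[ℝ] (EuclideanSpace F (Fin n) × F) :=
    LinearMap.prodMap LinearMap.id (-LinearMap.id)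
  let G : WithLp 2 (EuclideanSpace F (Fin n) × F) →ₗ[ℝ] WithLp 2 (EuclideanSpace F (Fin n) × F) :=
    e ∘ₗ prodAct g ∘ₗ e.symm
  let J : WithLp 2 (EuclideanSpace F (Fin n) × F) →ₗ[ℝ] WithLp 2 (EuclideanSpace F (Fin n) × F) :=
    e ∘ₗ J' ∘ₗ e.symm
  rw [← LinearMap.det_conj (prodAct g) e]
  refine abs_det_eq_one_of_norm_sq_sub (G := G) (J := J) ?_ ?_ ?_
  · intro x y
    simp [J, J', e, WithLp.prod_inner_apply]
  · ext1 x
    simp [J, J', e]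
    rfl
  · intro v
    have h : ‖(prodAct g v.ofLp).1‖ ^ 2 - ‖(prodAct g v.ofLp).2‖ ^ 2 = ‖v.fst‖ ^ 2 - ‖v.snd‖ ^ 2 :=
      norm_sq_prodAct hg v.ofLp
    simp [G, J, J', e, WithLp.prod_inner_apply]
    linarith

variable [MeasurableSpace F] [BorelSpace F]

theorem measurePreserving_prodAct {g : Matrix (Fin n ⊕ Unit) (Fin n ⊕ Unit) F} (hg : Preserves g)
    (μ : Measure (EuclideanSpace F (Fin n))) [μ.IsAddHaarMeasure] (l : Measure F)
    [l.IsAddHaarMeasure] : MeasurePreserving (prodAct g) (μ.prod l) (μ.prod l) := by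
  have : (μ.prod l).IsAddHaarMeasure := Measure.prod.instIsAddHaarMeasure μ l
  have h := abs_det_prodAct hg
  refine ⟨(LinearMap.continuous_of_finiteDimensional _).measurable, ?_⟩
  rw [Measure.map_linearMap_addHaar_eq_smul_addHaar]
  · rw [abs_inv, h]; simp
  · intro h0; rw [h0] at h; simp at h

end LinearAction

/-! ### The Jacobian of the action on the unit ball. -/

section BallAction

variable {F : Type} [NormedDivisionRing F] [NormedAlgebra ℝ F] {n : ℕ}

/-- Coordinatewise right multiplication on `𝔽ⁿ`. -/
def rightMul (y : F) : EuclideanSpace F (Fin n) →ₗ[ℝ] EuclideanSpace F (Fin n) where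
  toFun x := WithLp.toLp 2 fun i => x i * y
  map_add' x x' := by ext i; simp [add_mul]
  map_smul' r x := by ext i; simp

@[simp]
theorem rightMul_apply (y : F) (x : EuclideanSpace F (Fin n)) (i : Fin n) :
    rightMul y x i = x i * y := rfl

theorem norm_rightMul (y : F) (x : EuclideanSpace F (Fin n)) : ‖rightMul y x‖ = ‖x‖ * ‖y‖ := by
  rw [← sq_eq_sq₀ (norm_nonneg _) (by positivity), mul_pow, PiLp.norm_sq_eq_of_L2,
    PiLp.norm_sq_eq_of_L2, Finset.sum_mul]
  simp [mul_pow]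

/-- The fractional linear transformation `x ↦ (a x + b)(c x + d)⁻¹`. -/
def ballAct (g : Matrix (Fin n ⊕ Unit) (Fin n ⊕ Unit) F) (x : EuclideanSpace F (Fin n)) :
    EuclideanSpace F (Fin n) :=
  WithLp.toLp 2 fun i => sNum g (fun j => x j) i * (sDen g fun j => x j)⁻¹

variable [FiniteDimensional ℝ F]

theorem finrank_pos_of_pos (hn : 0 < n) : 0 < Module.finrank ℝ (EuclideanSpace F (Fin n)) := by
  have : Nonempty (Fin n) := ⟨⟨0, hn⟩⟩
  exact Module.finrank_pos

variable [MeasurableSpace F] [BorelSpace F]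

/-- Right multiplication by `y` scales norms by `‖y‖`. Its determinant is read off from the measures
of a ball and of its preimage, without any computation in coordinates. -/
theorem lintegral_rightMul (μ : Measure (EuclideanSpace F (Fin n))) [μ.IsAddHaarMeasure] {y : F}
    (hy : y ≠ 0) {f : EuclideanSpace F (Fin n) → ℝ≥0∞} (hf : Measurable f) :
    ∫⁻ x, f x ∂μ = ENNReal.ofReal (‖y‖ ^ Module.finrank ℝ (EuclideanSpace F (Fin n))) *
      ∫⁻ x, f (rightMul y x) ∂μ := by
  have hy' : 0 < ‖y‖ := norm_pos_iff.mpr hy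
  have hdet : LinearMap.det (rightMul (n := n) y) ≠ 0 := by
    have h : rightMul (n := n) y ∘ₗ rightMul y⁻¹ = LinearMap.id := by
      ext x i
      simp [hy]
    have h2 := congrArg LinearMap.det h
    rw [LinearMap.det_comp, LinearMap.det_id] at h2
    exact left_ne_zero_of_mul_eq_one h2
  have hmeas : Measurable (rightMul (n := n) y) :=
    (LinearMap.continuous_of_finiteDimensional _).measurable
  have hmap := Measure.map_linearMap_addHaar_eq_smul_addHaar μ hdet
  set c := ENNReal.ofReal |(LinearMap.det (rightMul (n := n) y))⁻¹|
  have h1 : ∫⁻ x, f (rightMul y x) ∂μ = c * ∫⁻ x, f x ∂μ := by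
    rw [← lintegral_map hf hmeas, hmap, lintegral_smul_measure, smul_eq_mul]
  have hball : rightMul (n := n) y ⁻¹' Metric.ball 0 ‖y‖ = Metric.ball 0 1 := by
    ext x
    simp only [Set.mem_preimage, mem_ball_zero_iff, norm_rightMul]
    exact mul_lt_iff_lt_one_left hy'
  have h2 := congrArg (fun m => m (Metric.ball 0 ‖y‖)) hmap
  simp only [Measure.map_apply hmeas Metric.isOpen_ball.measurableSet, hball, Measure.smul_apply,
    smul_eq_mul, Measure.addHaar_ball_of_pos μ (0 : EuclideanSpace F (Fin n)) hy'] at h2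
  have hb0 : μ (Metric.ball (0 : EuclideanSpace F (Fin n)) 1) ≠ 0 :=
    (Metric.measure_ball_pos μ _ one_pos).ne'
  have hb1 : μ (Metric.ball (0 : EuclideanSpace F (Fin n)) 1) ≠ ∞ := measure_ball_lt_top.ne
  have h3 : ENNReal.ofReal (‖y‖ ^ Module.finrank ℝ (EuclideanSpace F (Fin n))) * c = 1 := by
    have h4 : 1 * μ (Metric.ball (0 : EuclideanSpace F (Fin n)) 1) =
        (ENNReal.ofReal (‖y‖ ^ Module.finrank ℝ (EuclideanSpace F (Fin n))) * c) *
          μ (Metric.ball (0 : EuclideanSpace F (Fin n)) 1) := by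
      rw [one_mul]
      refine h2.trans ?_
      ring
    exact ((ENNReal.mul_left_inj hb0 hb1).mp h4).symm
  rw [h1, ← mul_assoc, h3, one_mul]

/-- The weight `∫_{|y| < 1} |y|^m dy`. -/
def ballWeight (l : Measure F) (m : ℕ) : ℝ≥0∞ :=
  ∫⁻ y, ENNReal.ofReal (‖y‖ ^ m) * (Metric.ball (0 : F) 1).indicator 1 y ∂l

theorem ballWeight_ne_zero (l : Measure F) [l.IsAddHaarMeasure] (m : ℕ) :
    ballWeight l m ≠ 0 := by
  have hm : Measurable fun y : F =>
      ENNReal.ofReal (‖y‖ ^ m) * (Metric.ball (0 : F) 1).indicator 1 y :=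
    (by fun_prop : Measurable fun y : F => ENNReal.ofReal (‖y‖ ^ m)).mul
      (measurable_one.indicator Metric.isOpen_ball.measurableSet)
  rw [ballWeight, Ne, lintegral_eq_zero_iff hm]
  intro h
  have h1 : Metric.ball (0 : F) 1 \ {0} ⊆ {y | ¬ ENNReal.ofReal (‖y‖ ^ m) *
      (Metric.ball (0 : F) 1).indicator 1 y = (0 : F → ℝ≥0∞) y} := by
    rintro y ⟨hy, hy0⟩
    simp
    exact ⟨fun h => absurd h hy0, by simpa using hy⟩
  have h2 := measure_mono_null h1 h
  rw [measure_sdiff_null (measure_singleton _)] at h2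
  exact (Metric.measure_ball_pos l 0 one_pos).ne' h2

theorem ballWeight_ne_top (l : Measure F) [l.IsAddHaarMeasure] (m : ℕ) :
    ballWeight l m ≠ ∞ := by
  refine ne_top_of_le_ne_top (measure_ball_lt_top (μ := l) (x := 0) (r := 1)).ne ?_
  rw [ballWeight, ← lintegral_indicator_one Metric.isOpen_ball.measurableSet]
  refine lintegral_mono fun y => ?_
  by_cases hy : y ∈ Metric.ball (0 : F) 1
  · simp only [hy, Set.indicator_of_mem, Pi.one_apply, mul_one]
    rw [mem_ball_zero_iff] at hy
    exact ENNReal.ofReal_le_one.mpr (pow_le_one₀ (norm_nonneg _) hy.le)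
  · simp [hy]

theorem lintegral_ballWeight (l : Measure F) [l.IsAddHaarMeasure] (m : ℕ) {t : ℝ} (ht : 0 < t) :
    ∫⁻ y, ENNReal.ofReal (‖y‖ ^ m) * (Metric.ball (0 : F) 1).indicator 1 (t • y) ∂l =
      ENNReal.ofReal (t⁻¹ ^ (m + Module.finrank ℝ F)) * ballWeight l m := by
  set h : F → ℝ≥0∞ := fun y => ENNReal.ofReal (t⁻¹ ^ m) *
    (ENNReal.ofReal (‖y‖ ^ m) * (Metric.ball (0 : F) 1).indicator 1 y) with hh
  have hm' : Measurable fun y : F =>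
      ENNReal.ofReal (‖y‖ ^ m) * (Metric.ball (0 : F) 1).indicator 1 y :=
    (by fun_prop : Measurable fun y : F => ENNReal.ofReal (‖y‖ ^ m)).mul
      (measurable_one.indicator Metric.isOpen_ball.measurableSet)
  have hm : Measurable h := hm'.const_mul _
  have h1 : ∀ y : F, ENNReal.ofReal (‖y‖ ^ m) * (Metric.ball (0 : F) 1).indicator 1 (t • y) =
      h (t • y) := by
    intro y
    rw [hh]
    simp only
    rw [← mul_assoc, ← ENNReal.ofReal_mul (by positivity), norm_smul, Real.norm_of_nonneg ht.le,
      ← mul_pow, inv_mul_cancel_left₀ ht.ne']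
  simp only [h1]
  rw [← lintegral_map (f := h) hm (measurable_const_smul t), Measure.map_addHaar_smul l ht.ne',
    lintegral_smul_measure, smul_eq_mul, hh, lintegral_const_mul _ hm', ← mul_assoc, ballWeight,
    ← ENNReal.ofReal_mul (by positivity)]
  congr 2
  rw [abs_of_pos (by positivity), pow_add, inv_pow, inv_pow, mul_comm]

/-- These are the homogeneous coordinates `(x y, y)`, in which a linear map of `𝔽ⁿ × 𝔽` induces a
fractional linear map in `x`. The null set `y = 0` is discarded. -/
theorem lintegral_prod_rightMul (μ : Measure (EuclideanSpace F (Fin n))) [μ.IsAddHaarMeasure]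
    (l : Measure F) [l.IsAddHaarMeasure] {f : EuclideanSpace F (Fin n) × F → ℝ≥0∞}
    (hf : Measurable f) :
    ∫⁻ p, f p ∂μ.prod l = ∫⁻ y, ∫⁻ x,
      ENNReal.ofReal (‖y‖ ^ Module.finrank ℝ (EuclideanSpace F (Fin n))) * f (rightMul y x, y)
        ∂μ ∂l := by
  rw [lintegral_prod_symm' _ hf]
  have h0 : ∀ᵐ y ∂l, y ≠ 0 := by
    rw [ae_iff]
    simp
  refine lintegral_congr_ae ?_
  filter_upwards [h0] with y hy
  rw [lintegral_rightMul μ hy (f := fun x => f (x, y))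
    (hf.comp (measurable_id.prodMk measurable_const)), lintegral_const_mul]
  · exact hf.comp (((LinearMap.continuous_of_finiteDimensional (rightMul y)).measurable).prodMk
      measurable_const)

variable [StarRing F]

omit [FiniteDimensional ℝ F] [MeasurableSpace F] [BorelSpace F] in
theorem prodAct_rightMul (g : Matrix (Fin n ⊕ Unit) (Fin n ⊕ Unit) F)
    (x : EuclideanSpace F (Fin n)) (y : F) :
    prodAct g (rightMul y x, y) = (WithLp.toLp 2 fun i => sNum g (fun j => x j) i * y,
      sDen g (fun j => x j) * y) := by
  have h : Sum.elim (fun j => rightMul y x j) (fun _ : Unit => y) =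
      fun i => Sum.elim (fun j => x j) (fun _ : Unit => (1 : F)) i * y := by
    funext i; rcases i with i | i <;> simp
  have h2 : g *ᵥ Sum.elim (fun j => rightMul y x j) (fun _ : Unit => y) =
      fun i => (g *ᵥ Sum.elim (fun j => x j) (fun _ : Unit => (1 : F))) i * y := by
    rw [h]
    funext i
    simp only [mulVec, dotProduct, Finset.sum_mul, mul_assoc]
  rw [mulVec_elim] at h2
  show (_, _) = _
  simp only [h2]
  rfl

variable [NormSqStar F]

omit [FiniteDimensional ℝ F] [MeasurableSpace F] [BorelSpace F] in
theorem norm_sq_sNum_sub {g : Matrix (Fin n ⊕ Unit) (Fin n ⊕ Unit) F} (hg : Preserves g)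
    (x : EuclideanSpace F (Fin n)) :
    ‖WithLp.toLp 2 (sNum g fun j => x j)‖ ^ 2 - ‖sDen g fun j => x j‖ ^ 2 = ‖x‖ ^ 2 - 1 := by
  have h := norm_sq_prodAct hg (rightMul 1 x, 1)
  rw [prodAct_rightMul, norm_rightMul] at h
  simpa using h

omit [MeasurableSpace F] [BorelSpace F] [FiniteDimensional ℝ F] in
theorem sDen_ne_zero_of_norm_lt {g : Matrix (Fin n ⊕ Unit) (Fin n ⊕ Unit) F} (hg : Preserves g)
    {x : EuclideanSpace F (Fin n)} (hx : ‖x‖ < 1) : 0 < ‖sDen g fun j => x j‖ := by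
  have h := norm_sq_sNum_sub hg x
  by_contra h0
  have h1 : ‖sDen g fun j => x j‖ = 0 := le_antisymm (not_lt.mp h0) (norm_nonneg _)
  rw [h1] at h
  nlinarith [norm_nonneg x, sq_nonneg ‖WithLp.toLp 2 (sNum g fun j => x j)‖]

omit [MeasurableSpace F] [BorelSpace F] [FiniteDimensional ℝ F] in
theorem norm_sNum_lt_iff {g : Matrix (Fin n ⊕ Unit) (Fin n ⊕ Unit) F} (hg : Preserves g)
    (x : EuclideanSpace F (Fin n)) :
    ‖WithLp.toLp 2 (sNum g fun j => x j)‖ < ‖sDen g fun j => x j‖ ↔ ‖x‖ < 1 := by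
  have h := norm_sq_sNum_sub hg x
  rw [← sq_lt_sq₀ (norm_nonneg _) (norm_nonneg _), ← sq_lt_one_iff₀ (norm_nonneg x)]
  constructor <;> intro <;> linarith

omit [StarRing F] [NormSqStar F] in
theorem measurable_sDen (g : Matrix (Fin n ⊕ Unit) (Fin n ⊕ Unit) F) :
    Measurable fun x : EuclideanSpace F (Fin n) => sDen g fun j => x j := by
  refine Continuous.measurable ?_
  unfold sDen mulVec dotProduct
  fun_prop

omit [StarRing F] [NormSqStar F] in
theorem measurable_ballAct (g : Matrix (Fin n ⊕ Unit) (Fin n ⊕ Unit) F) :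
    Measurable (ballAct g) := by
  unfold ballAct
  refine (PiLp.continuous_toLp 2 _).measurable.comp (measurable_pi_lambda _ fun i => ?_)
  refine Measurable.mul (Continuous.measurable ?_) (measurable_sDen g).inv
  unfold sNum mulVec dotProduct
  fun_prop

/-- The function `(x, y) ↦ f (x y⁻¹)` on `|x| < |y| < 1`. -/
def coneFun (f : EuclideanSpace F (Fin n) → ℝ≥0∞) (p : EuclideanSpace F (Fin n) × F) : ℝ≥0∞ :=
  {p : EuclideanSpace F (Fin n) × F | ‖p.1‖ < ‖p.2‖}.indicator 1 p *
    (Metric.ball (0 : F) 1).indicator 1 p.2 * f (rightMul p.2⁻¹ p.1)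

omit [StarRing F] [NormSqStar F] in
theorem measurable_coneFun {f : EuclideanSpace F (Fin n) → ℝ≥0∞} (hf : Measurable f) :
    Measurable (coneFun f) := by
  unfold coneFun
  refine ((measurable_one.indicator
    (measurableSet_lt measurable_fst.norm measurable_snd.norm)).mul
    ((measurable_one.indicator Metric.isOpen_ball.measurableSet).comp measurable_snd)).mul
    (hf.comp ?_)
  refine (PiLp.continuous_toLp 2 _).measurable.comp (measurable_pi_lambda _ fun i => ?_)
  refine Measurable.mul (Continuous.measurable ?_) measurable_snd.inv
  fun_prop

-- In homogeneous coordinates the cone `‖p.1‖ < ‖p.2‖` is the ball `‖x‖ < 1`, which the action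
-- preserves. The remaining condition involves only the norm of `(cx + d) y`, so `cx + d` may be
-- replaced by the real scalar `‖cx + d‖`.
omit [FiniteDimensional ℝ F] [MeasurableSpace F] [BorelSpace F] in
theorem coneFun_prodAct {g : Matrix (Fin n ⊕ Unit) (Fin n ⊕ Unit) F} (hg : Preserves g)
    (f : EuclideanSpace F (Fin n) → ℝ≥0∞) (x : EuclideanSpace F (Fin n)) {y : F} (hy : y ≠ 0) :
    coneFun f (prodAct g (rightMul y x, y)) =
      (Metric.ball (0 : EuclideanSpace F (Fin n)) 1).indicator (fun x => f (ballAct g x)) x *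
        (Metric.ball (0 : F) 1).indicator 1 (‖sDen g fun j => x j‖ • y) := by
  have hy' : 0 < ‖y‖ := norm_pos_iff.mpr hy
  rw [prodAct_rightMul, coneFun]
  have h1 : ((WithLp.toLp 2 fun i => sNum g (fun j => x j) i * y : EuclideanSpace F (Fin n)),
      sDen g (fun j => x j) * y) ∈ {p : EuclideanSpace F (Fin n) × F | ‖p.1‖ < ‖p.2‖} ↔
      x ∈ Metric.ball (0 : EuclideanSpace F (Fin n)) 1 := by
    have h : (WithLp.toLp 2 fun i => sNum g (fun j => x j) i * y : EuclideanSpace F (Fin n)) =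
      rightMul y (WithLp.toLp 2 (sNum g fun j => x j)) := rfl
    rw [mem_ball_zero_iff, ← norm_sNum_lt_iff hg x, h]
    show ‖rightMul y _‖ < ‖_ * _‖ ↔ _
    rw [norm_rightMul, norm_mul]
    exact mul_lt_mul_iff_left₀ hy'
  by_cases hx : x ∈ Metric.ball (0 : EuclideanSpace F (Fin n)) 1
  · rw [Set.indicator_of_mem (h1.mpr hx), Set.indicator_of_mem hx, Pi.one_apply, one_mul, mul_comm]
    congr 1
    · congr 1
      ext i
      simp [ballAct, mul_assoc, hy]
    · have h2 : sDen g (fun j => x j) * y ∈ Metric.ball (0 : F) 1 ↔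
          ‖sDen g fun j => x j‖ • y ∈ Metric.ball (0 : F) 1 := by
        simp [norm_smul]
      by_cases h3 : sDen g (fun j => x j) * y ∈ Metric.ball (0 : F) 1
      · rw [Set.indicator_of_mem h3, Set.indicator_of_mem (h2.mp h3)]; rfl
      · rw [Set.indicator_of_notMem h3, Set.indicator_of_notMem fun h => h3 (h2.mpr h)]
  · rw [Set.indicator_of_notMem fun h => hx (h1.mp h), Set.indicator_of_notMem hx]
    simp

/-- For fixed `x` the integral over `y` is a scaled copy of `ballWeight`. The scaling by `‖cx + d‖`
yields the exponent `dim 𝔽ⁿ + dim 𝔽`, one summand from the coordinate change and one from `dy`. -/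
theorem lintegral_coneFun_prodAct {g : Matrix (Fin n ⊕ Unit) (Fin n ⊕ Unit) F} (hg : Preserves g)
    (μ : Measure (EuclideanSpace F (Fin n))) [μ.IsAddHaarMeasure]
    (l : Measure F) [l.IsAddHaarMeasure] {f : EuclideanSpace F (Fin n) → ℝ≥0∞}
    (hf : Measurable f) :
    ∫⁻ p, coneFun f (prodAct g p) ∂μ.prod l =
      (∫⁻ x in Metric.ball 0 1, f (ballAct g x) * ENNReal.ofReal ((‖sDen g fun j => x j‖⁻¹) ^
        (Module.finrank ℝ (EuclideanSpace F (Fin n)) + Module.finrank ℝ F)) ∂μ) *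
        ballWeight l (Module.finrank ℝ (EuclideanSpace F (Fin n))) := by
  set m := Module.finrank ℝ (EuclideanSpace F (Fin n))
  have hg' : Measurable (prodAct g) := (LinearMap.continuous_of_finiteDimensional _).measurable
  rw [lintegral_prod_rightMul μ l (f := fun p => coneFun f (prodAct g p))
    ((measurable_coneFun hf).comp hg')]
  have h0 : ∀ᵐ y ∂l, y ≠ 0 := by
    rw [ae_iff]
    simp
  set φ : EuclideanSpace F (Fin n) → ℝ≥0∞ :=
    (Metric.ball (0 : EuclideanSpace F (Fin n)) 1).indicator fun x => f (ballAct g x) with hφ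
  have hφm : Measurable φ := (hf.comp (measurable_ballAct g)).indicator
    Metric.isOpen_ball.measurableSet
  have hind : Measurable fun p : EuclideanSpace F (Fin n) × F =>
      ENNReal.ofReal (‖p.2‖ ^ m) *
        (φ p.1 * (Metric.ball (0 : F) 1).indicator 1 (‖sDen g fun j => p.1 j‖ • p.2)) := by
    refine Measurable.mul (by fun_prop) ((hφm.comp measurable_fst).mul ?_)
    refine (measurable_one.indicator Metric.isOpen_ball.measurableSet).comp ?_
    exact (((measurable_sDen g).comp measurable_fst).norm).smul measurable_snd
  have h1 : ∫⁻ y, ∫⁻ x, ENNReal.ofReal (‖y‖ ^ m) * coneFun f (prodAct g (rightMul y x, y)) ∂μ ∂l =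
      ∫⁻ y, ∫⁻ x, ENNReal.ofReal (‖y‖ ^ m) *
        (φ x * (Metric.ball (0 : F) 1).indicator 1 (‖sDen g fun j => x j‖ • y)) ∂μ ∂l := by
    refine lintegral_congr_ae ?_
    filter_upwards [h0] with y hy
    refine lintegral_congr fun x => ?_
    rw [coneFun_prodAct hg f x hy]
  refine h1.trans ?_
  rw [lintegral_lintegral_swap (f := fun y x => ENNReal.ofReal (‖y‖ ^ m) *
    (φ x * (Metric.ball (0 : F) 1).indicator 1 (‖sDen g fun j => x j‖ • y)))
    (hind.comp measurable_swap).aemeasurable, ← lintegral_mul_const,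
    ← lintegral_indicator Metric.isOpen_ball.measurableSet]
  · refine lintegral_congr fun x => ?_
    by_cases hx : x ∈ Metric.ball (0 : EuclideanSpace F (Fin n)) 1
    · have ht := sDen_ne_zero_of_norm_lt hg (mem_ball_zero_iff.mp hx)
      simp only [hφ, Set.indicator_of_mem hx]
      have h2 : ∀ y : F, ENNReal.ofReal (‖y‖ ^ m) * (f (ballAct g x) *
          (Metric.ball (0 : F) 1).indicator 1 (‖sDen g fun j => x j‖ • y)) =
          f (ballAct g x) * (ENNReal.ofReal (‖y‖ ^ m) *
          (Metric.ball (0 : F) 1).indicator 1 (‖sDen g fun j => x j‖ • y)) := fun y => by ring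
      simp only [h2]
      rw [lintegral_const_mul, lintegral_ballWeight l m ht, mul_assoc]
      refine Measurable.mul (by fun_prop) ?_
      exact (measurable_one.indicator Metric.isOpen_ball.measurableSet).comp
        (measurable_const_smul _)
    · simp [hφ, hx]
  · exact (hf.comp (measurable_ballAct g)).mul
      (((measurable_sDen g).norm.inv.pow_const _).ennreal_ofReal)

/-- Change of variables for the fractional linear action on the unit ball. -/
theorem lintegral_ballAct {g : Matrix (Fin n ⊕ Unit) (Fin n ⊕ Unit) F} (hg : Preserves g)
    (μ : Measure (EuclideanSpace F (Fin n))) [μ.IsAddHaarMeasure]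
    {f : EuclideanSpace F (Fin n) → ℝ≥0∞} (hf : Measurable f) :
    ∫⁻ x in Metric.ball 0 1, f (ballAct g x) * ENNReal.ofReal ((‖sDen g fun j => x j‖⁻¹) ^
      (Module.finrank ℝ (EuclideanSpace F (Fin n)) + Module.finrank ℝ F)) ∂μ =
    ∫⁻ x in Metric.ball 0 1, f x ∂μ := by
  let l : Measure F := Measure.addHaar
  have h1 : Preserves (1 : Matrix (Fin n ⊕ Unit) (Fin n ⊕ Unit) F) := by simp [Preserves]
  have hone : ∀ p : EuclideanSpace F (Fin n) × F, prodAct 1 p = p := by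
    intro p
    simp [prodAct]
  have hden : ∀ x : EuclideanSpace F (Fin n), sDen 1 (fun j => x j) = 1 := by
    intro x
    have := congrFun (mulVec_elim 1 fun j => x j) (Sum.inr ())
    simpa using this.symm
  have hnum : ∀ x : EuclideanSpace F (Fin n), ballAct 1 x = x := by
    intro x
    ext i
    have := congrFun (mulVec_elim 1 fun j => x j) (Sum.inl i)
    simp [ballAct, hden]
    simpa using this.symm
  -- The formula is compared for `g` and for the identity. Invariance of the measure equates the
  -- left-hand sides, and the finite nonzero `ballWeight` cancels.
  have h2 := lintegral_coneFun_prodAct h1 μ l hf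
  have h3 := lintegral_coneFun_prodAct hg μ l hf
  rw [(measurePreserving_prodAct hg μ l).lintegral_comp (measurable_coneFun hf)] at h3
  simp only [hone, hden, hnum, norm_one, inv_one, one_pow, ENNReal.ofReal_one, mul_one] at h2
  rw [h2] at h3
  exact ((ENNReal.mul_left_inj (ballWeight_ne_zero l _) (ballWeight_ne_top l _)).mp h3).symm

end BallAction

/-! ### Recovering the surface measure from measures on the ball. -/

section Concentration

variable {E : Type*} [NormedAddCommGroup E] [NormedSpace ℝ E] [MeasurableSpace E] [BorelSpace E]
  [FiniteDimensional ℝ E]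

/-- Integration over the unit ball in polar coordinates. -/
theorem lintegral_ball_polar [Nontrivial E] (μ : Measure E) [μ.IsAddHaarMeasure] {G : E → ℝ≥0∞}
    (hG : Measurable G) :
    ∫⁻ x in Metric.ball 0 1, G x ∂μ = ∫⁻ ω, (∫⁻ r in Set.Ioo (0 : ℝ) 1,
      ENNReal.ofReal (r ^ (Module.finrank ℝ E - 1)) * G (r • (ω : E))) ∂μ.toSphere := by
  set B : E → ℝ≥0∞ := (Metric.ball (0 : E) 1).indicator G with hB
  have hBm : Measurable B := hG.indicator Metric.isOpen_ball.measurableSet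
  have h1 : ∫⁻ x in Metric.ball 0 1, G x ∂μ = ∫⁻ x : ({(0 : E)}ᶜ : Set E), B x ∂(μ.comap (↑)) := by
    rw [← lintegral_indicator Metric.isOpen_ball.measurableSet,
      lintegral_subtype_comap (measurableSet_singleton _).compl B, restrict_compl_singleton]
  have h2 : ∫⁻ x : ({(0 : E)}ᶜ : Set E), B x ∂(μ.comap (↑)) =
      ∫⁻ p : Metric.sphere (0 : E) 1 × Set.Ioi (0 : ℝ), B (p.2.1 • p.1.1)
        ∂μ.toSphere.prod (Measure.volumeIoiPow (Module.finrank ℝ E - 1)) := by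
    rw [← μ.measurePreserving_homeomorphUnitSphereProd.lintegral_comp_emb
      (Homeomorph.measurableEmbedding _)]
    refine lintegral_congr fun x => ?_
    have hx : ‖(x : E)‖ ≠ 0 := norm_ne_zero_iff.mpr x.2
    simp [smul_smul, hx]
  rw [h1, h2, lintegral_prod _ (by
    refine (hBm.comp (Continuous.measurable ?_)).aemeasurable
    fun_prop)]
  refine lintegral_congr fun ω => ?_
  have hm : Measurable fun r : ℝ => B (r • (ω : E)) :=
    hBm.comp (Continuous.measurable (by fun_prop))
  rw [Measure.volumeIoiPow, lintegral_withDensity_eq_lintegral_mul (g := fun r : Set.Ioi (0 : ℝ) =>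
    B (r.1 • (ω : E))) _ ((measurable_subtype_coe.pow_const _).ennreal_ofReal) (hm.comp measurable_subtype_coe)]
  simp only [Pi.mul_apply]
  rw [lintegral_subtype_comap measurableSet_Ioi (fun r : ℝ =>
    ENNReal.ofReal (r ^ (Module.finrank ℝ E - 1)) * B (r • (ω : E))),
    ← lintegral_indicator measurableSet_Ioi, ← lintegral_indicator measurableSet_Ioo]
  refine lintegral_congr fun r => ?_
  by_cases hr : 0 < r
  · have hn : ‖r • (ω : E)‖ = r := by rw [norm_smul, norm_eq_of_mem_sphere, mul_one,
      Real.norm_of_nonneg hr.le]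
    by_cases hr1 : r < 1
    · simp [hr, hr1, hB, hn]
    · simp [hr, hr1, hB, hn]
  · simp [hr]

theorem lintegral_Ioo_one_sub {G : ℝ → ℝ≥0∞} {ε : ℝ} (hε : 0 < ε) :
    ∫⁻ r in Set.Ioo (0 : ℝ) 1, G r = ENNReal.ofReal ε *
      ∫⁻ s in Set.Ioo 0 ε⁻¹, G (1 - ε * s) := by
  rw [← lintegral_indicator measurableSet_Ioo, ← lintegral_indicator measurableSet_Ioo]
  set B := (Set.Ioo (0 : ℝ) 1).indicator G with hB
  have h1 : ∀ s, (Set.Ioo 0 ε⁻¹).indicator (fun s => G (1 - ε * s)) s = B (1 - ε * s) := by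
    intro s
    have : s ∈ Set.Ioo 0 ε⁻¹ ↔ 1 - ε * s ∈ Set.Ioo (0 : ℝ) 1 := by
      simp only [Set.mem_Ioo, sub_pos, sub_lt_self_iff, mul_pos_iff_of_pos_left hε]
      rw [mul_comm, ← lt_inv_mul_iff₀' hε]
      simp [and_comm]
    by_cases hs : s ∈ Set.Ioo 0 ε⁻¹
    · rw [Set.indicator_of_mem hs, hB, Set.indicator_of_mem (this.mp hs)]
    · rw [Set.indicator_of_notMem hs, hB, Set.indicator_of_notMem fun h => hs (this.mpr h)]
  simp only [h1]
  have h2 : ∫⁻ s, B (1 - ε * s) = ENNReal.ofReal |ε⁻¹| * ∫⁻ r, B (1 - r) := by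
    have := (Homeomorph.mulLeft₀ ε hε.ne').measurableEmbedding.lintegral_map (μ := volume)
      (fun r => B (1 - r))
    simp only [Homeomorph.coe_mulLeft₀] at this
    rw [← this, Real.map_volume_mul_left hε.ne', lintegral_smul_measure, smul_eq_mul]
  rw [h2, lintegral_sub_left_eq_self, ← mul_assoc, abs_of_pos (inv_pos.mpr hε),
    ← ENNReal.ofReal_mul hε.le, mul_inv_cancel₀ hε.ne', ENNReal.ofReal_one, one_mul]

theorem lintegral_exp_neg_mul {a : ℝ} (ha : 0 < a) :
    ∫⁻ s in Set.Ioi (0 : ℝ), ENNReal.ofReal (Real.exp (-(a * s))) = ENNReal.ofReal a⁻¹ := by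
  have h := integrableOn_exp_mul_Ioi (neg_lt_zero.mpr ha) 0
  have h2 := integral_exp_mul_Ioi (neg_lt_zero.mpr ha) 0
  simp only [neg_mul] at h h2
  rw [← ofReal_integral_eq_lintegral_ofReal h (ae_of_all _ fun _ => (Real.exp_pos _).le), h2]
  simp

/-- As `ε → 0`, the weight `ε⁻¹ exp(-(1 - |x|²) a(x) / ε)` on the ball concentrates on the sphere. -/
theorem tendsto_lintegral_ball_concentration [Nontrivial E] (μ : Measure E) [μ.IsAddHaarMeasure]
    {h a : E → ℝ} (hhm : Measurable h) (ham : Measurable a)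
    (hh : ContinuousOn h (Metric.closedBall 0 1)) (ha : ContinuousOn a (Metric.closedBall 0 1))
    (ha0 : ∀ x ∈ Metric.closedBall (0 : E) 1, 0 < a x)
    {ε : ℕ → ℝ} (hε : ∀ k, 0 < ε k) (hε0 : Tendsto ε atTop (𝓝 0)) :
    Tendsto (fun k => ∫⁻ x in Metric.ball 0 1,
      ENNReal.ofReal ((ε k)⁻¹ * h x * Real.exp (-((1 - ‖x‖ ^ 2) * a x / ε k))) ∂μ) atTop
      (𝓝 (∫⁻ ω, ENNReal.ofReal (h (ω : E) * (2 * a ω)⁻¹) ∂μ.toSphere)) := by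
  set m := Module.finrank ℝ E - 1
  have hcpt : IsCompact (Metric.closedBall (0 : E) 1) := isCompact_closedBall 0 1
  have hne : (Metric.closedBall (0 : E) 1).Nonempty := ⟨0, by simp⟩
  obtain ⟨C, hC⟩ := hcpt.exists_bound_of_continuousOn hh
  obtain ⟨x₀, hx₀, hmin⟩ := hcpt.exists_isMinOn hne ha
  have hC0 : 0 ≤ C := (norm_nonneg _).trans (hC _ hx₀)
  set a₀ := a x₀
  have ha₀ : 0 < a₀ := ha0 _ hx₀
  -- This is the integrand in polar coordinates with `r = 1 - ε s`. Then `1 - r² = ε s (2 - ε s)`,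
  -- the factor `ε⁻¹` cancels against `dr = ε ds`, and the limit `h exp(-2 a s)` integrates over `s
  -- > 0` to `h / (2 a)`.
  set K : ℕ → (Metric.sphere (0 : E) 1 × ℝ) → ℝ≥0∞ := fun k p =>
    (Set.Ioo 0 (ε k)⁻¹).indicator (fun s => ENNReal.ofReal ((1 - ε k * s) ^ m *
      h ((1 - ε k * s) • (p.1 : E)) *
        Real.exp (-(s * (2 - ε k * s) * a ((1 - ε k * s) • (p.1 : E)))))) p.2 with hK
  have hmeas1 : ∀ k, Measurable fun p : Metric.sphere (0 : E) 1 × ℝ =>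
      (1 - ε k * p.2) • (p.1 : E) := fun k => Continuous.measurable (by fun_prop)
  have hKm : ∀ k, Measurable (K k) := by
    intro k
    have h1 : K k = (Set.univ ×ˢ Set.Ioo 0 (ε k)⁻¹ : Set (Metric.sphere (0 : E) 1 × ℝ)).indicator
        fun p => ENNReal.ofReal ((1 - ε k * p.2) ^ m * h ((1 - ε k * p.2) • (p.1 : E)) *
        Real.exp (-(p.2 * (2 - ε k * p.2) * a ((1 - ε k * p.2) • (p.1 : E))))) := by
      funext p
      simp only [hK, Set.indicator, Set.mem_prod, Set.mem_univ, true_and]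
    rw [h1]
    refine Measurable.indicator ?_ (MeasurableSet.univ.prod measurableSet_Ioo)
    have := hhm.comp (hmeas1 k)
    have := ham.comp (hmeas1 k)
    fun_prop
  have hform : ∀ k, ∫⁻ x in Metric.ball 0 1,
      ENNReal.ofReal ((ε k)⁻¹ * h x * Real.exp (-((1 - ‖x‖ ^ 2) * a x / ε k))) ∂μ =
      ∫⁻ p, K k p ∂μ.toSphere.prod volume := by
    intro k
    rw [lintegral_ball_polar μ (by fun_prop), lintegral_prod _ (hKm k).aemeasurable]
    refine lintegral_congr fun ω => ?_
    rw [lintegral_Ioo_one_sub (hε k), ← lintegral_const_mul', ← lintegral_indicator measurableSet_Ioo]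
    · refine lintegral_congr fun s => ?_
      by_cases hs : s ∈ Set.Ioo 0 (ε k)⁻¹
      · simp only [hK, Set.indicator_of_mem hs]
        have h1 : 0 < 1 - ε k * s := by
          have := mul_lt_mul_of_pos_left hs.2 (hε k)
          rw [mul_inv_cancel₀ (hε k).ne'] at this
          linarith
        have h2 : ‖(1 - ε k * s) • (ω : E)‖ = 1 - ε k * s := by
          rw [norm_smul, norm_eq_of_mem_sphere, mul_one, Real.norm_of_nonneg h1.le]
        rw [← ENNReal.ofReal_mul (by positivity), ← ENNReal.ofReal_mul (hε k).le, h2]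
        congr 1
        have h3 : (1 - (1 - ε k * s) ^ 2) * a ((1 - ε k * s) • (ω : E)) / ε k =
            s * (2 - ε k * s) * a ((1 - ε k * s) • (ω : E)) := by
          field_simp [(hε k).ne']
          ring
        rw [h3]
        field_simp [(hε k).ne']
        exact mul_comm _ _
      · simp [hK, hs]
    · exact ENNReal.ofReal_ne_top
  simp only [hform]
  have hlim : ∫⁻ ω, ENNReal.ofReal (h (ω : E) * (2 * a ω)⁻¹) ∂μ.toSphere =
      ∫⁻ p : Metric.sphere (0 : E) 1 × ℝ, (Set.Ioi (0 : ℝ)).indicator (fun s =>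
        ENNReal.ofReal (h (p.1 : E) * Real.exp (-(2 * a p.1 * s)))) p.2
        ∂μ.toSphere.prod volume := by
    have hm : Measurable fun p : Metric.sphere (0 : E) 1 × ℝ =>
        (Set.Ioi (0 : ℝ)).indicator (fun s =>
          ENNReal.ofReal (h (p.1 : E) * Real.exp (-(2 * a p.1 * s)))) p.2 := by
      have h1 : (fun p : Metric.sphere (0 : E) 1 × ℝ => (Set.Ioi (0 : ℝ)).indicator (fun s =>
          ENNReal.ofReal (h (p.1 : E) * Real.exp (-(2 * a p.1 * s)))) p.2) =
          (Set.univ ×ˢ Set.Ioi 0 : Set (Metric.sphere (0 : E) 1 × ℝ)).indicator fun p =>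
          ENNReal.ofReal (h (p.1 : E) * Real.exp (-(2 * a p.1 * p.2))) := by
        funext p
        by_cases hp : 0 < p.2 <;> simp [Set.indicator, hp]
      rw [h1]
      refine Measurable.indicator ?_ (MeasurableSet.univ.prod measurableSet_Ioi)
      have := hhm.comp (measurable_subtype_coe.comp
        (measurable_fst : Measurable (Prod.fst : Metric.sphere (0 : E) 1 × ℝ → _)))
      have := ham.comp (measurable_subtype_coe.comp
        (measurable_fst : Measurable (Prod.fst : Metric.sphere (0 : E) 1 × ℝ → _)))
      fun_prop
    rw [lintegral_prod _ hm.aemeasurable]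
    refine lintegral_congr fun ω => ?_
    have haω : 0 < a ω := ha0 _ (by simp)
    simp only
    rw [lintegral_indicator measurableSet_Ioi]
    rw [ENNReal.ofReal_mul' (by positivity), ← lintegral_exp_neg_mul (by positivity),
      ← lintegral_const_mul' _ _ ENNReal.ofReal_ne_top]
    refine lintegral_congr fun s => ?_
    rw [ENNReal.ofReal_mul' (Real.exp_pos _).le]
  rw [hlim]
  -- On the support `2 - ε s ≥ 1`, so the exponential is at most `exp(-a₀ s)`, where `a₀` is the
  -- minimum of `a` on the closed ball and `C` bounds `h`.
  refine tendsto_lintegral_of_dominated_convergence (fun p : Metric.sphere (0 : E) 1 × ℝ =>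
    (Set.Ioi (0 : ℝ)).indicator (fun s => ENNReal.ofReal C *
      ENNReal.ofReal (Real.exp (-(a₀ * s)))) p.2) hKm ?_ ?_ ?_
  · intro k
    refine ae_of_all _ fun p => ?_
    by_cases hs : p.2 ∈ Set.Ioo 0 (ε k)⁻¹
    · have h0 : 0 < ε k * p.2 := mul_pos (hε k) hs.1
      have h1 : 0 < 1 - ε k * p.2 := by
        have := mul_lt_mul_of_pos_left hs.2 (hε k)
        rw [mul_inv_cancel₀ (hε k).ne'] at this
        linarith
      have h2 : ‖(1 - ε k * p.2) • (p.1 : E)‖ = 1 - ε k * p.2 := by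
        rw [norm_smul, norm_eq_of_mem_sphere, mul_one, Real.norm_of_nonneg h1.le]
      have h3 : (1 - ε k * p.2) • (p.1 : E) ∈ Metric.closedBall (0 : E) 1 := by
        rw [mem_closedBall_zero_iff, h2]; linarith
      simp only [hK]
      rw [Set.indicator_of_mem hs, Set.indicator_of_mem (Set.mem_Ioi.mpr hs.1),
        ← ENNReal.ofReal_mul hC0]
      refine ENNReal.ofReal_le_ofReal (mul_le_mul ?_ ?_ (Real.exp_pos _).le hC0)
      · calc (1 - ε k * p.2) ^ m * h ((1 - ε k * p.2) • (p.1 : E))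
            ≤ (1 - ε k * p.2) ^ m * ‖h ((1 - ε k * p.2) • (p.1 : E))‖ := by
              gcongr; exact Real.le_norm_self _
          _ ≤ 1 * C := by
              gcongr
              · exact pow_le_one₀ h1.le (by linarith)
              · exact hC _ h3
          _ = C := one_mul C
      · rw [Real.exp_le_exp, neg_le_neg_iff]
        have h4 : a₀ ≤ a ((1 - ε k * p.2) • (p.1 : E)) := hmin h3
        calc a₀ * p.2 = p.2 * 1 * a₀ := by ring
          _ ≤ _ := by
            have := hs.1
            have h5 : 0 ≤ p.2 * (2 - ε k * p.2) := mul_nonneg this.le (by linarith)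
            gcongr
            linarith
    · simp [hK, hs]
  · have h1 : ∫⁻ p : Metric.sphere (0 : E) 1 × ℝ, (Set.Ioi (0 : ℝ)).indicator (fun s =>
        ENNReal.ofReal C * ENNReal.ofReal (Real.exp (-(a₀ * s)))) p.2 ∂μ.toSphere.prod volume =
        ENNReal.ofReal C * ENNReal.ofReal a₀⁻¹ * μ.toSphere Set.univ := by
      rw [lintegral_prod]
      · simp only
        rw [lintegral_const, lintegral_indicator measurableSet_Ioi, lintegral_const_mul' _ _ ENNReal.ofReal_ne_top, lintegral_exp_neg_mul ha₀]
      · refine Measurable.aemeasurable (Measurable.comp (g := (Set.Ioi (0 : ℝ)).indicator fun s =>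
          ENNReal.ofReal C * ENNReal.ofReal (Real.exp (-(a₀ * s)))) ?_ measurable_snd)
        exact Measurable.indicator (by fun_prop) measurableSet_Ioi
    rw [h1]
    exact ENNReal.mul_ne_top (ENNReal.mul_ne_top ENNReal.ofReal_ne_top ENNReal.ofReal_ne_top)
      (measure_ne_top _ _)
  · refine ae_of_all _ fun p => ?_
    by_cases hs : 0 < p.2
    · rw [Set.indicator_of_mem (Set.mem_Ioi.mpr hs)]
      have hev : ∀ᶠ k in atTop, ε k * p.2 < 1 := by
        have : Tendsto (fun k => ε k * p.2) atTop (𝓝 0) := by simpa using hε0.mul_const p.2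
        exact this.eventually (gt_mem_nhds one_pos)
      have ht : Tendsto (fun k => 1 - ε k * p.2) atTop (𝓝 1) := by
        simpa using (hε0.mul_const p.2).const_sub 1
      have ht2 : Tendsto (fun k => 2 - ε k * p.2) atTop (𝓝 2) := by
        simpa using (hε0.mul_const p.2).const_sub 2
      have hx : Tendsto (fun k => (1 - ε k * p.2) • (p.1 : E)) atTop
          (𝓝[Metric.closedBall 0 1] (p.1 : E)) := by
        refine tendsto_nhdsWithin_iff.mpr ⟨by simpa using ht.smul_const (p.1 : E), ?_⟩
        filter_upwards [hev] with k hk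
        have := mul_pos (hε k) hs
        rw [mem_closedBall_zero_iff, norm_smul, norm_eq_of_mem_sphere, mul_one,
          Real.norm_of_nonneg (by linarith)]
        linarith
      have hp1 : (p.1 : E) ∈ Metric.closedBall (0 : E) 1 := by simp
      have hh' := (hh _ hp1).tendsto.comp hx
      have ha' := (ha _ hp1).tendsto.comp hx
      have hmain : Tendsto (fun k => ENNReal.ofReal ((1 - ε k * p.2) ^ m *
          h ((1 - ε k * p.2) • (p.1 : E)) *
          Real.exp (-(p.2 * (2 - ε k * p.2) * a ((1 - ε k * p.2) • (p.1 : E)))))) atTop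
          (𝓝 (ENNReal.ofReal (h (p.1 : E) * Real.exp (-(2 * a p.1 * p.2))))) := by
        refine ENNReal.tendsto_ofReal ?_
        have := ((ht.pow m).mul hh').mul (Real.continuous_exp.tendsto _ |>.comp
          (((ht2.const_mul p.2).mul ha').neg))
        rw [one_pow, one_mul] at this
        rw [show 2 * a p.1 * p.2 = p.2 * 2 * a p.1 by ring]
        exact this
      refine hmain.congr' ?_
      filter_upwards [hev] with k hk
      simp only [hK]
      rw [Set.indicator_of_mem]
      refine ⟨hs, ?_⟩
      rw [← one_div, lt_div_iff₀ (hε k), mul_comm]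
      exact hk
    · rw [Set.indicator_of_notMem (by simpa using hs)]
      refine tendsto_const_nhds.congr fun k => ?_
      simp [hK, hs]

end Concentration

/-! ### The Jacobian of the action on the sphere. -/

section SphereJacobian

variable {F : Type} [NormedDivisionRing F] [NormedAlgebra ℝ F] [StarRing F] [NormSqStar F] {n : ℕ}

theorem sDen_pos_of_norm_le {g : (Matrix (Fin n ⊕ Unit) (Fin n ⊕ Unit) F)ˣ}
    (hg : Preserves (g : Matrix (Fin n ⊕ Unit) (Fin n ⊕ Unit) F))
    {x : EuclideanSpace F (Fin n)} (hx : ‖x‖ ≤ 1) : 0 < ‖sDen g.1 fun j => x j‖ := by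
  rcases hx.lt_or_eq with h | h
  · exact sDen_ne_zero_of_norm_lt hg h
  · exact norm_pos_iff.mpr (sDen_ne_zero g hg _ (sphere_sum ⟨x, by simpa using h⟩))

/-- Invariance of the form gives `‖cx + d‖² - ‖ax + b‖² = 1 - ‖x‖²`; divide by `‖cx + d‖²`. This is
how the concentrating weight transforms under `g`. -/
theorem one_sub_norm_ballAct {g : (Matrix (Fin n ⊕ Unit) (Fin n ⊕ Unit) F)ˣ}
    (hg : Preserves (g : Matrix (Fin n ⊕ Unit) (Fin n ⊕ Unit) F))
    {x : EuclideanSpace F (Fin n)} (hx : ‖x‖ ≤ 1) :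
    1 - ‖ballAct g.1 x‖ ^ 2 = (1 - ‖x‖ ^ 2) * (‖sDen g.1 fun j => x j‖⁻¹) ^ 2 := by
  have h0 := sDen_pos_of_norm_le hg hx
  have h1 : ballAct g.1 x = rightMul (sDen g.1 fun j => x j)⁻¹
    (WithLp.toLp 2 (sNum g.1 fun j => x j)) := rfl
  have h2 := norm_sq_sNum_sub hg x
  rw [h1, norm_rightMul, norm_inv, mul_pow]
  field_simp
  linarith

variable [FiniteDimensional ℝ F] [MeasurableSpace F] [BorelSpace F]

omit [FiniteDimensional ℝ F] [MeasurableSpace F] [BorelSpace F] in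
theorem continuousOn_ballAct {g : (Matrix (Fin n ⊕ Unit) (Fin n ⊕ Unit) F)ˣ}
    (hg : Preserves (g : Matrix (Fin n ⊕ Unit) (Fin n ⊕ Unit) F)) :
    ContinuousOn (ballAct g.1) (Metric.closedBall 0 1) := by
  refine (PiLp.continuous_toLp 2 _).comp_continuousOn (continuousOn_pi.mpr fun i => ?_)
  refine ContinuousOn.mul (Continuous.continuousOn ?_) (ContinuousOn.inv₀
    (Continuous.continuousOn ?_) fun x hx =>
      norm_pos_iff.mp (sDen_pos_of_norm_le hg (mem_closedBall_zero_iff.mp hx)))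
  · unfold sNum mulVec dotProduct
    fun_prop
  · unfold sDen mulVec dotProduct
    fun_prop

omit [NormedAlgebra ℝ F] [StarRing F] [NormSqStar F] [FiniteDimensional ℝ F] [MeasurableSpace F]
  [BorelSpace F] in
theorem continuous_norm_sDen (g : Matrix (Fin n ⊕ Unit) (Fin n ⊕ Unit) F) :
    Continuous fun x : EuclideanSpace F (Fin n) => ‖sDen g fun j => x j‖ := by
  unfold sDen mulVec dotProduct
  fun_prop

/-- The Jacobian of the fractional linear action on the sphere, for nonnegative functions. -/
theorem lintegral_sphereAct (hn : 0 < n) {g : (Matrix (Fin n ⊕ Unit) (Fin n ⊕ Unit) F)ˣ}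
    (hg : Preserves (g : Matrix (Fin n ⊕ Unit) (Fin n ⊕ Unit) F))
    (μ : Measure (EuclideanSpace F (Fin n))) [μ.IsAddHaarMeasure] (f : C(USphere F n, ℝ)) :
    ∫⁻ u, ENNReal.ofReal (f (sphereAct g hg u) * (sphereFactor g u)⁻¹ ^
      (Module.finrank ℝ (EuclideanSpace F (Fin n)) + Module.finrank ℝ F - 2)) ∂μ.toSphere =
    ∫⁻ u, ENNReal.ofReal (f u) ∂μ.toSphere := by
  have hnt : Nontrivial (EuclideanSpace F (Fin n)) :=
    Module.finrank_pos_iff.mp (finrank_pos_of_pos (F := F) hn)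
  set N := Module.finrank ℝ (EuclideanSpace F (Fin n)) + Module.finrank ℝ F with hN
  have hN2 : 2 ≤ N := by
    have h1 := finrank_pos_of_pos (F := F) hn
    have h2 : 0 < Module.finrank ℝ F := Module.finrank_pos
    omega
  -- The function is extended from the sphere to the whole space so that the formula on the ball can
  -- be applied to it.
  obtain ⟨f', hf'⟩ := f.exists_extension (Topology.IsClosedEmbedding.subtypeVal
    (Metric.isClosed_sphere (x := (0 : EuclideanSpace F (Fin n))) (ε := 1)))
  have hf'' : ∀ u : USphere F n, f' u = f u := fun u => by rw [← hf']; rfl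
  set D : EuclideanSpace F (Fin n) → ℝ := fun x => ‖sDen g.1 fun j => x j‖ with hD
  have hDc : Continuous D := continuous_norm_sDen g.1
  have hDpos : ∀ x ∈ Metric.closedBall (0 : EuclideanSpace F (Fin n)) 1, 0 < D x := fun x hx =>
    sDen_pos_of_norm_le hg (mem_closedBall_zero_iff.mp hx)
  set ε : ℕ → ℝ := fun k => 1 / ((k : ℝ) + 1) with hε
  have hεpos : ∀ k, 0 < ε k := fun k => by positivity
  have hε0 : Tendsto ε atTop (𝓝 0) := tendsto_one_div_add_atTop_nhds_zero_nat
  have l1 := tendsto_lintegral_ball_concentration μ (h := f') (a := fun _ => 1)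
    f'.continuous.measurable measurable_const f'.continuous.continuousOn continuousOn_const
    (fun _ _ => one_pos) hεpos hε0
  -- The transformed weight has `a = D⁻²`. The limit factor `(2 a)⁻¹ = D² / 2` lowers the exponent
  -- on the ball from `N` to `N - 2` on the sphere.
  have l2 := tendsto_lintegral_ball_concentration μ (h := fun x => f' (ballAct g.1 x) * (D x)⁻¹ ^ N)
    (a := fun x => (D x)⁻¹ ^ 2)
    ((f'.continuous.measurable.comp (measurable_ballAct g.1)).mul
      (hDc.measurable.inv.pow_const _)) (hDc.measurable.inv.pow_const _)
    ((f'.continuous.comp_continuousOn (continuousOn_ballAct hg)).mul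
      ((hDc.continuousOn.inv₀ fun x hx => (hDpos x hx).ne').pow _))
    ((hDc.continuousOn.inv₀ fun x hx => (hDpos x hx).ne').pow _)
    (fun x hx => pow_pos (inv_pos.mpr (hDpos x hx)) 2) hεpos hε0
  have heq : ∀ k, ∫⁻ x in Metric.ball 0 1, ENNReal.ofReal ((ε k)⁻¹ *
      (f' (ballAct g.1 x) * (D x)⁻¹ ^ N) *
        Real.exp (-((1 - ‖x‖ ^ 2) * (D x)⁻¹ ^ 2 / ε k))) ∂μ =
      ∫⁻ x in Metric.ball 0 1, ENNReal.ofReal ((ε k)⁻¹ * f' x *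
        Real.exp (-((1 - ‖x‖ ^ 2) * 1 / ε k))) ∂μ := by
    intro k
    have hm : Measurable fun x => ENNReal.ofReal ((ε k)⁻¹ * f' x *
        Real.exp (-((1 - ‖x‖ ^ 2) * 1 / ε k))) := by
      have := f'.continuous.measurable
      fun_prop
    rw [← lintegral_ballAct hg μ hm]
    refine setLIntegral_congr_fun Metric.isOpen_ball.measurableSet fun x hx => ?_
    have hx1 : ‖x‖ ≤ 1 := (mem_ball_zero_iff.mp hx).le
    have hp := hDpos x (mem_closedBall_zero_iff.mpr hx1)
    simp only
    rw [one_sub_norm_ballAct hg hx1, ← ENNReal.ofReal_mul' (pow_nonneg (inv_nonneg.mpr hp.le) _),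
      mul_one]
    congr 1
    ring
  simp only [heq] at l2
  have key := tendsto_nhds_unique l1 l2
  simp only [mul_one] at key
  have h2 : ENNReal.ofReal 2⁻¹ ≠ 0 := by simp
  have e1 : ∫⁻ u : USphere F n, ENNReal.ofReal (f' (u : EuclideanSpace F (Fin n)) * 2⁻¹)
      ∂μ.toSphere = (∫⁻ u, ENNReal.ofReal (f u) ∂μ.toSphere) * ENNReal.ofReal 2⁻¹ := by
    rw [← lintegral_mul_const' _ _ ENNReal.ofReal_ne_top]
    refine lintegral_congr fun u => ?_
    rw [hf'', ENNReal.ofReal_mul' (by positivity)]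
  have e2 : ∫⁻ u : USphere F n, ENNReal.ofReal (f' (ballAct g.1 u) * (D u)⁻¹ ^ N *
      (2 * (D u)⁻¹ ^ 2)⁻¹) ∂μ.toSphere =
      (∫⁻ u, ENNReal.ofReal (f (sphereAct g hg u) * (sphereFactor g u)⁻¹ ^ (N - 2)) ∂μ.toSphere) *
        ENNReal.ofReal 2⁻¹ := by
    rw [← lintegral_mul_const' _ _ ENNReal.ofReal_ne_top]
    refine lintegral_congr fun u => ?_
    rw [← ENNReal.ofReal_mul' (by positivity)]
    have h3 : f' (ballAct g.1 u) = f (sphereAct g hg u) := hf'' (sphereAct g hg u)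
    have hp : 0 < D u := hDpos u (by simp)
    have h4 : sphereFactor g u = D u := rfl
    rw [h3, h4]
    congr 1
    obtain ⟨k, hk⟩ := Nat.exists_eq_add_of_le hN2
    rw [hk, Nat.add_sub_cancel_left]
    rw [pow_add]
    field_simp
  rw [e1, e2] at key
  exact ((ENNReal.mul_left_inj h2 ENNReal.ofReal_ne_top).mp key).symm

/-- The Jacobian of the fractional linear action on the sphere. -/
theorem integral_sphereAct (hn : 0 < n) {g : (Matrix (Fin n ⊕ Unit) (Fin n ⊕ Unit) F)ˣ}
    (hg : Preserves (g : Matrix (Fin n ⊕ Unit) (Fin n ⊕ Unit) F))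
    (μ : Measure (EuclideanSpace F (Fin n))) [μ.IsAddHaarMeasure] {ρ : ℝ}
    (hρ : 2 * ρ + 2 = Module.finrank ℝ (EuclideanSpace F (Fin n)) + Module.finrank ℝ F)
    (f : C(USphere F n, ℂ)) :
    ∫ u, ((sphereFactor g u ^ (-(2 * ρ)) : ℝ) : ℂ) * f (sphereAct g hg u) ∂μ.toSphere =
      ∫ u, f u ∂μ.toSphere := by
  set N := Module.finrank ℝ (EuclideanSpace F (Fin n)) + Module.finrank ℝ F - 2 with hN
  have hN2 : ((N : ℕ) : ℝ) = 2 * ρ := by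
    have h1 := finrank_pos_of_pos (F := F) hn
    have h2 : 0 < Module.finrank ℝ F := Module.finrank_pos
    rw [hN, Nat.cast_sub (by omega)]
    push_cast
    linarith
  have hpos : ∀ u, 0 < sphereFactor g u := fun u =>
    norm_pos_iff.mpr (sDen_ne_zero g hg _ (sphere_sum u))
  set w : USphere F n → NNReal := fun u => Real.toNNReal ((sphereFactor g u)⁻¹ ^ N) with hw
  have hwc : Continuous w := continuous_real_toNNReal.comp
    (((sphereFactor g).continuous.inv₀ fun u => (hpos u).ne').pow N)
  have hact : Measurable (sphereAct g hg) := (sphereAct g hg).continuous.measurable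
  -- Agreement on nonnegative continuous functions determines a finite measure, so the weighted
  -- pushforward is the surface measure, and complex integrals follow.
  set m : Measure (USphere F n) := (μ.toSphere.withDensity fun u => (w u : ℝ≥0∞)).map
    (sphereAct g hg) with hm
  have hfin : IsFiniteMeasure (μ.toSphere.withDensity fun u => (w u : ℝ≥0∞)) := by
    refine isFiniteMeasure_withDensity ?_
    have h1 := lintegral_sphereAct hn hg μ 1
    simp only [ContinuousMap.one_apply, one_mul] at h1
    refine ne_of_eq_of_ne h1 ?_
    rw [ENNReal.ofReal_one, lintegral_one]
    exact measure_ne_top _ _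
  have hmm : m = μ.toSphere := by
    refine ext_of_forall_lintegral_eq_of_IsFiniteMeasure fun φ => ?_
    have h1 := lintegral_sphereAct hn hg μ
      ⟨fun u => (φ u : ℝ), NNReal.continuous_coe.comp φ.continuous⟩
    simp only [ContinuousMap.coe_mk, ENNReal.ofReal_coe_nnreal] at h1
    rw [← h1, hm, lintegral_map (by fun_prop) hact, lintegral_withDensity_eq_lintegral_mul _
      (hwc.measurable.coe_nnreal_ennreal) (by fun_prop)]
    refine lintegral_congr fun u => ?_
    simp only [Pi.mul_apply, hw]
    rw [ENNReal.ofReal_mul (by positivity), ENNReal.ofReal_coe_nnreal, mul_comm]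
    rfl
  conv_rhs => rw [← hmm, hm]
  rw [integral_map hact.aemeasurable f.continuous.aestronglyMeasurable,
    integral_withDensity_eq_integral_smul hwc.measurable]
  refine integral_congr_ae (ae_of_all _ fun u => ?_)
  simp only [hw, NNReal.smul_def, Complex.real_smul]
  rw [Real.coe_toNNReal _ (pow_nonneg (inv_nonneg.mpr (hpos u).le) _), ← hN2,
    Real.rpow_neg (hpos u).le, Real.rpow_natCast, inv_pow]

end SphereJacobian

/-! ### Conjugation and the inner product over `ℝ`, `ℂ`, `ℍ`. -/

section StarAlgebra

variable {F : Type} [NormedDivisionRing F] [NormedAlgebra ℝ F] [StarRing F] [NormSqStar F]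

theorem norm_star_eq (x : F) : ‖star x‖ = ‖x‖ := by
  by_cases hx : x = 0
  · simp [hx]
  have h := congrArg norm (NormSqStar.star_mul_self x)
  rw [norm_mul, norm_algebraMap', Real.norm_of_nonneg (by positivity), sq] at h
  exact mul_right_cancel₀ (norm_ne_zero_iff.mpr hx) h

theorem star_algebraMap_eq (r : ℝ) : star (algebraMap ℝ F r) = algebraMap ℝ F r := by
  by_cases hr : r = 0
  · simp [hr]
  have h := NormSqStar.star_mul_self (algebraMap ℝ F r)
  rw [norm_algebraMap', Real.norm_eq_abs, sq_abs, sq, map_mul] at h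
  exact mul_right_cancel₀ ((map_ne_zero _).mpr hr) h

theorem star_real_smul (r : ℝ) (x : F) : star (r • x) = r • star x := by
  rw [Algebra.smul_def, star_mul, star_algebraMap_eq, Algebra.smul_def, Algebra.commutes]

theorem conjTranspose_real_smul {p q : Type} (r : ℝ) (A : Matrix p q F) :
    (r • A)ᴴ = r • Aᴴ := by
  ext i j
  simp [conjTranspose_apply, star_real_smul]

variable {n : ℕ}

/-- The `𝔽`-valued inner product `∑ ūᵢ xᵢ`. -/
def sip (x u : EuclideanSpace F (Fin n)) : F := ∑ i, star (u i) * x i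

theorem norm_sip_le (x u : EuclideanSpace F (Fin n)) : ‖sip x u‖ ≤ ‖u‖ * ‖x‖ := by
  calc ‖sip x u‖ ≤ ∑ i, ‖u i‖ * ‖x i‖ :=
        (norm_sum_le _ _).trans_eq (by simp [norm_star_eq])
    _ ≤ √(∑ i, ‖u i‖ ^ 2) * √(∑ i, ‖x i‖ ^ 2) := Real.sum_mul_le_sqrt_mul_sqrt _ _ _
    _ = ‖u‖ * ‖x‖ := by rw [PiLp.norm_eq_of_L2, PiLp.norm_eq_of_L2]

theorem norm_sip_sphere_le (x u : USphere F n) : ‖sip x.1 u.1‖ ≤ 1 := by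
  simpa using norm_sip_le x.1 u.1

theorem sip_self (x : USphere F n) : sip x.1 x.1 = 1 := by
  simp only [sip, NormSqStar.star_mul_self]
  rw [← map_sum, sphere_sum, map_one]

omit [NormedAlgebra ℝ F] [NormSqStar F] in
theorem continuous_sip [ContinuousStar F] :
    Continuous fun p : EuclideanSpace F (Fin n) × EuclideanSpace F (Fin n) => sip p.1 p.2 := by
  unfold sip
  fun_prop

/-! ### The interior kernels `|1 - r⟨x, u⟩|` -/

/-- The kernel `|1 - r⟨x, u⟩|`. -/
def radialKernel (r : ℝ) (x u : USphere F n) : ℝ := ‖1 - r • sip x.1 u.1‖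

omit [NormSqStar F] in
theorem radialKernel_nonneg (r : ℝ) (x u : USphere F n) : 0 ≤ radialKernel r x u :=
  norm_nonneg _

omit [NormSqStar F] in
theorem radialKernel_zero (x u : USphere F n) : radialKernel 0 x u = 1 := by
  simp [radialKernel]

omit [NormSqStar F] in
theorem radialKernel_one (x u : USphere F n) : radialKernel 1 x u = sphereKernel x u := by
  simp [radialKernel, sphereKernel, sip]

omit [NormSqStar F] in
theorem continuous_radialKernel [ContinuousStar F] :
    Continuous fun p : ℝ × USphere F n × USphere F n => radialKernel p.1 p.2.1 p.2.2 := by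
  have h : Continuous fun p : ℝ × USphere F n × USphere F n => sip p.2.1.1 p.2.2.1 :=
    continuous_sip.comp (f := fun p : ℝ × USphere F n × USphere F n => (p.2.1.1, p.2.2.1))
      (by fun_prop)
  unfold radialKernel
  fun_prop

theorem one_sub_le_radialKernel {r : ℝ} (hr : 0 ≤ r) (x u : USphere F n) :
    1 - r ≤ radialKernel r x u := by
  have h1 := norm_sub_norm_le (1 : F) (r • sip x.1 u.1)
  rw [norm_one, norm_smul, Real.norm_of_nonneg hr] at h1
  have h2 := mul_le_mul_of_nonneg_left (norm_sip_sphere_le x u) hr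
  rw [radialKernel]
  linarith

theorem norm_sub_le_one_sub {r : ℝ} (hr : r ≤ 1) (x u : USphere F n) :
    ‖(1 - r) • sip x.1 u.1‖ ≤ 1 - r := by
  rw [norm_smul, Real.norm_of_nonneg (by linarith)]
  exact mul_le_of_le_one_right (by linarith) (norm_sip_sphere_le x u)

/-- Write `1 - ⟨x, u⟩` as `(1 - r⟨x, u⟩) - (1 - r)⟨x, u⟩`. The second term has norm at most `1 - r`,
which is itself at most `|1 - r⟨x, u⟩|`. -/
theorem sphereKernel_le {r : ℝ} (hr : 0 ≤ r) (hr1 : r ≤ 1) (x u : USphere F n) :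
    sphereKernel x u ≤ 2 * radialKernel r x u := by
  have h1 := one_sub_le_radialKernel hr x u
  have h2 := norm_sub_le_one_sub hr1 x u
  have h3 : (1 : F) - sip x.1 u.1 = (1 - r • sip x.1 u.1) - (1 - r) • sip x.1 u.1 := by
    rw [sub_smul, one_smul]; abel
  have h4 := norm_sub_le (1 - r • sip x.1 u.1) ((1 - r) • sip x.1 u.1)
  rw [← h3] at h4
  have h5 : sphereKernel x u = ‖1 - sip x.1 u.1‖ := rfl
  rw [h5]
  rw [radialKernel] at *
  linarith

theorem radialKernel_le {r : ℝ} (hr1 : r ≤ 1) (x u : USphere F n) :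
    radialKernel r x u ≤ sphereKernel x u + (1 - r) := by
  have h2 := norm_sub_le_one_sub hr1 x u
  have h3 : (1 : F) - r • sip x.1 u.1 = (1 - sip x.1 u.1) + (1 - r) • sip x.1 u.1 := by
    rw [sub_smul, one_smul]; abel
  rw [radialKernel, h3]
  exact (norm_add_le _ _).trans (add_le_add le_rfl h2)

/-! ### Boosts -/

/-- The matrix of the boost with `cosh = c`, `sinh = s` in the direction `e`. -/
def boostMatrix (e : USphere F n) (c s : ℝ) : Matrix (Fin n ⊕ Unit) (Fin n ⊕ Unit) F :=
  let v : Matrix (Fin n) Unit F := Matrix.of fun i _ => e.1 i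
  fromBlocks (1 + (c - 1) • (v * vᴴ)) (s • v) (s • vᴴ) (c • (1 : Matrix Unit Unit F))

theorem boostMatrix_conjTranspose (e : USphere F n) (c s : ℝ) :
    (boostMatrix e c s)ᴴ = boostMatrix e c s := by
  unfold boostMatrix
  simp only [fromBlocks_conjTranspose, conjTranspose_add, conjTranspose_one,
    conjTranspose_real_smul, conjTranspose_mul, conjTranspose_conjTranspose]

theorem boostMatrix_preserves (e : USphere F n) {c s : ℝ} (h : c ^ 2 - s ^ 2 = 1) :
    Preserves (boostMatrix e c s) := by
  have hv : (Matrix.of fun i _ => e.1 i : Matrix (Fin n) Unit F)ᴴ *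
      (Matrix.of fun i _ => e.1 i : Matrix (Fin n) Unit F) = 1 := by
    ext i j
    have := sip_self e
    simpa [Matrix.mul_apply, sip] using this
  rw [Preserves, boostMatrix_conjTranspose, boostMatrix, sig]
  generalize (Matrix.of fun i _ => e.1 i : Matrix (Fin n) Unit F) = v at hv
  have h1 : v * vᴴ * (v * vᴴ) = v * vᴴ := by
    rw [Matrix.mul_assoc, ← Matrix.mul_assoc vᴴ, hv, Matrix.one_mul]
  have h2 : v * vᴴ * v = v := by rw [Matrix.mul_assoc, hv, Matrix.mul_one]
  have h3 : vᴴ * (v * vᴴ) = vᴴ := by rw [← Matrix.mul_assoc, hv, Matrix.one_mul]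
  simp only [fromBlocks_multiply, Matrix.mul_one, Matrix.mul_zero, add_zero, zero_add,
    Matrix.mul_neg, Matrix.neg_mul, Matrix.add_mul, Matrix.mul_add, Matrix.one_mul,
    Matrix.smul_mul, Matrix.mul_smul, h1, h2, h3, hv, smul_add]
  rw [fromBlocks_inj]
  refine ⟨?_, ?_, ?_, ?_⟩
  · match_scalars
    · ring
    · linear_combination h
  · match_scalars; ring
  · match_scalars; ring
  · match_scalars
    linear_combination -h

/-- The boost with `cosh = c`, `sinh = s` in the direction `e`. -/
def boost (e : USphere F n) {c s : ℝ} (h : c ^ 2 - s ^ 2 = 1) :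
    (Matrix (Fin n ⊕ Unit) (Fin n ⊕ Unit) F)ˣ where
  val := boostMatrix e c s
  inv := sig (Fin n) Unit F * boostMatrix e c s * sig (Fin n) Unit F
  val_inv := by
    have h1 := boostMatrix_preserves e h
    rw [Preserves, boostMatrix_conjTranspose] at h1
    rw [← Matrix.mul_assoc, ← Matrix.mul_assoc, h1, sig, fromBlocks_multiply]
    simp
  inv_val := by
    have h1 := boostMatrix_preserves e h
    rw [Preserves, boostMatrix_conjTranspose] at h1
    rw [Matrix.mul_assoc, Matrix.mul_assoc, ← Matrix.mul_assoc (boostMatrix e c s), h1, sig,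
      fromBlocks_multiply]
    simp

theorem boost_preserves (e : USphere F n) {c s : ℝ} (h : c ^ 2 - s ^ 2 = 1) :
    Preserves (boost e h : Matrix (Fin n ⊕ Unit) (Fin n ⊕ Unit) F) :=
  boostMatrix_preserves e h

theorem sphereFactor_boost (e : USphere F n) {c s : ℝ} (h : c ^ 2 - s ^ 2 = 1) (u : USphere F n) :
    sphereFactor (boost e h) u = ‖c • (1 : F) + s • sip u.1 e.1‖ := by
  show ‖sDen (boostMatrix e c s) _‖ = _
  congr 1
  simp [sDen, boostMatrix, mulVec, dotProduct, sip, Finset.smul_sum, add_comm]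

variable [FiniteDimensional ℝ F] [MeasurableSpace F] [BorelSpace F]
  (μ : Measure (EuclideanSpace F (Fin n))) [μ.IsAddHaarMeasure]

/-- Apply the change of variables to the constant `1` and to the boost with `cosh = (1 - r²)^{-1/2}`
and `sinh = -r cosh`, whose factor at `u` is `cosh · |1 - r⟨u, e⟩|`. At the exponent `2ρ` the
integral is therefore explicit. -/
theorem integral_radialKernel (hn : 0 < n) {ρ : ℝ}
    (hρ : 2 * ρ + 2 = Module.finrank ℝ (EuclideanSpace F (Fin n)) + Module.finrank ℝ F)
    {r : ℝ} (hr : 0 ≤ r) (hr1 : r < 1) (e : USphere F n) :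
    ∫ u, radialKernel r u e ^ (-(2 * ρ)) ∂μ.toSphere =
      μ.toSphere.real Set.univ * (1 - r ^ 2) ^ (-ρ) := by
  have hpos : 0 < 1 - r ^ 2 := by nlinarith
  set c : ℝ := (√(1 - r ^ 2))⁻¹ with hc
  have hcpos : 0 < c := inv_pos.mpr (Real.sqrt_pos.mpr hpos)
  have hc2 : c ^ 2 = (1 - r ^ 2)⁻¹ := by rw [hc, inv_pow, Real.sq_sqrt hpos.le]
  have h : c ^ 2 - (-(r * c)) ^ 2 = 1 := by
    rw [neg_sq, mul_pow, hc2]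
    field_simp
  have h1 := integral_sphereAct hn (boost_preserves e h) μ hρ 1
  have h2 : ∀ u, sphereFactor (boost e h) u = c * radialKernel r u e := by
    intro u
    rw [sphereFactor_boost, radialKernel, ← Real.norm_of_nonneg hcpos.le, ← norm_smul, smul_sub,
      Real.norm_of_nonneg hcpos.le, smul_smul, neg_smul, mul_comm r c, sub_eq_add_neg]
  simp only [ContinuousMap.one_apply, mul_one, h2] at h1
  rw [integral_complex_ofReal] at h1
  have h3 : ∀ u, (c * radialKernel r u e) ^ (-(2 * ρ)) =
      (1 - r ^ 2) ^ ρ * radialKernel r u e ^ (-(2 * ρ)) := by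
    intro u
    rw [Real.mul_rpow hcpos.le (radialKernel_nonneg r u e)]
    congr 1
    rw [show -(2 * ρ) = ((2 : ℕ) : ℝ) * (-ρ) by push_cast; ring, Real.rpow_natCast_mul hcpos.le,
      hc2, Real.inv_rpow hpos.le, Real.rpow_neg hpos.le, inv_inv]
  simp only [h3] at h1
  rw [integral_const_mul, integral_const] at h1
  have h4 : (1 - r ^ 2) ^ ρ * ∫ u, radialKernel r u e ^ (-(2 * ρ)) ∂μ.toSphere =
      μ.toSphere.real Set.univ := by
    refine Complex.ofReal_injective ?_
    rw [h1, Complex.real_smul, mul_one]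
  rw [Real.rpow_neg hpos.le, ← h4]
  have : 0 < (1 - r ^ 2) ^ ρ := Real.rpow_pos_of_pos hpos _
  field_simp

end StarAlgebra

/-! ### The critical exponent of the boundary kernel. -/

section KernelEstimates

variable {F : Type} [NormedDivisionRing F] [NormedAlgebra ℝ F] [StarRing F] [NormSqStar F]
  [ContinuousStar F] {n : ℕ} [FiniteDimensional ℝ F] [MeasurableSpace F] [BorelSpace F]
  (μ : Measure (EuclideanSpace F (Fin n))) [μ.IsAddHaarMeasure]

omit [NormSqStar F] [ContinuousStar F] [FiniteDimensional ℝ F] [MeasurableSpace F] [BorelSpace F]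
  [NormedAlgebra ℝ F] in
theorem sphereKernel_nonneg (x u : USphere F n) : 0 ≤ sphereKernel x u := norm_nonneg _

omit [ContinuousStar F] [FiniteDimensional ℝ F] [MeasurableSpace F] [BorelSpace F] in
theorem sphereKernel_le_two (x u : USphere F n) : sphereKernel x u ≤ 2 := by
  have := sphereKernel_le le_rfl zero_le_one x u
  rwa [radialKernel_zero, mul_one] at this

omit [NormSqStar F] [FiniteDimensional ℝ F] [MeasurableSpace F] [BorelSpace F] in
theorem continuous_sphereKernel :
    Continuous fun p : USphere F n × USphere F n => sphereKernel p.1 p.2 := by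
  simp only [← radialKernel_one]
  exact continuous_radialKernel.comp (f := fun p : USphere F n × USphere F n => ((1 : ℝ), p))
    (by fun_prop)

omit [NormSqStar F] [FiniteDimensional ℝ F] [MeasurableSpace F] [BorelSpace F] in
theorem continuous_radialKernel_right (r : ℝ) (e : USphere F n) :
    Continuous fun u : USphere F n => radialKernel r u e :=
  continuous_radialKernel.comp (f := fun u : USphere F n => (r, u, e)) (by fun_prop)

omit [NormSqStar F] [FiniteDimensional ℝ F] [MeasurableSpace F] [BorelSpace F] in
theorem continuous_radialKernel_prod (r : ℝ) :
    Continuous fun p : USphere F n × USphere F n => radialKernel r p.1 p.2 :=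
  continuous_radialKernel.comp (f := fun p : USphere F n × USphere F n => (r, p)) (by fun_prop)

/-- Non-isotropic balls of radius `ε` have measure `O(ε^ρ)`. -/
theorem measure_sphereKernel_lt_le (hn : 0 < n) {ρ : ℝ} (hρ0 : 0 ≤ ρ)
    (hρ : 2 * ρ + 2 = Module.finrank ℝ (EuclideanSpace F (Fin n)) + Module.finrank ℝ F)
    {ε : ℝ} (hε : 0 < ε) (hε1 : ε ≤ 1) (e : USphere F n) :
    μ.toSphere {u | sphereKernel u e < ε} ≤
      ENNReal.ofReal (4 ^ ρ * μ.toSphere.real Set.univ * ε ^ ρ) := by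
  set A : Set (USphere F n) := {u | sphereKernel u e < ε} with hA
  have hAm : MeasurableSet A := by
    have h1 : Continuous fun u : USphere F n => sphereKernel u e := by
      simpa only [radialKernel_one] using continuous_radialKernel_right 1 e
    exact (isOpen_lt h1 continuous_const).measurableSet
  have hr : 0 ≤ 1 - ε := by linarith
  have h1 := integral_radialKernel μ hn hρ hr (by linarith) e
  have hpos : ∀ u, 0 < radialKernel (1 - ε) u e := fun u =>
    lt_of_lt_of_le (by linarith) (one_sub_le_radialKernel hr u e)
  have hint : Integrable (fun u => radialKernel (1 - ε) u e ^ (-(2 * ρ))) μ.toSphere :=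
    ((continuous_radialKernel_right (1 - ε) e).rpow_const fun u =>
      Or.inl (hpos u).ne').integrable_of_hasCompactSupport (HasCompactSupport.of_compactSpace _)
  -- Chebyshev's inequality for the explicit integral at `r = 1 - ε`: on `A` the interior kernel is
  -- less than `2 ε`.
  have h2 : (2 * ε) ^ (-(2 * ρ)) * μ.toSphere.real A ≤
      μ.toSphere.real Set.univ * (1 - (1 - ε) ^ 2) ^ (-ρ) := by
    rw [← h1]
    calc (2 * ε) ^ (-(2 * ρ)) * μ.toSphere.real A = ∫ u in A, (2 * ε) ^ (-(2 * ρ)) ∂μ.toSphere := by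
          rw [setIntegral_const, smul_eq_mul, mul_comm]
      _ ≤ ∫ u in A, radialKernel (1 - ε) u e ^ (-(2 * ρ)) ∂μ.toSphere := by
          refine setIntegral_mono_on (integrable_const _).integrableOn hint.integrableOn hAm
            fun u hu => ?_
          refine Real.rpow_le_rpow_of_nonpos (hpos u) ?_ (by linarith)
          have h3 := radialKernel_le (by linarith : 1 - ε ≤ 1) u e
          have h4 : sphereKernel u e < ε := hu
          linarith
      _ ≤ _ := setIntegral_le_integral hint
          (ae_of_all _ fun u => Real.rpow_nonneg (radialKernel_nonneg _ _ _) _)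
  have h3 : (1 - (1 - ε) ^ 2) ^ (-ρ) ≤ ε ^ (-ρ) :=
    Real.rpow_le_rpow_of_nonpos hε (by nlinarith) (by linarith)
  have h4 : (2 * ε) ^ (-(2 * ρ)) = (4 ^ ρ * ε ^ ρ * ε ^ ρ)⁻¹ := by
    rw [Real.rpow_neg (by positivity), two_mul ρ, Real.rpow_add (by positivity),
      Real.mul_rpow (by norm_num) hε.le, show (4 : ℝ) = 2 * 2 by norm_num,
      Real.mul_rpow (by norm_num) (by norm_num)]
    ring_nf
  have hερ : 0 < ε ^ ρ := Real.rpow_pos_of_pos hε _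
  have h4ρ : (0 : ℝ) < 4 ^ ρ := Real.rpow_pos_of_pos (by norm_num) _
  rw [← ofReal_measureReal]
  refine ENNReal.ofReal_le_ofReal ?_
  rw [h4, inv_mul_le_iff₀ (by positivity)] at h2
  calc μ.toSphere.real A ≤ _ := h2
    _ ≤ 4 ^ ρ * ε ^ ρ * ε ^ ρ * (μ.toSphere.real Set.univ * ε ^ (-ρ)) := by gcongr
    _ = _ := by
      rw [Real.rpow_neg hε.le]
      field_simp

theorem measure_prod_sphereKernel_lt_le (hn : 0 < n) {ρ : ℝ} (hρ0 : 0 ≤ ρ)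
    (hρ : 2 * ρ + 2 = Module.finrank ℝ (EuclideanSpace F (Fin n)) + Module.finrank ℝ F)
    {ε : ℝ} (hε : 0 < ε) (hε1 : ε ≤ 1) :
    (μ.toSphere.prod μ.toSphere) {p | sphereKernel p.1 p.2 < ε} ≤
      ENNReal.ofReal (4 ^ ρ * μ.toSphere.real Set.univ ^ 2 * ε ^ ρ) := by
  rw [Measure.prod_apply_symm (isOpen_lt continuous_sphereKernel continuous_const).measurableSet]
  calc _ ≤ ∫⁻ _ : USphere F n, ENNReal.ofReal (4 ^ ρ * μ.toSphere.real Set.univ * ε ^ ρ)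
        ∂μ.toSphere := lintegral_mono fun e => measure_sphereKernel_lt_le μ hn hρ0 hρ hε hε1 e
    _ = _ := by
      rw [lintegral_const, ← ofReal_measureReal, ← ENNReal.ofReal_mul (by positivity)]
      congr 1
      ring

theorem ae_sphereKernel_pos (hn : 0 < n) {ρ : ℝ} (hρ0 : 0 < ρ)
    (hρ : 2 * ρ + 2 = Module.finrank ℝ (EuclideanSpace F (Fin n)) + Module.finrank ℝ F) :
    ∀ᵐ p ∂μ.toSphere.prod μ.toSphere, 0 < sphereKernel p.1 p.2 := by
  rw [ae_iff]
  set C := 4 ^ ρ * μ.toSphere.real Set.univ ^ 2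
  have h1 : ∀ k : ℕ, (μ.toSphere.prod μ.toSphere) {p | ¬ 0 < sphereKernel p.1 p.2} ≤
      ENNReal.ofReal (C * (1 / ((k : ℝ) + 1)) ^ ρ) := by
    intro k
    have h2 : (0 : ℝ) < 1 / ((k : ℝ) + 1) := by positivity
    refine (measure_mono fun p hp => ?_).trans
      (measure_prod_sphereKernel_lt_le μ hn hρ0.le hρ h2 ?_)
    · exact lt_of_le_of_lt (not_lt.mp hp) h2
    · rw [div_le_one (by positivity)]
      linarith [(Nat.cast_nonneg k : (0 : ℝ) ≤ k)]
  have h2 : Tendsto (fun k : ℕ => ENNReal.ofReal (C * (1 / ((k : ℝ) + 1)) ^ ρ)) atTop (𝓝 0) := by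
    rw [← ENNReal.ofReal_zero]
    refine ENNReal.tendsto_ofReal ?_
    have h3 := (tendsto_one_div_add_atTop_nhds_zero_nat (𝕜 := ℝ)).rpow_const
      (p := ρ) (Or.inr hρ0.le)
    rw [Real.zero_rpow hρ0.ne'] at h3
    simpa using h3.const_mul C
  exact le_antisymm (ge_of_tendsto' h2 h1) bot_le

/-- In the layer-cake formula the set where `kn⁻¹ > t` has measure `O(t^{-ρ})`. Against `t^{m-1}`
this converges at infinity because `m < ρ`, and at zero because `m > 0`. -/
theorem integrable_sphereKernel (hn : 0 < n) {ρ : ℝ}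
    (hρ : 2 * ρ + 2 = Module.finrank ℝ (EuclideanSpace F (Fin n)) + Module.finrank ℝ F)
    {m : ℝ} (hm : 0 < m) (hmρ : m < ρ) :
    Integrable (fun p : USphere F n × USphere F n => sphereKernel p.1 p.2 ^ (-m))
      (μ.toSphere.prod μ.toSphere) := by
  set P := μ.toSphere.prod μ.toSphere
  have hmeas : Measurable fun p : USphere F n × USphere F n => (sphereKernel p.1 p.2)⁻¹ :=
    continuous_sphereKernel.measurable.inv
  have hnn : ∀ p : USphere F n × USphere F n, 0 ≤ sphereKernel p.1 p.2 := fun p => norm_nonneg _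
  have heq : ∀ p : USphere F n × USphere F n,
      sphereKernel p.1 p.2 ^ (-m) = (sphereKernel p.1 p.2)⁻¹ ^ m := fun p => by
    rw [Real.inv_rpow (hnn p), Real.rpow_neg (hnn p)]
  simp only [heq]
  refine ⟨(hmeas.pow_const m).aestronglyMeasurable, ?_⟩
  rw [hasFiniteIntegral_iff_ofReal
    (ae_of_all _ fun p => Real.rpow_nonneg (inv_nonneg.mpr (hnn p)) _),
    lintegral_rpow_eq_lintegral_meas_lt_mul P (ae_of_all _ fun p => inv_nonneg.mpr (hnn p))
      hmeas.aemeasurable hm]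
  refine ENNReal.mul_lt_top ENNReal.ofReal_lt_top ?_
  set C := 4 ^ ρ * μ.toSphere.real Set.univ ^ 2 with hC
  have hsplit : Set.Ioi (0 : ℝ) = Set.Ioc 0 1 ∪ Set.Ioi 1 := by
    rw [Set.Ioc_union_Ioi_eq_Ioi zero_le_one]
  rw [hsplit]
  refine (lintegral_union_le _ _ _).trans_lt (ENNReal.add_lt_top.mpr ⟨?_, ?_⟩)
  · calc _ ≤ ∫⁻ t in Set.Ioc (0 : ℝ) 1, P Set.univ * ENNReal.ofReal (t ^ (m - 1)) := by
          refine lintegral_mono fun t => ?_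
          gcongr
          exact Set.subset_univ _
      _ = P Set.univ * ∫⁻ t in Set.Ioc (0 : ℝ) 1, ENNReal.ofReal (t ^ (m - 1)) :=
          lintegral_const_mul' _ _ (measure_ne_top _ _)
      _ < ∞ := by
          refine ENNReal.mul_lt_top (measure_lt_top _ _) ?_
          have h := (intervalIntegral.intervalIntegrable_rpow' (a := 0) (b := 1)
            (by linarith : -1 < m - 1)).1
          refine ((hasFiniteIntegral_iff_ofReal ?_).mp h.2)
          filter_upwards [ae_restrict_mem measurableSet_Ioc] with t ht
          exact Real.rpow_nonneg ht.1.le _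
  · calc _ ≤ ∫⁻ t in Set.Ioi (1 : ℝ), ENNReal.ofReal C * ENNReal.ofReal (t ^ (m - ρ - 1)) := by
          refine setLIntegral_mono' measurableSet_Ioi fun t ht => ?_
          have ht1 : (1 : ℝ) < t := ht
          have ht0 : 0 < t := by linarith
          have h1 : P {p | t < (sphereKernel p.1 p.2)⁻¹} ≤ ENNReal.ofReal (C * t⁻¹ ^ ρ) := by
            refine (measure_mono fun p hp => ?_).trans (measure_prod_sphereKernel_lt_le μ hn
              (hm.trans hmρ).le hρ (inv_pos.mpr ht0) (inv_le_one_of_one_le₀ ht1.le))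
            have h2 : t < (sphereKernel p.1 p.2)⁻¹ := hp
            exact (lt_inv_comm₀ ht0 (inv_pos.mp (ht0.trans h2))).mp h2
          calc _ ≤ ENNReal.ofReal (C * t⁻¹ ^ ρ) * ENNReal.ofReal (t ^ (m - 1)) := by gcongr
            _ = _ := by
              rw [← ENNReal.ofReal_mul (by positivity), ← ENNReal.ofReal_mul (by positivity),
                Real.inv_rpow ht0.le, ← Real.rpow_neg ht0.le, mul_assoc, ← Real.rpow_add ht0]
              congr 3
              ring
      _ = ENNReal.ofReal C * ∫⁻ t in Set.Ioi (1 : ℝ), ENNReal.ofReal (t ^ (m - ρ - 1)) :=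
          lintegral_const_mul' _ _ ENNReal.ofReal_ne_top
      _ < ∞ := by
          refine ENNReal.mul_lt_top ENNReal.ofReal_lt_top ?_
          have h := integrableOn_Ioi_rpow_of_lt (by linarith : m - ρ - 1 < -1) one_pos
          refine ((hasFiniteIntegral_iff_ofReal ?_).mp h.2)
          filter_upwards [ae_restrict_mem measurableSet_Ioi] with t ht
          exact Real.rpow_nonneg (one_pos.le.trans (le_of_lt ht)) _

theorem integrable_radialKernel {r : ℝ} (hr : 0 ≤ r) (hr1 : r < 1) (m : ℝ) :
    Integrable (fun p : USphere F n × USphere F n => radialKernel r p.1 p.2 ^ m)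
      (μ.toSphere.prod μ.toSphere) :=
  ((continuous_radialKernel_prod r).rpow_const fun p => Or.inl (lt_of_lt_of_le (by linarith)
    (one_sub_le_radialKernel hr p.1 p.2)).ne').integrable_of_hasCompactSupport
      (HasCompactSupport.of_compactSpace _)

-- In real dimension one the sphere is a pair `±x` of points at distance two, so singletons are
-- open.
omit [StarRing F] [NormSqStar F] [ContinuousStar F] in
theorem exists_singleton_measure_pos (hF : Module.finrank ℝ (EuclideanSpace F (Fin n)) = 1) :
    ∃ x : USphere F n, 0 < μ.toSphere {x} := by
  have hnt : Nontrivial (EuclideanSpace F (Fin n)) := by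
    refine Module.finrank_pos_iff (R := ℝ).mp (by omega)
  obtain ⟨x⟩ : Nonempty (USphere F n) := NormedSpace.sphere_nonempty.mpr zero_le_one |>.to_subtype
  refine ⟨x, ?_⟩
  have hx : ‖x.1‖ = 1 := by simp
  have hx0 : x.1 ≠ 0 := by intro h; rw [h] at hx; simp at hx
  have h1 : ({x} : Set (USphere F n)) = Metric.ball x 1 := by
    ext u
    rw [Set.mem_singleton_iff, Metric.mem_ball]
    constructor
    · rintro rfl; simp
    · intro hu
      obtain ⟨c, hc⟩ := (finrank_eq_one_iff_of_nonzero' x.1 hx0).mp hF u.1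
      have hu1 : ‖u.1‖ = 1 := by simp
      rw [← hc, norm_smul, hx, mul_one, Real.norm_eq_abs] at hu1
      rw [Subtype.dist_eq, dist_eq_norm, ← hc, show c • x.1 - x.1 = (c - 1) • x.1 by rw [sub_smul, one_smul], norm_smul, hx, mul_one,
        Real.norm_eq_abs] at hu
      rcases (abs_eq zero_le_one).mp hu1 with h | h
      · rw [h, one_smul] at hc
        exact Subtype.ext hc.symm
      · rw [h] at hu
        norm_num at hu
  rw [h1]
  exact Metric.isOpen_ball.measure_pos _ ⟨x, by simp⟩

/-- In dimension one the kernel means blow up because points have positive measure. -/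
theorem not_bounded_of_finrank_eq_one (hF : Module.finrank ℝ (EuclideanSpace F (Fin n)) = 1)
    {m : ℝ} (hm : 0 < m) (C : ℝ) : ∃ r : ℝ, 0 ≤ r ∧ r < 1 ∧
      C < ∫ p, radialKernel r p.1 p.2 ^ (-m) ∂μ.toSphere.prod μ.toSphere := by
  obtain ⟨x, hx⟩ := exists_singleton_measure_pos μ hF
  set s := μ.toSphere.real {x} with hs
  have hspos : 0 < s := ENNReal.toReal_pos hx.ne' (measure_ne_top _ _)
  have hlow : ∀ r : ℝ, 0 ≤ r → r < 1 → (1 - r) ^ (-m) * s ^ 2 ≤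
      ∫ p, radialKernel r p.1 p.2 ^ (-m) ∂μ.toSphere.prod μ.toSphere := by
    intro r hr hr1
    have hk : radialKernel r x x = 1 - r := by
      rw [radialKernel, sip_self, show (1 : F) - r • 1 = (1 - r) • (1 : F) by
        rw [sub_smul, one_smul], norm_smul, norm_one, mul_one, Real.norm_of_nonneg (by linarith)]
    have hnn : ∀ p : USphere F n × USphere F n, 0 ≤ radialKernel r p.1 p.2 ^ (-m) := fun p =>
      Real.rpow_nonneg (radialKernel_nonneg _ _ _) _
    calc (1 - r) ^ (-m) * s ^ 2
        = ∫ p in {(x, x)}, radialKernel r p.1 p.2 ^ (-m) ∂μ.toSphere.prod μ.toSphere := by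
          rw [integral_singleton, hk, smul_eq_mul, mul_comm, ← Set.singleton_prod_singleton,
            measureReal_prod_prod, sq]
      _ ≤ _ := setIntegral_le_integral (integrable_radialKernel μ hr hr1 _) (ae_of_all _ hnn)
  have hlim : Tendsto (fun k : ℕ => ((k : ℝ) + 1) ^ m * s ^ 2) atTop atTop :=
    ((tendsto_rpow_atTop hm).comp (tendsto_atTop_add_const_right _ _
      tendsto_natCast_atTop_atTop)).atTop_mul_const (by positivity)
  obtain ⟨k, hk⟩ := (hlim.eventually_gt_atTop C).exists
  have hk0 : (0 : ℝ) < (k : ℝ) + 1 := by positivity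
  have hk1 : 1 / ((k : ℝ) + 1) ≤ 1 := by
    rw [div_le_one hk0]
    linarith [(Nat.cast_nonneg k : (0 : ℝ) ≤ k)]
  have hk2 : 0 < 1 / ((k : ℝ) + 1) := by positivity
  refine ⟨1 - 1 / ((k : ℝ) + 1), by linarith, by linarith, hk.trans_le ?_⟩
  refine le_trans (le_of_eq ?_) (hlow _ (by linarith) (by linarith))
  rw [sub_sub_cancel, one_div, Real.inv_rpow hk0.le, Real.rpow_neg hk0.le, inv_inv]

/-- The kernel means of exponent `m` stay bounded only below the critical exponent. -/
theorem lt_of_bounded_radialKernel (hn : 0 < n) {ρ : ℝ} (hρ0 : 0 ≤ ρ)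
    (hρ : 2 * ρ + 2 = Module.finrank ℝ (EuclideanSpace F (Fin n)) + Module.finrank ℝ F)
    {m : ℝ} (hm : 0 < m) {C : ℝ} (hC : ∀ r : ℝ, 0 ≤ r → r < 1 →
      ∫ x, ∫ u, radialKernel r x u ^ (-m) ∂μ.toSphere ∂μ.toSphere ≤ C) : m < ρ := by
  have hnt : Nontrivial (EuclideanSpace F (Fin n)) :=
    Module.finrank_pos_iff.mp (finrank_pos_of_pos (F := F) hn)
  have hC' : ∀ r : ℝ, 0 ≤ r → r < 1 →
      ∫ p, radialKernel r p.1 p.2 ^ (-m) ∂μ.toSphere.prod μ.toSphere ≤ C := fun r hr hr1 => by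
    rw [integral_prod _ (integrable_radialKernel μ hr hr1 _)]
    exact hC r hr hr1
  -- The value `ρ = 0` forces both real dimensions to be one. The sphere is then two points and the
  -- kernel is not almost everywhere positive, so this case is separate.
  rcases hρ0.eq_or_lt with rfl | hρpos
  · exfalso
    have h1 := finrank_pos_of_pos (F := F) hn
    have h2 : 0 < Module.finrank ℝ F := Module.finrank_pos
    have h3 : 2 = Module.finrank ℝ (EuclideanSpace F (Fin n)) + Module.finrank ℝ F := by
      have : (2 : ℝ) = Module.finrank ℝ (EuclideanSpace F (Fin n)) + Module.finrank ℝ F := by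
        linarith
      exact_mod_cast this
    obtain ⟨r, hr, hr1, h⟩ := not_bounded_of_finrank_eq_one (F := F) (n := n) μ (by omega) hm C
    exact absurd (hC' r hr hr1) (not_le.mpr h)
  by_contra hmρ
  rw [not_lt] at hmρ
  set P := μ.toSphere.prod μ.toSphere with hP
  set r : ℕ → ℝ := fun k => 1 - 1 / ((k : ℝ) + 1) with hr
  have hk2 : ∀ k : ℕ, 0 < 1 / ((k : ℝ) + 1) := fun k => by positivity
  have hk1 : ∀ k : ℕ, 1 / ((k : ℝ) + 1) ≤ 1 := fun k => by
    rw [div_le_one (by positivity)]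
    linarith [(Nat.cast_nonneg k : (0 : ℝ) ≤ k)]
  have hr0 : ∀ k, 0 ≤ r k := fun k => by linarith [hk1 k]
  have hr1 : ∀ k, r k < 1 := fun k => by linarith [hk2 k]
  have hrlim : Tendsto r atTop (𝓝 1) := by
    simpa [hr] using (tendsto_one_div_add_atTop_nhds_zero_nat (𝕜 := ℝ)).const_sub 1
  have hpos := ae_sphereKernel_pos μ hn hρpos hρ
  have hklim : ∀ p : USphere F n × USphere F n,
      Tendsto (fun k => radialKernel (r k) p.1 p.2) atTop (𝓝 (sphereKernel p.1 p.2)) := by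
    intro p
    have h1 : Continuous fun t : ℝ => radialKernel t p.1 p.2 :=
      continuous_radialKernel.comp (f := fun t : ℝ => (t, p)) (by fun_prop)
    rw [← radialKernel_one]
    exact (h1.tendsto 1).comp hrlim
  -- Fatou's lemma passes the uniform bound for `r < 1` to the boundary kernel.
  have hint : Integrable (fun p : USphere F n × USphere F n => sphereKernel p.1 p.2 ^ (-m)) P := by
    refine ⟨(continuous_sphereKernel.measurable.pow_const _).aestronglyMeasurable, ?_⟩
    rw [hasFiniteIntegral_iff_ofReal
      (ae_of_all _ fun p => Real.rpow_nonneg (sphereKernel_nonneg _ _) _)]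
    have h1 : ∀ᵐ p ∂P, ENNReal.ofReal (sphereKernel p.1 p.2 ^ (-m)) =
        liminf (fun k => ENNReal.ofReal (radialKernel (r k) p.1 p.2 ^ (-m))) atTop := by
      filter_upwards [hpos] with p hp
      exact (ENNReal.tendsto_ofReal ((hklim p).rpow_const (Or.inl hp.ne'))).liminf_eq.symm
    rw [lintegral_congr_ae h1]
    refine (lintegral_liminf_le fun k =>
      ((continuous_radialKernel_prod (r k)).measurable.pow_const _).ennreal_ofReal).trans_lt ?_
    refine lt_of_le_of_lt ?_ (ENNReal.ofReal_lt_top (r := C))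
    refine liminf_le_of_frequently_le' (Frequently.of_forall fun k => ?_)
    rw [← ofReal_integral_eq_lintegral_ofReal (integrable_radialKernel μ (hr0 k) (hr1 k) _)
      (ae_of_all _ fun p => Real.rpow_nonneg (radialKernel_nonneg _ _ _) _)]
    exact ENNReal.ofReal_le_ofReal (hC' _ (hr0 k) (hr1 k))
  -- The contradiction comes from this Poisson-type kernel. If `m ≥ ρ`, the integrable function `2 ^
  -- m * kn ^ (-m)` dominates it, and it tends to zero almost everywhere; yet its integral is known
  -- exactly and stays above `s ^ 2 * 2 ^ (-ρ)`.
  set G : ℕ → USphere F n × USphere F n → ℝ := fun k p =>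
    (1 - r k) ^ ρ * radialKernel (r k) p.1 p.2 ^ (-(2 * ρ)) with hG
  have hGlim : Tendsto (fun k => ∫ p, G k p ∂P) atTop (𝓝 (∫ _, (0 : ℝ) ∂P)) := by
    refine tendsto_integral_of_dominated_convergence
      (fun p => 2 ^ m * sphereKernel p.1 p.2 ^ (-m)) (fun k => ?_) (hint.const_mul _) (fun k => ?_) ?_
    · exact (((continuous_radialKernel_prod (r k)).measurable.pow_const _).const_mul
        _).aestronglyMeasurable
    · filter_upwards [hpos] with p hp
      have a1 : 0 < 1 - r k := by linarith [hr1 k]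
      have a2 := one_sub_le_radialKernel (hr0 k) p.1 p.2
      have a3 : 0 < radialKernel (r k) p.1 p.2 := a1.trans_le a2
      have a4 := sphereKernel_le (hr0 k) (hr1 k).le p.1 p.2
      have a5 := sphereKernel_le_two p.1 p.2
      rw [Real.norm_of_nonneg (mul_nonneg (Real.rpow_nonneg a1.le _) (Real.rpow_nonneg a3.le _))]
      calc (1 - r k) ^ ρ * radialKernel (r k) p.1 p.2 ^ (-(2 * ρ))
          ≤ radialKernel (r k) p.1 p.2 ^ ρ * radialKernel (r k) p.1 p.2 ^ (-(2 * ρ)) := by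
            gcongr
        _ = radialKernel (r k) p.1 p.2 ^ (-ρ) := by
            rw [← Real.rpow_add a3]; congr 1; ring
        _ ≤ (sphereKernel p.1 p.2 / 2) ^ (-ρ) :=
            Real.rpow_le_rpow_of_nonpos (by positivity) (by linarith) (by linarith)
        -- Halving makes the base at most `1`, so raising `ρ` to `m` can only increase the negative
        -- power.
        _ ≤ (sphereKernel p.1 p.2 / 2) ^ (-m) :=
            Real.rpow_le_rpow_of_exponent_ge (by positivity) (by linarith) (by linarith)
        _ = 2 ^ m * sphereKernel p.1 p.2 ^ (-m) := by
            rw [Real.div_rpow hp.le (by norm_num), Real.rpow_neg (by norm_num : (0 : ℝ) ≤ 2)]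
            field_simp
    · filter_upwards [hpos] with p hp
      have h1 : Tendsto (fun k => (1 - r k) ^ ρ) atTop (𝓝 0) := by
        have := (hrlim.const_sub 1).rpow_const (p := ρ) (Or.inr hρpos.le)
        rwa [sub_self, Real.zero_rpow hρpos.ne'] at this
      have h2 := h1.mul ((hklim p).rpow_const (p := -(2 * ρ)) (Or.inl hp.ne'))
      simpa only [zero_mul] using h2
  rw [integral_zero] at hGlim
  set s := μ.toSphere.real Set.univ with hs
  have hspos : 0 < s := by
    refine ENNReal.toReal_pos ?_ (measure_ne_top _ _)
    rw [Ne, Measure.measure_univ_eq_zero]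
    exact μ.toSphere_ne_zero
  have hGlow : ∀ k, s ^ 2 * 2 ^ (-ρ) ≤ ∫ p, G k p ∂P := by
    intro k
    have a1 : 0 < 1 - r k := by linarith [hr1 k]
    have a2 : 0 < 1 + r k := by linarith [hr0 k]
    have h1 : ∫ p, G k p ∂P = s ^ 2 * (1 + r k) ^ (-ρ) := by
      rw [hG, integral_const_mul, hP,
        integral_prod_symm _ (integrable_radialKernel μ (hr0 k) (hr1 k) _)]
      simp only [integral_radialKernel μ hn hρ (hr0 k) (hr1 k)]
      rw [integral_const, smul_eq_mul, ← hs, show 1 - r k ^ 2 = (1 - r k) * (1 + r k) by ring,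
        Real.mul_rpow a1.le a2.le, Real.rpow_neg a1.le]
      have : 0 < (1 - r k) ^ ρ := Real.rpow_pos_of_pos a1 _
      field_simp
    rw [h1]
    gcongr ?_ * ?_
    exact Real.rpow_le_rpow_of_nonpos a2 (by linarith [hr1 k]) (by linarith)
  have h1 := ge_of_tendsto' hGlim hGlow
  have h2 : 0 < s ^ 2 * 2 ^ (-ρ) := by positivity
  linarith

end KernelEstimates

/-! ### Positive definite kernels: products, exponentials, integrals and negative powers. -/

section PositiveKernels

variable {X : Type*}

/-- Positivity of a kernel only concerns its restrictions to finite sets. -/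
theorem posSemidef_of_finset {K : Matrix X X ℂ}
    (h : ∀ s : Finset X, (K.submatrix (Subtype.val : s → X) Subtype.val).PosSemidef) :
    K.PosSemidef := by
  classical
  constructor
  · ext i j
    have := congrFun (congrFun (h {i, j}).1 ⟨i, by simp⟩) ⟨j, by simp⟩
    simpa using this
  · intro x
    have h1 := (h x.support).2 (x.comapDomain Subtype.val Subtype.val_injective.injOn)
    have h2 : (x.comapDomain (Subtype.val : x.support → X) Subtype.val_injective.injOn).mapDomain
        Subtype.val = x := Finsupp.mapDomain_comapDomain _ Subtype.val_injective _
        (fun y hy => by simpa using hy)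
    conv_rhs => rw [← h2]
    simpa [Finsupp.sum_mapDomain_index, add_mul, mul_add] using h1

theorem posSemidef_hadamard {A B : Matrix X X ℂ} (hA : A.PosSemidef) (hB : B.PosSemidef) :
    (Matrix.of fun i j => A i j * B i j).PosSemidef :=
  hA.hadamard hB

theorem posSemidef_ofReal_mul {A : Matrix X X ℂ} (hA : A.PosSemidef) {c : ℝ} (hc : 0 ≤ c) :
    (Matrix.of fun i j => (c : ℂ) * A i j).PosSemidef := by
  have := hA.smul hc
  convert this using 1
  ext i j
  simp

theorem posSemidef_of_tendsto {A : ℕ → Matrix X X ℂ} {B : Matrix X X ℂ}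
    (hA : ∀ k, (A k).PosSemidef) (h : ∀ i j, Tendsto (fun k => A k i j) atTop (𝓝 (B i j))) :
    B.PosSemidef := by
  constructor
  · ext i j
    have h1 := (Complex.continuous_conj.tendsto _).comp (h j i)
    refine tendsto_nhds_unique h1 ((h i j).congr fun k => ?_)
    exact (congrFun (congrFun (hA k).1 i) j).symm
  · intro x
    refine ge_of_tendsto' (x := atTop) (f := fun k =>
      x.sum fun i xi => x.sum fun j xj => star xi * A k i j * xj) ?_ fun k => (hA k).2 x
    exact tendsto_finsetSum _ fun i _ => tendsto_finsetSum _ fun j _ =>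
      ((h i j).const_mul _).mul_const _

theorem posSemidef_mul_conj (f : X → ℂ) : (Matrix.of fun i j => f i * conj (f j)).PosSemidef :=
  posSemidef_of_finset fun s => by
    exact posSemidef_vecMulVec_self_star fun i : s => f i

theorem posSemidef_pow {A : Matrix X X ℂ} (hA : A.PosSemidef) (k : ℕ) :
    (Matrix.of fun i j => A i j ^ k).PosSemidef := by
  induction k with
  | zero => simpa using posSemidef_mul_conj fun _ : X => 1
  | succ k ih => simpa only [pow_succ, of_apply] using posSemidef_hadamard ih hA

/-- The partial sums of the exponential series are nonnegative combinations of Schur powers, and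
positivity survives entrywise limits. -/
theorem posSemidef_exp {A : Matrix X X ℂ} (hA : A.PosSemidef) :
    (Matrix.of fun i j => Complex.exp (A i j)).PosSemidef := by
  refine posSemidef_of_tendsto (A := fun k => ∑ m ∈ Finset.range k,
    Matrix.of fun i j => (((m.factorial : ℝ)⁻¹ : ℝ) : ℂ) * A i j ^ m) (fun k => ?_) fun i j => ?_
  · exact posSemidef_sum _ fun m _ => posSemidef_ofReal_mul (posSemidef_pow hA m) (by positivity)
  · have h := (NormedSpace.expSeries_div_hasSum_exp (A i j)).tendsto_sum_nat
    rw [← Complex.exp_eq_exp_ℂ] at h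
    refine h.congr fun k => ?_
    rw [Matrix.sum_apply]
    refine Finset.sum_congr rfl fun m _ => ?_
    simp [div_eq_inv_mul]

theorem posSemidef_integral {T : Type*} [MeasurableSpace T] {m : Measure T}
    {A : T → Matrix X X ℂ} (hA : ∀ᵐ t ∂m, (A t).PosSemidef)
    (hint : ∀ i j, Integrable (fun t => A t i j) m) :
    (Matrix.of fun i j => ∫ t, A t i j ∂m).PosSemidef := by
  constructor
  · ext i j
    rw [conjTranspose_apply, of_apply, of_apply]
    show conj _ = _
    rw [← integral_conj]
    refine integral_congr_ae ?_
    filter_upwards [hA] with t ht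
    exact congrFun (congrFun ht.1 i) j
  · intro x
    have h1 : (x.sum fun i xi => x.sum fun j xj => star xi *
        (Matrix.of fun i j => ∫ t, A t i j ∂m) i j * xj) =
        ∫ t, (x.sum fun i xi => x.sum fun j xj => star xi * A t i j * xj) ∂m := by
      simp only [Finsupp.sum]
      rw [integral_finsetSum _ fun i _ => integrable_finsetSum _ fun j _ =>
        ((hint i j).const_mul _).mul_const _]
      refine Finset.sum_congr rfl fun i _ => ?_
      rw [integral_finsetSum _ fun j _ => ((hint i j).const_mul _).mul_const _]
      refine Finset.sum_congr rfl fun j _ => ?_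
      rw [integral_mul_const, integral_const_mul, of_apply]
    rw [h1]
    have h2 : ∀ᵐ t ∂m, (x.sum fun i xi => x.sum fun j xj => star xi * A t i j * xj) =
        (((x.sum fun i xi => x.sum fun j xj => star xi * A t i j * xj).re : ℝ) : ℂ) := by
      filter_upwards [hA] with t ht
      have := Complex.le_def.mp (ht.2 x)
      exact Complex.ext rfl this.2.symm
    rw [integral_congr_ae h2, integral_complex_ofReal]
    refine Complex.zero_le_real.mpr (integral_nonneg_of_ae ?_)
    filter_upwards [hA] with t ht
    exact (Complex.le_def.mp (ht.2 x)).1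

/-- The measure `t^(ν-1) dt` on the positive half-line. -/
def gammaDensity (ν : ℝ) : Measure ℝ :=
  (volume.restrict (Set.Ioi 0)).withDensity fun t => ((t ^ (ν - 1)).toNNReal : ℝ≥0∞)

theorem measurable_toNNReal_rpow (ν : ℝ) : Measurable fun t : ℝ => (t ^ (ν - 1)).toNNReal :=
  (measurable_id.pow_const _).real_toNNReal

theorem integrable_rpow_mul_exp {ν : ℝ} (hν : 0 < ν) {r : ℂ} (hr : 0 < r.re) :
    IntegrableOn (fun t : ℝ => ((t ^ (ν - 1) : ℝ) : ℂ) * Complex.exp (-(r * t))) (Set.Ioi 0) := by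
  have h := integrableOn_rpow_mul_exp_neg_mul_rpow (p := 1) (s := ν - 1) (b := r.re) (by linarith)
    one_pos hr
  simp only [Real.rpow_one] at h
  refine (integrable_norm_iff ?_).mp (h.congr ?_)
  · exact ((measurable_id.pow_const _).complex_ofReal.mul
      (by fun_prop : Measurable fun t : ℝ => Complex.exp (-(r * t)))).aestronglyMeasurable
  · filter_upwards [ae_restrict_mem measurableSet_Ioi] with t ht
    rw [norm_mul, Complex.norm_real, Complex.norm_exp,
      Real.norm_of_nonneg (Real.rpow_nonneg (le_of_lt ht) _)]
    simp

/-- Recognising the Gamma integral as a complex moment generating function supplies its analyticity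
in `z`. -/
theorem complexMGF_gammaDensity (ν : ℝ) (z : ℂ) :
    ProbabilityTheory.complexMGF id (gammaDensity ν) z =
      ∫ t in Set.Ioi (0 : ℝ), ((t ^ (ν - 1) : ℝ) : ℂ) * Complex.exp (z * t) := by
  rw [ProbabilityTheory.complexMGF, gammaDensity,
    integral_withDensity_eq_integral_smul (measurable_toNNReal_rpow ν)]
  refine setIntegral_congr_fun measurableSet_Ioi fun t ht => ?_
  simp only [NNReal.smul_def, Complex.real_smul, id]
  rw [Real.coe_toNNReal _ (Real.rpow_nonneg (le_of_lt ht) _)]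

theorem subset_integrableExpSet_gammaDensity {ν : ℝ} (hν : 0 < ν) :
    Set.Iio 0 ⊆ ProbabilityTheory.integrableExpSet id (gammaDensity ν) := by
  intro s hs
  have hs0 : 0 < -s := neg_pos.mpr hs
  rw [ProbabilityTheory.integrableExpSet, Set.mem_ofPred_eq, gammaDensity,
    integrable_withDensity_iff_integrable_smul (measurable_toNNReal_rpow ν)]
  have h := integrableOn_rpow_mul_exp_neg_mul_rpow (p := 1) (s := ν - 1) (b := -s) (by linarith)
    one_pos hs0
  simp only [Real.rpow_one, neg_neg] at h
  refine h.congr ?_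
  filter_upwards [ae_restrict_mem measurableSet_Ioi] with t ht
  simp only [NNReal.smul_def, smul_eq_mul, id]
  rw [Real.coe_toNNReal _ (Real.rpow_nonneg (le_of_lt ht) _)]

/-- The Gamma integral with a complex parameter. -/
theorem integral_rpow_mul_exp {ν : ℝ} (hν : 0 < ν) {r : ℂ} (hr : 0 < r.re) :
    ∫ t in Set.Ioi (0 : ℝ), ((t ^ (ν - 1) : ℝ) : ℂ) * Complex.exp (-(r * t)) =
      r ^ (-ν : ℂ) * Real.Gamma ν := by
  -- Both sides are analytic on this half-plane and agree on the negative real axis, where the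
  -- classical Gamma integral applies; the identity theorem is used at `-1`.
  set U : Set ℂ := {z | z.re < 0} with hU
  have hUsub : U ⊆ {z | z.re ∈ interior
      (ProbabilityTheory.integrableExpSet id (gammaDensity ν))} := fun z hz =>
    interior_maximal (subset_integrableExpSet_gammaDensity hν) isOpen_Iio hz
  have hf := (ProbabilityTheory.analyticOnNhd_complexMGF (X := id) (μ := gammaDensity ν)).mono hUsub
  have hUopen : IsOpen U := isOpen_lt Complex.continuous_re continuous_const
  have hg : AnalyticOnNhd ℂ (fun z : ℂ => (-z) ^ (-ν : ℂ) * Real.Gamma ν) U := by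
    refine DifferentiableOn.analyticOnNhd (fun z hz => ?_) hUopen
    have h1 : -z ∈ Complex.slitPlane := Or.inl (by simpa [hU] using hz)
    exact ((differentiableAt_id.neg.cpow_const h1).mul_const _).differentiableWithinAt
  have hpre : IsPreconnected U := (convex_halfSpace_re_lt 0).isPreconnected
  have hreal : ∀ s : ℝ, 0 < s → ProbabilityTheory.complexMGF id (gammaDensity ν) ((-s : ℝ) : ℂ) =
      (-((-s : ℝ) : ℂ)) ^ (-ν : ℂ) * Real.Gamma ν := by
    intro s hs
    rw [complexMGF_gammaDensity]
    have h1 := Complex.integral_cpow_mul_exp_neg_mul_Ioi (a := ν) (by simpa using hν) hs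
    have h2 : ∫ t in Set.Ioi (0 : ℝ), ((t ^ (ν - 1) : ℝ) : ℂ) * Complex.exp (((-s : ℝ) : ℂ) * t) =
        ∫ t in Set.Ioi (0 : ℝ), (t : ℂ) ^ ((ν : ℂ) - 1) * Complex.exp (-(s * t)) := by
      refine setIntegral_congr_fun measurableSet_Ioi fun t ht => ?_
      rw [Complex.ofReal_cpow (le_of_lt ht)]
      push_cast
      rw [neg_mul]
    rw [h2, h1, Complex.Gamma_ofReal, one_div, Complex.inv_cpow _ _
      (Complex.slitPlane_arg_ne_pi (Complex.ofReal_mem_slitPlane.mpr hs)), ← Complex.cpow_neg]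
    push_cast
    rw [neg_neg]
  have hfreq : ∃ᶠ z in 𝓝[≠] ((-1 : ℝ) : ℂ),
      ProbabilityTheory.complexMGF id (gammaDensity ν) z = (-z) ^ (-ν : ℂ) * Real.Gamma ν := by
    have h1 : Tendsto (fun x : ℝ => (x : ℂ)) (𝓝[≠] (-1 : ℝ)) (𝓝[≠] ((-1 : ℝ) : ℂ)) :=
      Complex.continuous_ofReal.continuousWithinAt.tendsto_nhdsWithin fun x hx =>
        fun h => hx (Complex.ofReal_injective h)
    refine h1.frequently (Eventually.frequently ?_)
    have h2 : ∀ᶠ x in 𝓝[≠] (-1 : ℝ), x < 0 :=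
      eventually_nhdsWithin_of_eventually_nhds (gt_mem_nhds (by norm_num))
    filter_upwards [h2] with x hx
    have := hreal (-x) (by linarith)
    rwa [neg_neg] at this
  have key := hf.eqOn_of_preconnected_of_frequently_eq hg hpre
    (show ((-1 : ℝ) : ℂ) ∈ U by simp [hU]) hfreq (show -r ∈ U by simpa [hU] using hr)
  simp only [neg_neg] at key
  rw [← key, complexMGF_gammaDensity]
  simp only [neg_mul]

/-- Negative powers of `B`, when all `exp(-t B)` are positive kernels. -/
theorem posSemidef_cpow_of_exp {B G : Matrix X X ℂ} {ν : ℝ} (hν : 0 < ν)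
    (hB : ∀ i j, 0 < (B i j).re)
    (hexp : ∀ t : ℝ, 0 < t → (Matrix.of fun i j => G i j * Complex.exp (-(B i j * t))).PosSemidef) :
    (Matrix.of fun i j => G i j * B i j ^ (-ν : ℂ)).PosSemidef := by
  have hΓ := Real.Gamma_pos_of_pos hν
  have h1 : (Matrix.of fun i j => ∫ t in Set.Ioi (0 : ℝ), ((t ^ (ν - 1) : ℝ) : ℂ) *
      (G i j * Complex.exp (-(B i j * t)))).PosSemidef := by
    refine posSemidef_integral (A := fun t => Matrix.of fun i j => ((t ^ (ν - 1) : ℝ) : ℂ) *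
      (G i j * Complex.exp (-(B i j * t)))) ?_ fun i j => ?_
    · filter_upwards [ae_restrict_mem measurableSet_Ioi] with t ht
      exact posSemidef_ofReal_mul (hexp t ht) (Real.rpow_nonneg (le_of_lt ht) _)
    · refine ((integrable_rpow_mul_exp hν (hB i j)).const_mul (G i j)).congr (ae_of_all _ fun t => ?_)
      simp only [of_apply]
      ring
  have h2 := posSemidef_ofReal_mul h1 (inv_nonneg.mpr hΓ.le)
  convert h2 using 1
  ext i j
  simp only [of_apply]
  have h3 : ∫ t in Set.Ioi (0 : ℝ), ((t ^ (ν - 1) : ℝ) : ℂ) *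
      (G i j * Complex.exp (-(B i j * t))) = G i j * ∫ t in Set.Ioi (0 : ℝ),
        ((t ^ (ν - 1) : ℝ) : ℂ) * Complex.exp (-(B i j * t)) := by
    rw [← integral_const_mul]
    congr 1
    funext t
    ring
  rw [h3, integral_rpow_mul_exp hν (hB i j)]
  have : ((Real.Gamma ν : ℝ) : ℂ) ≠ 0 := Complex.ofReal_ne_zero.mpr hΓ.ne'
  push_cast
  field_simp

/-- `(1 - A)^{-ν}` is a positive kernel if `A` is. -/
theorem posSemidef_one_sub_cpow {A : Matrix X X ℂ} (hA : A.PosSemidef)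
    (hA1 : ∀ i j, 0 < (1 - A i j).re) {ν : ℝ} (hν : 0 < ν) :
    (Matrix.of fun i j => (1 - A i j) ^ (-ν : ℂ)).PosSemidef := by
  have := posSemidef_cpow_of_exp (B := Matrix.of fun i j => 1 - A i j) (G := Matrix.of fun _ _ => 1)
    hν hA1 fun t ht => ?_
  · simpa using this
  -- Factor `exp(-t(1 - A))` as `exp(-t) exp(tA)`.
  have h1 := posSemidef_ofReal_mul (posSemidef_exp (posSemidef_ofReal_mul hA ht.le))
    (Real.exp_pos (-t)).le
  convert h1 using 1
  ext i j
  simp only [of_apply, one_mul]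
  rw [Complex.ofReal_exp, ← Complex.exp_add]
  congr 1
  push_cast
  ring

/-- The Gaussian average of the kernels `exp(-a (1, β) M (1, β)*)` over `β ∈ ℂ`. -/
theorem posSemidef_gaussian_average {M₁₁ M₁₂ M₂₁ M₂₂ : Matrix X X ℂ} (h22 : ∀ i j, 0 < (M₂₂ i j).re)
    {a : ℝ} (ha : 0 < a)
    (hexp : ∀ x y : ℝ, (Matrix.of fun i j => Complex.exp (-(a * (M₁₁ i j + M₂₂ i j * (x ^ 2 + y ^ 2) +
      (M₁₂ i j + M₂₁ i j) * x + Complex.I * (M₁₂ i j - M₂₁ i j) * y)))).PosSemidef) :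
    (Matrix.of fun i j => (M₂₂ i j)⁻¹ *
      Complex.exp (-((M₁₁ i j - M₁₂ i j * M₂₁ i j / M₂₂ i j) * a))).PosSemidef := by
  have h0 : ∀ i j, M₂₂ i j ≠ 0 := fun i j h => by have := h22 i j; rw [h] at this; simp at this
  have hb : ∀ i j, (-(a * M₂₂ i j)).re < 0 := fun i j => by
    simpa using mul_pos ha (h22 i j)
  have ha0 : (a : ℂ) ≠ 0 := Complex.ofReal_ne_zero.mpr ha.ne'
  -- With `β = x + iy` the exponent is `-a(M₁₁ + M₁₂ β + M₂₁ β̄ + M₂₂ |β|²)`. Two one-dimensional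
  -- Gaussian integrals, in `y` and then in `x`, complete the square and leave the Schur complement.
  have hy : ∀ x : ℝ, (Matrix.of fun i j => ∫ y : ℝ, Complex.exp (-(a * M₂₂ i j) * y ^ 2 +
      (-(a * (Complex.I * (M₁₂ i j - M₂₁ i j)))) * y + (-(a * (M₁₁ i j + M₂₂ i j * x ^ 2 +
        (M₁₂ i j + M₂₁ i j) * x))))).PosSemidef := by
    intro x
    refine posSemidef_integral (A := fun y : ℝ => Matrix.of fun i j =>
      Complex.exp (-(a * M₂₂ i j) * y ^ 2 +
      (-(a * (Complex.I * (M₁₂ i j - M₂₁ i j)))) * y + (-(a * (M₁₁ i j + M₂₂ i j * x ^ 2 +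
        (M₁₂ i j + M₂₁ i j) * x))))) (ae_of_all _ fun y => ?_) fun i j =>
      integrable_cexp_quadratic' (hb i j) _ _
    convert hexp x y using 1
    ext i j
    simp only [of_apply]
    congr 1
    ring
  simp only [integral_cexp_quadratic (hb _ _)] at hy
  have hx : (Matrix.of fun i j => ∫ x : ℝ, (Real.pi / -(-(a * M₂₂ i j))) ^ (1 / 2 : ℂ) *
      Complex.exp (-(a * M₂₂ i j) * x ^ 2 + (-(a * (M₁₂ i j + M₂₁ i j))) * x +
      (-(a * M₁₁ i j) - (-(a * (Complex.I * (M₁₂ i j - M₂₁ i j)))) ^ 2 /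
        (4 * (-(a * M₂₂ i j)))))).PosSemidef := by
    refine posSemidef_integral (A := fun x : ℝ => Matrix.of fun i j =>
      (Real.pi / -(-(a * M₂₂ i j))) ^ (1 / 2 : ℂ) *
      Complex.exp (-(a * M₂₂ i j) * x ^ 2 + (-(a * (M₁₂ i j + M₂₁ i j))) * x +
      (-(a * M₁₁ i j) - (-(a * (Complex.I * (M₁₂ i j - M₂₁ i j)))) ^ 2 /
        (4 * (-(a * M₂₂ i j)))))) (ae_of_all _ fun x => ?_) fun i j =>
      (integrable_cexp_quadratic' (hb i j) _ _).const_mul _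
    convert hy x using 1
    ext i j
    simp only [of_apply]
    congr 2
    ring
  simp only [integral_const_mul, integral_cexp_quadratic (hb _ _)] at hx
  -- Each integration contributes `(π / (a M₂₂))^{1/2}`; the factor `a / π` reduces their product to
  -- `M₂₂⁻¹`.
  have h3 := posSemidef_ofReal_mul hx (c := a / Real.pi) (by positivity)
  convert h3 using 1
  ext i j
  simp only [of_apply]
  have hπ : (Real.pi : ℂ) ≠ 0 := Complex.ofReal_ne_zero.mpr Real.pi_ne_zero
  have hh := h0 i j
  generalize M₁₁ i j = m₁₁, M₁₂ i j = m₁₂, M₂₁ i j = m₂₁, M₂₂ i j = m₂₂ at hh ⊢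
  have hne : (Real.pi : ℂ) / -(-(a * m₂₂)) ≠ 0 := by
    rw [neg_neg]
    exact div_ne_zero hπ (mul_ne_zero ha0 hh)
  rw [← mul_assoc, ← mul_assoc, mul_assoc ((a / Real.pi : ℝ) : ℂ), ← Complex.cpow_add _ _ hne]
  have hI := Complex.I_sq
  congr 1
  · norm_num
    field_simp
  · congr 1
    field_simp
    ring_nf
    rw [hI]
    ring

end PositiveKernels

/-! ### Fractional linear maps of matrix balls and the values of `h`. -/

section MatrixBallGeometry

variable {p q : Type} [Fintype p] [Fintype q] [DecidableEq p] [DecidableEq q]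

omit [DecidableEq p] [DecidableEq q] in
theorem toBlocks_mul (g g' : Matrix (p ⊕ q) (p ⊕ q) ℂ) :
    (g * g').toBlocks₁₁ = g.toBlocks₁₁ * g'.toBlocks₁₁ + g.toBlocks₁₂ * g'.toBlocks₂₁ ∧
    (g * g').toBlocks₁₂ = g.toBlocks₁₁ * g'.toBlocks₁₂ + g.toBlocks₁₂ * g'.toBlocks₂₂ ∧
    (g * g').toBlocks₂₁ = g.toBlocks₂₁ * g'.toBlocks₁₁ + g.toBlocks₂₂ * g'.toBlocks₂₁ ∧
    (g * g').toBlocks₂₂ = g.toBlocks₂₁ * g'.toBlocks₁₂ + g.toBlocks₂₂ * g'.toBlocks₂₂ := by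
  have h : g * g' = fromBlocks g.toBlocks₁₁ g.toBlocks₁₂ g.toBlocks₂₁ g.toBlocks₂₂ *
      fromBlocks g'.toBlocks₁₁ g'.toBlocks₁₂ g'.toBlocks₂₁ g'.toBlocks₂₂ := by
    rw [fromBlocks_toBlocks, fromBlocks_toBlocks]
  rw [h, fromBlocks_multiply]
  simp

omit [DecidableEq p] in
theorem mobius_mul_mDen (g : Matrix (p ⊕ q) (p ⊕ q) ℂ) {z : Matrix p q ℂ}
    (hz : IsUnit (mDen g z)) : mobius g z * mDen g z = mNum g z := by
  rw [mobius, Matrix.mul_assoc, nonsing_inv_mul _ ((isUnit_iff_isUnit_det _).mp hz), Matrix.mul_one]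

omit [DecidableEq p] in
theorem mNum_mul (g g' : Matrix (p ⊕ q) (p ⊕ q) ℂ) {z : Matrix p q ℂ}
    (hz : IsUnit (mDen g' z)) : mNum (g * g') z = mNum g (mobius g' z) * mDen g' z := by
  obtain ⟨h1, h2, -, -⟩ := toBlocks_mul g g'
  rw [mNum, mNum, h1, h2, Matrix.add_mul (_ * mobius g' z), Matrix.mul_assoc _ (mobius g' z),
    mobius_mul_mDen g' hz]
  simp only [mNum, mDen, Matrix.add_mul, Matrix.mul_add, Matrix.mul_assoc]
  abel

omit [DecidableEq p] in
theorem mDen_mul (g g' : Matrix (p ⊕ q) (p ⊕ q) ℂ) {z : Matrix p q ℂ}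
    (hz : IsUnit (mDen g' z)) : mDen (g * g') z = mDen g (mobius g' z) * mDen g' z := by
  obtain ⟨-, -, h1, h2⟩ := toBlocks_mul g g'
  rw [mDen, mDen, h1, h2, Matrix.add_mul (_ * mobius g' z), Matrix.mul_assoc _ (mobius g' z),
    mobius_mul_mDen g' hz]
  simp only [mNum, mDen, Matrix.add_mul, Matrix.mul_add, Matrix.mul_assoc]
  abel

omit [DecidableEq p] in
theorem mobius_mul (g g' : Matrix (p ⊕ q) (p ⊕ q) ℂ) {z : Matrix p q ℂ}
    (hz : IsUnit (mDen g' z)) : mobius (g * g') z = mobius g (mobius g' z) := by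
  rw [mobius, mNum_mul g g' hz, mDen_mul g g' hz, Matrix.mul_inv_rev, Matrix.mul_assoc,
    ← Matrix.mul_assoc (mDen g' z), mul_nonsing_inv _ ((isUnit_iff_isUnit_det _).mp hz),
    Matrix.one_mul]
  rfl

omit [Fintype q] in
theorem mDen_one (z : Matrix p q ℂ) : mDen 1 z = 1 := by
  rw [mDen, ← fromBlocks_one, toBlocks_fromBlocks₂₁, toBlocks_fromBlocks₂₂]
  simp

theorem mobius_one (z : Matrix p q ℂ) : mobius 1 z = z := by
  rw [mobius, mDen_one, mNum, ← fromBlocks_one, toBlocks_fromBlocks₁₁, toBlocks_fromBlocks₁₂]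
  simp

/-- This is invariance of the form evaluated on the columns `(w, 1)` and `(z, 1)`, the polarised
version of `mNum_mDen`; it underlies the covariance of `h`. -/
theorem mDen_conjTranspose_mul_sub {g : Matrix (p ⊕ q) (p ⊕ q) ℂ} (hg : Preserves g)
    (w z : Matrix p q ℂ) :
    (mDen g w)ᴴ * mDen g z - (mNum g w)ᴴ * mNum g z = 1 - wᴴ * z := by
  have h : (fromBlocks g.toBlocks₁₁ g.toBlocks₁₂ g.toBlocks₂₁ g.toBlocks₂₂)ᴴ * sig p q ℂ *
      fromBlocks g.toBlocks₁₁ g.toBlocks₁₂ g.toBlocks₂₁ g.toBlocks₂₂ = sig p q ℂ := by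
    rw [fromBlocks_toBlocks]; exact hg
  rw [sig, fromBlocks_conjTranspose, fromBlocks_multiply, fromBlocks_multiply,
    fromBlocks_inj] at h
  simp only [Matrix.mul_one, Matrix.mul_zero, add_zero, zero_add, Matrix.mul_neg,
    Matrix.neg_mul] at h
  obtain ⟨h1, h2, h3, h4⟩ := h
  unfold mNum mDen
  generalize g.toBlocks₁₁ = a at *
  generalize g.toBlocks₁₂ = b at *
  generalize g.toBlocks₂₁ = c at *
  generalize g.toBlocks₂₂ = d at *
  have e1 : aᴴ * a = 1 + cᴴ * c := by rw [← h1]; abel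
  have e2 : aᴴ * b = cᴴ * d := by rwa [← sub_eq_add_neg, sub_eq_zero] at h2
  have e3 : bᴴ * a = dᴴ * c := by rwa [← sub_eq_add_neg, sub_eq_zero] at h3
  have e4 : dᴴ * d = 1 + bᴴ * b := by
    have : bᴴ * b = -1 + dᴴ * d := by rw [← h4]; abel
    rw [this]; abel
  simp only [conjTranspose_add, conjTranspose_mul, Matrix.add_mul, Matrix.mul_add,
    Matrix.mul_assoc]
  have f1 : aᴴ * (a * z) = z + cᴴ * (c * z) := by
    rw [← Matrix.mul_assoc, e1, Matrix.add_mul, Matrix.one_mul, Matrix.mul_assoc]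
  have f3 : bᴴ * (a * z) = dᴴ * (c * z) := by rw [← Matrix.mul_assoc, e3, Matrix.mul_assoc]
  rw [f1, f3, e2, e4, Matrix.mul_add]
  abel

theorem mobius_covariance {g : Matrix (p ⊕ q) (p ⊕ q) ℂ} (hg : Preserves g)
    {w z : Matrix p q ℂ} (hw : IsUnit (mDen g w)) (hz : IsUnit (mDen g z)) :
    (mDen g w)ᴴ * (1 - (mobius g w)ᴴ * mobius g z) * mDen g z = 1 - wᴴ * z := by
  rw [← mDen_conjTranspose_mul_sub hg w z, ← mobius_mul_mDen g hw, ← mobius_mul_mDen g hz,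
    conjTranspose_mul, Matrix.mul_sub, Matrix.sub_mul]
  simp only [Matrix.mul_assoc, Matrix.mul_one]

theorem det_mobius_covariance {g : Matrix (p ⊕ q) (p ⊕ q) ℂ} (hg : Preserves g)
    {w z : Matrix p q ℂ} (hw : IsUnit (mDen g w)) (hz : IsUnit (mDen g z)) :
    (mDen g z).det * conj (mDen g w).det * (1 - (mobius g w)ᴴ * mobius g z).det =
      (1 - wᴴ * z).det := by
  rw [← mobius_covariance hg hw hz, det_mul, det_mul, det_conjTranspose]
  show _ = star _ * _ * _
  rw [Complex.star_def]
  ring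

omit [DecidableEq p] in
theorem conj_det_one_sub (z w : Matrix p q ℂ) :
    conj (1 - wᴴ * z).det = (1 - zᴴ * w).det := by
  rw [← Complex.star_def, ← det_conjTranspose]
  simp

theorem zero_mem_matBall : (0 : Matrix p q ℂ) ∈ matBall p q := by
  simpa [matBall] using PosDef.one

theorem smul_mem_matBall {r : ℝ} (hr : 0 ≤ r) (hr1 : r ≤ 1) {z : Matrix p q ℂ}
    (hz : z ∈ matBall p q) : r • z ∈ matBall p q := by
  have h1 : (1 : Matrix q q ℂ) - (r • z)ᴴ * (r • z) = (1 - zᴴ * z) + (1 - r ^ 2) • (zᴴ * z) := by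
    rw [conjTranspose_smul, star_trivial, Matrix.smul_mul, Matrix.mul_smul, smul_smul]
    module
  show (1 - (r • z)ᴴ * (r • z)).PosDef
  rw [h1]
  exact PosDef.add_posSemidef hz ((posSemidef_conjTranspose_mul_self z).smul (by nlinarith))

theorem smul_mem_matBall_of_isometry {r : ℝ} (hr : 0 ≤ r) (hr1 : r < 1) {z : Matrix p q ℂ}
    (hz : zᴴ * z = 1) : r • z ∈ matBall p q := by
  have h1 : (1 : Matrix q q ℂ) - (r • z)ᴴ * (r • z) = (1 - r ^ 2) • (1 : Matrix q q ℂ) := by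
    rw [conjTranspose_smul, star_trivial, Matrix.smul_mul, Matrix.mul_smul, smul_smul, hz]
    module
  show (1 - (r • z)ᴴ * (r • z)).PosDef
  rw [h1]
  exact PosDef.one.smul (by nlinarith)

/-- For `z` in the ball and `w` in its closure, `1 - w* z` has positive definite real part. -/
theorem re_one_sub_pos {z w : Matrix p q ℂ} (hz : z ∈ matBall p q)
    (hw : (1 - wᴴ * w).PosSemidef) {v : q → ℂ} (hv : v ≠ 0) :
    0 < (star v ⬝ᵥ ((1 - wᴴ * z) *ᵥ v)).re := by
  -- The sum is twice the Hermitian part of `1 - w* z`; its first term is definite and the others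
  -- are semidefinite.
  have h1 : ((1 - zᴴ * z) + (1 - wᴴ * w) + (z - w)ᴴ * (z - w)).PosDef :=
    (PosDef.add_posSemidef hz hw).add_posSemidef (posSemidef_conjTranspose_mul_self _)
  have h2 : (1 - zᴴ * z) + (1 - wᴴ * w) + (z - w)ᴴ * (z - w) =
      (1 - wᴴ * z) + (1 - wᴴ * z)ᴴ := by
    simp only [conjTranspose_sub, conjTranspose_mul, conjTranspose_one, conjTranspose_conjTranspose,
      Matrix.sub_mul, Matrix.mul_sub]
    abel
  have h3 := h1.dotProduct_mulVec_pos hv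
  rw [h2, add_mulVec, dotProduct_add] at h3
  have h4 : star v ⬝ᵥ ((1 - wᴴ * z)ᴴ *ᵥ v) = conj (star v ⬝ᵥ ((1 - wᴴ * z) *ᵥ v)) := by
    rw [dotProduct_mulVec, ← star_mulVec, ← Complex.star_def, ← star_dotProduct_star, star_star]
  rw [h4, Complex.add_conj] at h3
  have := (Complex.lt_def.mp h3).1
  rw [Complex.ofReal_re, Complex.zero_re] at this
  linarith

theorem re_det_one_sub_pos {z w : Matrix p Unit ℂ} (hz : z ∈ matBall p Unit)
    (hw : (1 - wᴴ * w).PosSemidef) : 0 < (1 - wᴴ * z).det.re := by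
  have h := re_one_sub_pos hz hw (v := fun _ => 1) (fun h => one_ne_zero (congrFun h ()))
  rw [det_unique]
  simpa [dotProduct, mulVec] using h

/-- The Schur complement of the lower right entry of `1 - w* z`. -/
theorem re_schurComplement_pos {z w : Matrix p (Fin 2) ℂ} (hz : z ∈ matBall p (Fin 2))
    (hw : (1 - wᴴ * w).PosSemidef) : 0 < ((1 - wᴴ * z : Matrix (Fin 2) (Fin 2) ℂ) 1 1).re ∧
    0 < ((1 - wᴴ * z : Matrix (Fin 2) (Fin 2) ℂ) 0 0 - (1 - wᴴ * z : Matrix (Fin 2) (Fin 2) ℂ) 0 1 *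
      (1 - wᴴ * z : Matrix (Fin 2) (Fin 2) ℂ) 1 0 /
        (1 - wᴴ * z : Matrix (Fin 2) (Fin 2) ℂ) 1 1).re := by
  have h := fun {v : Fin 2 → ℂ} (hv : v ≠ 0) => re_one_sub_pos hz hw hv
  generalize (1 - wᴴ * z) = M at *
  have h11 : 0 < (M 1 1).re := by
    have := h (v := ![0, 1]) (fun h => by simpa using congrFun h 1)
    simpa [dotProduct, mulVec, Fin.sum_univ_two] using this
  refine ⟨h11, ?_⟩
  have h0 : M 1 1 ≠ 0 := by intro h; rw [h] at h11; simp at h11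
  -- This vector annihilates the second entry of `M v`, so the quadratic form reduces to the Schur
  -- complement.
  have := h (v := ![1, -(M 1 0 / M 1 1)]) (fun h => by simpa using congrFun h 0)
  simp only [dotProduct, mulVec, Fin.sum_univ_two, Pi.star_apply, cons_val_zero, cons_val_one,
    star_one, one_mul, mul_one] at this
  rw [show M 1 0 + M 1 1 * -(M 1 0 / M 1 1) = 0 by field_simp; ring, mul_zero, add_zero] at this
  convert this using 2
  ring

omit [Fintype p] [DecidableEq p] in
theorem det_eq_mul_schurComplement {M : Matrix (Fin 2) (Fin 2) ℂ} (h : M 1 1 ≠ 0) :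
    M.det = M 1 1 * (M 0 0 - M 0 1 * M 1 0 / M 1 1) := by
  rw [det_fin_two]
  field_simp

theorem arg_add_mem_of_re_pos {a b : ℂ} (ha : 0 < a.re) (hb : 0 < b.re) :
    a.arg + b.arg ∈ Set.Ioo (-Real.pi) Real.pi := by
  have h1 := abs_lt.mp ((Complex.abs_arg_lt_pi_div_two_iff (z := a)).mpr (Or.inl ha))
  have h2 := abs_lt.mp ((Complex.abs_arg_lt_pi_div_two_iff (z := b)).mpr (Or.inl hb))
  constructor <;> linarith [h1.1, h1.2, h2.1, h2.2]

theorem ne_zero_of_re_pos {a : ℂ} (ha : 0 < a.re) : a ≠ 0 := by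
  rintro rfl
  simp at ha

theorem mul_mem_slitPlane_of_re_pos {a b : ℂ} (ha : 0 < a.re) (hb : 0 < b.re) :
    a * b ∈ Complex.slitPlane := by
  have h := arg_add_mem_of_re_pos ha hb
  rw [Complex.mem_slitPlane_iff_arg]
  have ha0 := ne_zero_of_re_pos ha
  have hb0 := ne_zero_of_re_pos hb
  rw [Complex.arg_mul ha0 hb0 ⟨h.1, h.2.le⟩]
  exact ⟨h.2.ne, mul_ne_zero ha0 hb0⟩

theorem mul_cpow_of_re_pos {a b : ℂ} (ha : 0 < a.re) (hb : 0 < b.re) (s : ℂ) :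
    (a * b) ^ s = a ^ s * b ^ s := by
  have h := arg_add_mem_of_re_pos ha hb
  have ha0 := ne_zero_of_re_pos ha
  have hb0 := ne_zero_of_re_pos hb
  rw [Complex.cpow_def_of_ne_zero (mul_ne_zero ha0 hb0), Complex.cpow_def_of_ne_zero ha0,
    Complex.cpow_def_of_ne_zero hb0, ← Complex.exp_add, ← add_mul,
    Complex.log_mul ha0 hb0 ⟨h.1, h.2.le⟩]

/-- The determinant is a product of two numbers with positive real part, the lower right entry and
its Schur complement. Their arguments add up to less than `π` in absolute value. -/
theorem det_one_sub_mem_slitPlane {z w : Matrix p (Fin 2) ℂ} (hz : z ∈ matBall p (Fin 2))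
    (hw : (1 - wᴴ * w).PosSemidef) : (1 - wᴴ * z).det ∈ Complex.slitPlane := by
  obtain ⟨h1, h2⟩ := re_schurComplement_pos hz hw
  rw [det_eq_mul_schurComplement (ne_zero_of_re_pos h1)]
  exact mul_mem_slitPlane_of_re_pos h1 h2

/-! ### Positive kernels on matrix balls -/

omit [DecidableEq p] [DecidableEq q] in
theorem posSemidef_quadratic (D : Set (Matrix p q ℂ)) (v : q → ℂ) :
    (Matrix.of fun z w : D => star v ⬝ᵥ ((w.1ᴴ * z.1) *ᵥ v)).PosSemidef := by
  have h : (Matrix.of fun z w : D => star v ⬝ᵥ ((w.1ᴴ * z.1) *ᵥ v)) =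
      ∑ i, Matrix.of fun z w : D => (z.1 *ᵥ v) i * conj ((w.1 *ᵥ v) i) := by
    ext z w
    rw [Matrix.sum_apply, of_apply, ← mulVec_mulVec, dotProduct_mulVec, ← star_mulVec, dotProduct]
    refine Finset.sum_congr rfl fun i _ => ?_
    rw [of_apply, Pi.star_apply, Complex.star_def, mul_comm]
  rw [h]
  exact posSemidef_sum _ fun i _ => posSemidef_mul_conj _

theorem posSemidef_det_cpow_unit {ν : ℝ} (hν : 0 < ν) :
    (Matrix.of fun z w : matBall p Unit => (1 - w.1ᴴ * z.1).det ^ (-ν : ℂ)).PosSemidef := by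
  have h := posSemidef_one_sub_cpow (posSemidef_quadratic (matBall p Unit) fun _ => 1)
    (fun z w => ?_) hν
  · convert h using 1
    ext z w
    simp [det_unique, dotProduct, mulVec]
  · have := re_det_one_sub_pos z.2 w.2.posSemidef
    rw [det_unique] at this
    simpa [dotProduct, mulVec] using this

/-- With `M = 1 - w* z` and Schur complement `s` of `M₁₁` (the lower right entry), `det M ^ (-ν)` is
the Schur product of `M₁₁ ^ (-(ν - 1))` and `M₁₁⁻¹ s ^ (-ν)`. The first is positive because `ν > 1`.
The second is an integral over `t` of Gaussian averages of the positive kernels `exp(-t v* M v)`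
with `v = (1, β)`. -/
theorem posSemidef_det_cpow_fin_two {ν : ℝ} (hν : 1 < ν) :
    (Matrix.of fun z w : matBall p (Fin 2) =>
      (1 - w.1ᴴ * z.1).det ^ (-ν : ℂ)).PosSemidef := by
  set D := matBall p (Fin 2)
  have hre := fun z w : D => re_schurComplement_pos z.2 w.2.posSemidef
  set M : Fin 2 → Fin 2 → Matrix D D ℂ := fun i j => Matrix.of fun z w =>
    (1 - w.1ᴴ * z.1 : Matrix (Fin 2) (Fin 2) ℂ) i j with hM
  have h1 : (Matrix.of fun z w : D => M 1 1 z w ^ (-((ν - 1 : ℝ) : ℂ))).PosSemidef := by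
    have h := posSemidef_one_sub_cpow (posSemidef_quadratic D ![0, 1]) (fun z w => ?_)
      (sub_pos.mpr hν)
    · convert h using 1
      ext z w
      simp [hM, dotProduct, mulVec, Fin.sum_univ_two]
    · simpa [dotProduct, mulVec, Fin.sum_univ_two] using (hre z w).1
  have h2 : (Matrix.of fun z w : D => (M 1 1 z w)⁻¹ *
      (M 0 0 z w - M 0 1 z w * M 1 0 z w / M 1 1 z w) ^ (-ν : ℂ)).PosSemidef := by
    refine posSemidef_cpow_of_exp (G := Matrix.of fun z w => (M 1 1 z w)⁻¹)
      (B := Matrix.of fun z w => M 0 0 z w - M 0 1 z w * M 1 0 z w / M 1 1 z w)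
      (by linarith) (fun z w => (hre z w).2) fun t ht => ?_
    refine posSemidef_gaussian_average (M₁₁ := M 0 0) (M₁₂ := M 0 1) (M₂₁ := M 1 0)
      (M₂₂ := M 1 1) (fun z w => (hre z w).1) ht fun x y => ?_
    have h3 := posSemidef_ofReal_mul (posSemidef_exp (posSemidef_ofReal_mul
      (posSemidef_quadratic D ![1, x + y * Complex.I]) ht.le))
      (Real.exp_pos (-(t * (1 + x ^ 2 + y ^ 2)))).le
    convert h3 using 1
    ext z w
    simp only [of_apply, hM]
    rw [Complex.ofReal_exp, ← Complex.exp_add]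
    congr 1
    simp only [dotProduct, mulVec, Fin.sum_univ_two, Pi.star_apply, cons_val_zero, cons_val_one,
      map_one, one_mul, mul_one, Matrix.sub_apply, one_apply_eq, Complex.star_def, map_add, map_mul,
      Complex.conj_ofReal, Complex.conj_I, one_apply_ne (zero_ne_one : (0 : Fin 2) ≠ 1),
      one_apply_ne (one_ne_zero : (1 : Fin 2) ≠ 0)]
    push_cast
    linear_combination (t * (w.1ᴴ * z.1) 1 1 * y ^ 2) * Complex.I_sq
  have h4 := posSemidef_hadamard h1 h2
  convert h4 using 1
  ext z w
  have h11 := ne_zero_of_re_pos (hre z w).1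
  simp only [of_apply, hM]
  rw [det_eq_mul_schurComplement h11, mul_cpow_of_re_pos (hre z w).1 (hre z w).2, ← mul_assoc]
  congr 1
  rw [← Complex.cpow_neg_one, ← Complex.cpow_add _ _ h11]
  congr 1
  push_cast
  ring

end MatrixBallGeometry

/-! ### Cocycle identities for the action on the sphere. -/

section SphereCocycle

variable {F : Type} [NormedDivisionRing F] [StarRing F] [NormedAlgebra ℝ F] [NormSqStar F] {n : ℕ}

omit [NormedAlgebra ℝ F] [NormSqStar F] in
theorem mulVec_mul_right (g : Matrix (Fin n ⊕ Unit) (Fin n ⊕ Unit) F) (u : Fin n → F) (y : F) :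
    (g *ᵥ fun i => Sum.elim u (fun _ : Unit => (1 : F)) i * y) =
      fun i => Sum.elim (sNum g u) (fun _ => sDen g u) i * y := by
  rw [← mulVec_elim]
  funext i
  simp only [mulVec, dotProduct, Finset.sum_mul, mul_assoc]

-- Matrices act from the left on the column `(u, 1)` and scalars from the right, so normalising the
-- last coordinate commutes with the action even over `ℍ`.
omit [NormedAlgebra ℝ F] [NormSqStar F] in
theorem sNum_sDen_mul (g g' : Matrix (Fin n ⊕ Unit) (Fin n ⊕ Unit) F) {u : Fin n → F}
    (h : sDen g' u ≠ 0) :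
    sNum (g * g') u = (fun i => sNum g (fun j => sNum g' u j * (sDen g' u)⁻¹) i * sDen g' u) ∧
    sDen (g * g') u = sDen g (fun j => sNum g' u j * (sDen g' u)⁻¹) * sDen g' u := by
  have h1 := mulVec_elim (g * g') u
  have h2 : Sum.elim (sNum g' u) (fun _ : Unit => sDen g' u) =
      fun i => Sum.elim (fun j => sNum g' u j * (sDen g' u)⁻¹) (fun _ : Unit => (1 : F)) i *
        sDen g' u := by
    funext i; rcases i with i | i <;> simp [h]
  rw [← mulVec_mulVec, mulVec_elim, h2, mulVec_mul_right] at h1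
  exact ⟨funext fun i => (congrFun h1 (Sum.inl i)).symm, (congrFun h1 (Sum.inr ())).symm⟩

omit [NormedAlgebra ℝ F] [NormSqStar F] in
theorem sNum_sDen_one (u : Fin n → F) : sNum 1 u = u ∧ sDen 1 u = 1 := by
  have h1 := mulVec_elim 1 u
  rw [one_mulVec] at h1
  exact ⟨funext fun i => (congrFun h1 (Sum.inl i)).symm, (congrFun h1 (Sum.inr ())).symm⟩

theorem sphereAct_one (h : Preserves ((1 : (Matrix (Fin n ⊕ Unit) (Fin n ⊕ Unit) F)ˣ) :
    Matrix (Fin n ⊕ Unit) (Fin n ⊕ Unit) F)) (u : USphere F n) : sphereAct 1 h u = u := by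
  obtain ⟨h1, h2⟩ := sNum_sDen_one fun j => u.1 j
  ext i
  show sNum 1 _ i * (sDen 1 _)⁻¹ = _
  rw [h1, h2, inv_one, mul_one]

omit [NormedAlgebra ℝ F] [NormSqStar F] in
theorem sphereFactor_one (u : USphere F n) :
    sphereFactor (1 : (Matrix (Fin n ⊕ Unit) (Fin n ⊕ Unit) F)ˣ) u = 1 := by
  show ‖sDen 1 _‖ = 1
  rw [(sNum_sDen_one _).2, norm_one]

variable {g g' : (Matrix (Fin n ⊕ Unit) (Fin n ⊕ Unit) F)ˣ}

theorem sphereAct_mul (hg : Preserves (g : Matrix (Fin n ⊕ Unit) (Fin n ⊕ Unit) F))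
    (hg' : Preserves (g' : Matrix (Fin n ⊕ Unit) (Fin n ⊕ Unit) F))
    (hgg' : Preserves ((g * g' : (Matrix (Fin n ⊕ Unit) (Fin n ⊕ Unit) F)ˣ) :
      Matrix (Fin n ⊕ Unit) (Fin n ⊕ Unit) F)) (u : USphere F n) :
    sphereAct (g * g') hgg' u = sphereAct g hg (sphereAct g' hg' u) := by
  have h0 := sDen_ne_zero g' hg' _ (sphere_sum u)
  obtain ⟨h1, h2⟩ := sNum_sDen_mul g.1 g'.1 h0
  ext i
  show sNum (g.1 * g'.1) _ i * (sDen (g.1 * g'.1) _)⁻¹ = sNum g.1 _ i * (sDen g.1 _)⁻¹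
  rw [h1, h2, _root_.mul_inv_rev, mul_assoc, mul_inv_cancel_left₀ h0]
  rfl

theorem sphereFactor_mul (hg' : Preserves (g' : Matrix (Fin n ⊕ Unit) (Fin n ⊕ Unit) F))
    (u : USphere F n) :
    sphereFactor (g * g') u = sphereFactor g (sphereAct g' hg' u) * sphereFactor g' u := by
  have h0 := sDen_ne_zero g' hg' _ (sphere_sum u)
  show ‖sDen (g.1 * g'.1) _‖ = _
  rw [(sNum_sDen_mul g.1 g'.1 h0).2, norm_mul]
  rfl

theorem sphereFactor_pos (hg : Preserves (g : Matrix (Fin n ⊕ Unit) (Fin n ⊕ Unit) F))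
    (u : USphere F n) : 0 < sphereFactor g u :=
  norm_pos_iff.mpr (sDen_ne_zero g hg _ (sphere_sum u))

end SphereCocycle

/-! ### Continuity and holomorphy on matrix balls. -/

section MatrixTopology

variable {p q : Type} [Fintype p] [Fintype q] [DecidableEq p] [DecidableEq q]

theorem posSemidef_of_mem_closure {w : Matrix p q ℂ} (hw : w ∈ closure (matBall p q)) :
    (1 - wᴴ * w).PosSemidef := by
  have h1 : IsClosed {w : Matrix p q ℂ | ∀ v : q → ℂ, 0 ≤ star v ⬝ᵥ ((1 - wᴴ * w) *ᵥ v)} := by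
    simp only [Set.ofPred_forall]
    refine isClosed_iInter fun v => isClosed_le continuous_const ?_
    exact Continuous.dotProduct continuous_const
      ((continuous_const.sub (continuous_id.matrix_conjTranspose.matrix_mul continuous_id)).matrix_mulVec
        continuous_const)
  have h2 : closure (matBall p q) ⊆ {w : Matrix p q ℂ | ∀ v : q → ℂ,
      0 ≤ star v ⬝ᵥ ((1 - wᴴ * w) *ᵥ v)} :=
    closure_minimal (fun w hw v => hw.posSemidef.dotProduct_mulVec_nonneg v) h1
  refine PosSemidef.of_dotProduct_mulVec_nonneg ?_ (h2 hw)
  rw [IsHermitian]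
  simp

omit [Fintype q] [DecidableEq p] [DecidableEq q] in
theorem continuous_mNum (g : Matrix (p ⊕ q) (p ⊕ q) ℂ) : Continuous (mNum g) :=
  (continuous_const.matrix_mul continuous_id).add continuous_const

omit [Fintype q] [DecidableEq p] [DecidableEq q] in
theorem continuous_mDen (g : Matrix (p ⊕ q) (p ⊕ q) ℂ) : Continuous (mDen g) :=
  (continuous_const.matrix_mul continuous_id).add continuous_const

theorem continuous_mobius {g : Matrix (p ⊕ q) (p ⊕ q) ℂ} (hg : Preserves g) :
    Continuous fun z : matBall p q => mobius g z.1 := by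
  have h1 : Continuous fun z : matBall p q => mDen g z.1 :=
    (continuous_mDen g).comp continuous_subtype_val
  refine ((continuous_mNum g).comp continuous_subtype_val).matrix_mul ?_
  simp only [Matrix.inv_def, Ring.inverse_eq_inv']
  exact (h1.matrix_det.inv₀ fun z => ((isUnit_iff_isUnit_det _).mp
    (isUnit_mDen g hg z.1 z.2)).ne_zero).smul h1.matrix_adjugate

omit [DecidableEq p] in
theorem continuous_det_one_sub :
    Continuous fun z : Matrix p q ℂ × Matrix p q ℂ => (1 - z.2ᴴ * z.1).det :=
  (continuous_const.sub (continuous_snd.matrix_conjTranspose.matrix_mul continuous_fst)).matrix_det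

attribute [local instance] Matrix.normedAddCommGroup Matrix.normedSpace

omit [DecidableEq p] in
theorem differentiable_det_one_sub (w : Matrix p q ℂ) :
    Differentiable ℂ fun z : Matrix p q ℂ => (1 - wᴴ * z).det := by
  have h1 : ∀ i j, Differentiable ℂ fun z : Matrix p q ℂ => (1 - wᴴ * z : Matrix q q ℂ) i j := by
    intro i j
    have h2 : ∀ k, Differentiable ℂ fun z : Matrix p q ℂ => z k j := fun k =>
      differentiable_pi.mp (differentiable_pi.mp (differentiable_id (E := p → q → ℂ)) k) j
    simp only [Matrix.sub_apply, Matrix.mul_apply]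
    exact (differentiable_const _).sub (Differentiable.fun_sum fun k _ => (h2 k).const_mul _)
  simp only [det_apply']
  have h3 : ∀ σ : Equiv.Perm q, Differentiable ℂ fun z : Matrix p q ℂ =>
      ∏ i, (1 - wᴴ * z : Matrix q q ℂ) (σ i) i := by
    intro σ
    induction (Finset.univ : Finset q) using Finset.cons_induction with
    | empty => simpa only [Finset.prod_empty] using differentiable_const (1 : ℂ)
    | cons a t ha ih =>
      simp only [Finset.prod_cons]
      exact (h1 (σ a) a).mul ih
  exact Differentiable.fun_sum fun σ _ => (h3 σ).const_mul _

end MatrixTopology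

/-! ### The sign of the denominator in the real case. -/

section IdentityComponent

variable {n : ℕ}

/-- On the identity component the denominators `c u + d` stay positive. -/
theorem sDen_pos_of_mem_idComponent {g : (Matrix (Fin n ⊕ Unit) (Fin n ⊕ Unit) ℝ)ˣ}
    (hg : g ∈ idComponent (specialIndefUnitary (Fin n) Unit ℝ)) {x : EuclideanSpace ℝ (Fin n)}
    (hx : ‖x‖ ≤ 1) : 0 < sDen g.1 fun j => x j := by
  obtain ⟨y, hy, rfl⟩ := hg
  set f : specialIndefUnitary (Fin n) Unit ℝ → ℝ := fun y => sDen y.1.1 fun j => x j with hf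
  have hc : Continuous f := by
    have h1 : Continuous fun y : specialIndefUnitary (Fin n) Unit ℝ => y.1.1 :=
      Units.continuous_val.comp continuous_subtype_val
    have h2 : ∀ i j, Continuous fun y : specialIndefUnitary (Fin n) Unit ℝ => y.1.1 i j :=
      fun i j => h1.matrix_elem i j
    simp only [hf, sDen, mulVec, dotProduct, toBlocks₂₁, toBlocks₂₂, of_apply]
    exact (continuous_finsetSum _ fun i _ => (h2 _ _).mul continuous_const).add (h2 _ _)
  -- The denominator never vanishes on the closed ball and equals `1` at the identity, so it cannot
  -- change sign on a connected set.
  have hne : ∀ y, f y ≠ 0 := fun y => norm_pos_iff.mp (sDen_pos_of_norm_le y.2.1 hx)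
  have hpre : IsPreconnected (connectedComponent (1 : specialIndefUnitary (Fin n) Unit ℝ)) :=
    isPreconnected_connectedComponent
  have h1 : f 1 = 1 := (sNum_sDen_one _).2
  by_contra hneg
  have hlt : f y ≤ 0 := not_lt.mp hneg
  obtain ⟨y', -, hy'⟩ := hpre.intermediate_value hy mem_connectedComponent hc.continuousOn
    (show (0 : ℝ) ∈ Set.Icc (f y) (f 1) from ⟨hlt, by rw [h1]; exact zero_le_one⟩)
  exact hne y' hy'

end IdentityComponent

/-! ### Real dimension of `𝔽ⁿ`. -/

section SphereDimension

theorem finrank_euclideanSpace_real (F : Type) [NormedDivisionRing F] [NormedAlgebra ℝ F]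
    [FiniteDimensional ℝ F] (n : ℕ) :
    Module.finrank ℝ (EuclideanSpace F (Fin n)) = n * Module.finrank ℝ F := by
  rw [(WithLp.linearEquiv 2 ℝ (Fin n → F)).finrank_eq, Module.finrank_pi_fintype]
  simp

end SphereDimension

/-! ### Spheres inside the boundaries of matrix balls. -/

section BoundaryEmbedding

variable {p q : Type} [Fintype p] [Fintype q] [DecidableEq p] [DecidableEq q]

omit [DecidableEq p] in
theorem mobius_eq_of_mul_mDen {g : Matrix (p ⊕ q) (p ⊕ q) ℂ} {z w : Matrix p q ℂ}
    (hz : IsUnit (mDen g z)) (hw : w * mDen g z = mNum g z) : mobius g z = w := by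
  rw [mobius, ← hw, mul_nonsing_inv_cancel_right _ _ ((isUnit_iff_isUnit_det _).mp hz)]

omit [DecidableEq p] in
theorem det_one_sub_real_smul (r t : ℝ) (z w : Matrix p q ℂ) :
    (1 - (t • w)ᴴ * (r • z)).det = (1 - (r * t) • (wᴴ * z)).det := by
  rw [conjTranspose_real_smul, Matrix.smul_mul, Matrix.mul_smul, smul_smul, mul_comm t r]

variable {n : ℕ}

/-- A vector of `ℂⁿ` as a column. -/
def vecCol (v : Fin n → ℂ) : Matrix (Fin n) Unit ℂ := Matrix.of fun i _ => v i

theorem mNum_vecCol (g : Matrix (Fin n ⊕ Unit) (Fin n ⊕ Unit) ℂ) (v : Fin n → ℂ) :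
    mNum g (vecCol v) = vecCol (sNum g v) := rfl

theorem det_mDen_vecCol (g : Matrix (Fin n ⊕ Unit) (Fin n ⊕ Unit) ℂ) (v : Fin n → ℂ) :
    (mDen g (vecCol v)).det = sDen g v := by
  rw [det_unique]
  rfl

theorem isUnit_mDen_vecCol {g : Matrix (Fin n ⊕ Unit) (Fin n ⊕ Unit) ℂ} {v : Fin n → ℂ}
    (h : sDen g v ≠ 0) : IsUnit (mDen g (vecCol v)) := by
  rw [isUnit_iff_isUnit_det, det_mDen_vecCol]
  exact h.isUnit

theorem mobius_vecCol {g : Matrix (Fin n ⊕ Unit) (Fin n ⊕ Unit) ℂ} {v : Fin n → ℂ}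
    (h : sDen g v ≠ 0) : mobius g (vecCol v) = vecCol fun i => sNum g v i * (sDen g v)⁻¹ := by
  refine mobius_eq_of_mul_mDen (isUnit_mDen_vecCol h) ?_
  rw [mNum_vecCol]
  ext i j
  have h1 : mDen g (vecCol v) () j = sDen g v := rfl
  rw [Matrix.mul_apply, Fintype.sum_unique]
  show sNum g v i * (sDen g v)⁻¹ * mDen g (vecCol v) () j = sNum g v i
  rw [h1, inv_mul_cancel_right₀ h]

theorem vecCol_conjTranspose_mul (u v : EuclideanSpace ℂ (Fin n)) :
    (vecCol fun i => u i)ᴴ * (vecCol fun i => v i) = Matrix.of fun _ _ => sip v u := rfl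

theorem vecCol_conjTranspose_mul_self (u : USphere ℂ n) :
    (vecCol fun i => u.1 i)ᴴ * (vecCol fun i => u.1 i) = 1 := by
  rw [vecCol_conjTranspose_mul, sip_self]
  ext i j
  simp

theorem continuous_vecCol : Continuous (vecCol (n := n)) :=
  continuous_matrix fun i _ => continuous_apply i

theorem det_one_sub_smul_vecCol (r t : ℝ) (v u : EuclideanSpace ℂ (Fin n)) :
    (1 - (t • vecCol fun i => u i)ᴴ * (r • vecCol fun i => v i)).det =
      1 - (r * t) • sip v u := by
  rw [det_one_sub_real_smul, vecCol_conjTranspose_mul, det_unique]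
  rfl

/-! ### Real matrices -/

theorem sNum_realCplx (g : Matrix (Fin n ⊕ Unit) (Fin n ⊕ Unit) ℝ) (v : Fin n → ℝ) (i : Fin n) :
    sNum (realCplx g) (fun j => (v j : ℂ)) i = ((sNum g v i : ℝ) : ℂ) := by
  simp [sNum, mulVec, dotProduct, realCplx, toBlocks₁₁, toBlocks₁₂]

theorem sDen_realCplx (g : Matrix (Fin n ⊕ Unit) (Fin n ⊕ Unit) ℝ) (v : Fin n → ℝ) :
    sDen (realCplx g) (fun j => (v j : ℂ)) = ((sDen g v : ℝ) : ℂ) := by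
  simp [sDen, mulVec, dotProduct, realCplx, toBlocks₂₁, toBlocks₂₂]

theorem realCplx_mul (g g' : Matrix (Fin n ⊕ Unit) (Fin n ⊕ Unit) ℝ) :
    realCplx (g * g') = realCplx g * realCplx g' := Matrix.map_mul

theorem realCplx_one : realCplx (1 : Matrix (Fin n ⊕ Unit) (Fin n ⊕ Unit) ℝ) = 1 :=
  Matrix.map_one _ (map_zero _) (map_one _)

/-- The complexification of a real vector. -/
def complexify (x : EuclideanSpace ℝ (Fin n)) : EuclideanSpace ℂ (Fin n) :=
  WithLp.toLp 2 fun i => (x i : ℂ)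

theorem sip_complexify (x u : EuclideanSpace ℝ (Fin n)) :
    sip (complexify x) (complexify u) = ((sip x u : ℝ) : ℂ) := by
  simp [sip, complexify]

/-! ### Quaternionic matrices -/

/-- A vector of `ℍⁿ` as a complex `2n × 2` matrix. -/
def quatCol (v : Fin n → ℍ[ℝ]) : Matrix (Fin n × Fin 2) (Fin 2) ℂ :=
  Matrix.of fun i k => quatMat (v i.1) i.2 k

theorem mNum_quatCol (g : Matrix (Fin n ⊕ Unit) (Fin n ⊕ Unit) ℍ[ℝ]) (v : Fin n → ℍ[ℝ]) :
    mNum (quatCplx g) (quatCol v) = quatCol (sNum g v) := by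
  ext ⟨i, a⟩ k
  simp [mNum, quatCol, sNum, mulVec, dotProduct, Matrix.mul_apply, Fintype.sum_prod_type,
    Matrix.sum_apply, toBlocks₁₁, toBlocks₁₂, quatCplx, quatIdx]

theorem mDen_quatCol (g : Matrix (Fin n ⊕ Unit) (Fin n ⊕ Unit) ℍ[ℝ]) (v : Fin n → ℍ[ℝ]) :
    mDen (quatCplx g) (quatCol v) = quatMat (sDen g v) := by
  ext a k
  simp [mDen, quatCol, sDen, mulVec, dotProduct, Matrix.mul_apply, Fintype.sum_prod_type,
    Matrix.sum_apply, toBlocks₂₁, toBlocks₂₂, quatCplx, quatIdx]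

/-- The determinant is the reduced norm. The square is the reason for `μ = 2ν` in the quaternionic
case. -/
theorem det_quatMat (x : ℍ[ℝ]) : (quatMat x).det = ((‖x‖ ^ 2 : ℝ) : ℂ) := by
  rw [sq, ← Quaternion.normSq_eq_norm_mul_self, Quaternion.normSq_def', det_fin_two]
  simp [quatMat]
  ring_nf
  simp [Complex.I_sq]
  ring

theorem quatCol_mul_quatMat (v : Fin n → ℍ[ℝ]) (y : ℍ[ℝ]) :
    quatCol v * quatMat y = quatCol fun i => v i * y := by
  ext ⟨i, a⟩ k
  simp [quatCol, Matrix.mul_apply]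

theorem quatCol_conjTranspose_mul (u v : EuclideanSpace ℍ[ℝ] (Fin n)) :
    (quatCol fun i => u i)ᴴ * (quatCol fun i => v i) = quatMat (sip v u) := by
  ext a k
  simp [quatCol, Matrix.mul_apply, Fintype.sum_prod_type, Matrix.sum_apply, sip, quatMat_star]

theorem quatCol_conjTranspose_mul_self (u : USphere ℍ[ℝ] n) :
    (quatCol fun i => u.1 i)ᴴ * (quatCol fun i => u.1 i) = 1 := by
  rw [quatCol_conjTranspose_mul, sip_self, map_one]

theorem quatMat_real_smul (r : ℝ) (x : ℍ[ℝ]) : quatMat (r • x) = r • quatMat x := by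
  ext i j
  fin_cases i <;> fin_cases j <;> simp [quatMat] <;> ring

theorem det_one_sub_smul_quatCol (r t : ℝ) (v u : EuclideanSpace ℍ[ℝ] (Fin n)) :
    (1 - (t • quatCol fun i => u i)ᴴ * (r • quatCol fun i => v i)).det =
      ((‖1 - (r * t) • sip v u‖ ^ 2 : ℝ) : ℂ) := by
  rw [det_one_sub_real_smul, quatCol_conjTranspose_mul, ← quatMat_real_smul, ← map_one quatMat,
    ← map_sub, det_quatMat]

theorem isUnit_mDen_quatCol {g : Matrix (Fin n ⊕ Unit) (Fin n ⊕ Unit) ℍ[ℝ]} {v : Fin n → ℍ[ℝ]}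
    (h : sDen g v ≠ 0) : IsUnit (mDen (quatCplx g) (quatCol v)) := by
  rw [mDen_quatCol]
  exact h.isUnit.map quatMat

theorem mobius_quatCol {g : Matrix (Fin n ⊕ Unit) (Fin n ⊕ Unit) ℍ[ℝ]} {v : Fin n → ℍ[ℝ]}
    (h : sDen g v ≠ 0) :
    mobius (quatCplx g) (quatCol v) = quatCol fun i => sNum g v i * (sDen g v)⁻¹ := by
  refine mobius_eq_of_mul_mDen (isUnit_mDen_quatCol h) ?_
  rw [mNum_quatCol, mDen_quatCol, quatCol_mul_quatMat]
  simp only [inv_mul_cancel_right₀ h]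

theorem quatCplx_one : quatCplx (1 : Matrix (Fin n ⊕ Unit) (Fin n ⊕ Unit) ℍ[ℝ]) = 1 := by
  ext i j
  rcases i with ⟨i, k⟩ | k <;> rcases j with ⟨j, l⟩ | l
  · by_cases h : i = j
    · simp [quatCplx, quatIdx, h, Matrix.one_apply]
    · simp [quatCplx, quatIdx, h, Matrix.one_apply]
  · simp [quatCplx, quatIdx, Matrix.one_apply]
  · simp [quatCplx, quatIdx, Matrix.one_apply]
  · simp [quatCplx, quatIdx, Matrix.one_apply]

theorem continuous_quatCol : Continuous (quatCol (n := n)) := by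
  refine continuous_matrix fun i k => ?_
  have h1 : Continuous fun x : ℍ[ℝ] => quatMat x i.2 k := by
    obtain ⟨i, a⟩ := i
    have e1 := Quaternion.continuous_re
    have e2 := Quaternion.continuous_imI
    have e3 := Quaternion.continuous_imJ
    have e4 := Quaternion.continuous_imK
    fin_cases a <;> fin_cases k <;> simp [quatMat] <;> fun_prop
  exact h1.comp (continuous_apply i.1)

end BoundaryEmbedding

/-! ### The real case. -/

section RealModel

variable {n : ℕ}

theorem sDen_realCplx_complexify (g : Matrix (Fin n ⊕ Unit) (Fin n ⊕ Unit) ℝ)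
    (x : EuclideanSpace ℝ (Fin n)) :
    sDen (realCplx g) (fun i => complexify x i) = ((sDen g fun i => x i : ℝ) : ℂ) :=
  sDen_realCplx g _

/-- The embedding of the real sphere in the boundary of the unit ball of `ℂⁿ`. -/
def realEmb (s : USphere ℝ n) : Matrix (Fin n) Unit ℂ := vecCol fun i => complexify s.1 i

theorem realEmb_conjTranspose_mul_self (s : USphere ℝ n) : (realEmb s)ᴴ * realEmb s = 1 := by
  rw [realEmb, vecCol_conjTranspose_mul, sip_complexify, sip_self]
  ext i j
  simp

theorem continuous_realEmb : Continuous (realEmb (n := n)) :=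
  continuous_vecCol.comp <| continuous_pi fun i => by
    have : Continuous fun s : USphere ℝ n => s.1 i := by fun_prop
    exact Complex.continuous_ofReal.comp this

/-- Over `ℝ` the number `1 - rt⟨s, u⟩` is itself nonnegative, so the kernel enters with exponent
`1`. -/
theorem det_one_sub_smul_realEmb {r t : ℝ} (hr1 : r ≤ 1) (ht : 0 ≤ t) (hr : 0 ≤ r) (ht1 : t ≤ 1)
    (s u : USphere ℝ n) :
    (1 - (t • realEmb u)ᴴ * (r • realEmb s)).det = ((radialKernel (r * t) s u ^ 1 : ℝ) : ℂ) := by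
  have h1 : 0 ≤ 1 - (r * t) • sip s.1 u.1 := by
    have h2 := (abs_le.mp (norm_sip_sphere_le s u)).2
    have h3 : r * t ≤ 1 := mul_le_one₀ hr1 ht ht1
    rw [smul_eq_mul]
    nlinarith [mul_nonneg hr ht]
  rw [realEmb, realEmb, det_one_sub_smul_vecCol, sip_complexify, pow_one, radialKernel,
    Real.norm_of_nonneg h1]
  simp

variable {g : (Matrix (Fin n ⊕ Unit) (Fin n ⊕ Unit) ℝ)ˣ}

theorem mobius_realEmb (hg : Preserves (g : Matrix (Fin n ⊕ Unit) (Fin n ⊕ Unit) ℝ))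
    (s : USphere ℝ n) : mobius (realCplx g.1) (realEmb s) = realEmb (sphereAct g hg s) := by
  have h0 := sDen_ne_zero g hg _ (sphere_sum s)
  rw [realEmb, mobius_vecCol (by rw [sDen_realCplx_complexify]; exact_mod_cast h0)]
  ext i j
  show sNum (realCplx g.1) (fun i => ((s.1 i : ℝ) : ℂ)) i *
    (sDen (realCplx g.1) fun i => ((s.1 i : ℝ) : ℂ))⁻¹ =
      ((sNum g.1 (fun i => s.1 i) i * (sDen g.1 fun i => s.1 i)⁻¹ : ℝ) : ℂ)
  rw [sNum_realCplx, sDen_realCplx]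
  push_cast
  rfl

theorem det_mDen_realCplx_zero_pos (hg : g ∈ idComponent (specialIndefUnitary (Fin n) Unit ℝ)) :
    0 < (mDen (realCplx g.1) (0 : Matrix (Fin n) Unit ℂ)).det := by
  have h1 : (0 : Matrix (Fin n) Unit ℂ) =
      vecCol fun i => complexify (0 : EuclideanSpace ℝ (Fin n)) i := by
    ext i j; simp [vecCol, complexify]
  rw [h1, det_mDen_vecCol, sDen_realCplx_complexify]
  exact_mod_cast sDen_pos_of_mem_idComponent hg (by simp)

/-- Covariance of `h` is valid up to boundary points with invertible denominator. It produces `cs +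
d`, which agrees with `|cs + d|` only because `g` lies in the identity component. -/
theorem realEmb_covariance (hg : g ∈ idComponent (specialIndefUnitary (Fin n) Unit ℝ))
    (hP : Preserves (g : Matrix (Fin n ⊕ Unit) (Fin n ⊕ Unit) ℝ)) {z : Matrix (Fin n) Unit ℂ}
    (hz : z ∈ matBall (Fin n) Unit) (s : USphere ℝ n) :
    (mDen (realCplx g.1) z).det * ((sphereFactor g s ^ 1 : ℝ) : ℂ) *
      (1 - (realEmb (sphereAct g hP s))ᴴ * mobius (realCplx g.1) z).det =
        (1 - (realEmb s)ᴴ * z).det := by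
  have h1 : 0 < sDen g.1 fun i => s.1 i :=
    sDen_pos_of_mem_idComponent hg (norm_eq_of_mem_sphere s).le
  have h2 : (mDen (realCplx g.1) (realEmb s)).det = ((sphereFactor g s ^ 1 : ℝ) : ℂ) := by
    rw [realEmb, det_mDen_vecCol, sDen_realCplx_complexify, pow_one]
    exact congrArg _ (Real.norm_of_nonneg h1.le).symm
  have h3 : IsUnit (mDen (realCplx g.1) (realEmb s)) := by
    rw [isUnit_iff_isUnit_det, h2, isUnit_iff_ne_zero]
    exact_mod_cast pow_ne_zero _ (sphereFactor_pos hP s).ne'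
  have h4 := det_mobius_covariance (preserves_realCplx _ hP) h3
    (isUnit_mDen _ (preserves_realCplx _ hP) _ hz)
  rwa [h2, Complex.conj_ofReal, mobius_realEmb hP] at h4

theorem isAlgebraic_realModel (n : ℕ) :
    (realModel n).IsAlgebraic (radialKernel (F := ℝ) (n := n)) 1 := by
  have hP : ∀ g : (realModel n).H, Preserves g.1.1 := fun g => (mem_of_mem_idComponent g.2).1
  have hPc : ∀ g : (realModel n).H, Preserves (realCplx g.1.1) := fun g =>
    preserves_realCplx _ (hP g)
  have hone : ∀ z : Matrix (Fin n) Unit ℂ, mobius (realCplx 1) z = z := fun z => by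
    rw [realCplx_one, mobius_one]
  have hzero : ∀ z : Matrix (Fin n) Unit ℂ, (1 - (0 : Matrix (Fin n) Unit ℂ)ᴴ * z).det = 1 :=
    fun z => by simp
  exact
  { smul_mem := fun r hr hr1 z hz => smul_mem_matBall hr hr1 hz
    zero_mem := zero_mem_matBall
    actD_one := fun z => Subtype.ext (hone z.1)
    actD_mul := fun g g' z => Subtype.ext <| by
      refine (congrArg (fun m => mobius m _) (realCplx_mul g.1.1 g'.1.1)).trans ?_
      exact mobius_mul _ _ (isUnit_mDen _ (hPc g') _ z.2)
    continuous_actD := fun g => (continuous_mobius (hPc g)).subtype_mk _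
    facD_mul := fun g g' z => by
      refine (congrArg (fun m => (mDen m _).det) (realCplx_mul g.1.1 g'.1.1)).trans ?_
      exact (congrArg det (mDen_mul _ _ (isUnit_mDen _ (hPc g') _ z.2))).trans (det_mul _ _)
    continuous_facD := fun g => ((continuous_mDen _).comp continuous_subtype_val).matrix_det
    facD_zero_pos := fun g => det_mDen_realCplx_zero_pos g.2
    h_act := fun g z w => det_mobius_covariance (hPc g) (isUnit_mDen _ (hPc g) _ w.2)
      (isUnit_mDen _ (hPc g) _ z.2)
    actS_one := fun s => sphereAct_one (hP 1) s
    actS_mul := fun g g' s => sphereAct_mul (hP g) (hP g') (hP (g * g')) s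
    facS_pos := fun g s => sphereFactor_pos (hP g) s
    facS_one := fun s => sphereFactor_one s
    facS_mul := fun g g' s => sphereFactor_mul (hP g') s
    boundary_act := fun g z s => realEmb_covariance g.2 (hP g) z.2 s
    smul_emb_mem := fun r hr hr1 s =>
      smul_mem_matBall_of_isometry hr hr1 (realEmb_conjTranspose_mul_self s)
    continuous_emb := continuous_realEmb
    continuous_h := continuous_det_one_sub
    slit := fun z hz w hw => Or.inl (re_det_one_sub_pos hz (posSemidef_of_mem_closure hw))
    conj_h := fun z w => conj_det_one_sub z w
    h_zero := hzero
    h_smul_emb := fun r hr hr1 t ht ht1 s u => det_one_sub_smul_realEmb hr1 ht hr ht1 s u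
    k_nonneg := radialKernel_nonneg
    continuous_coord := continuous_id
    coord_coord := fun z => rfl
    differentiable_h := fun w => differentiable_det_one_sub w }

end RealModel

/-! ### The complex case. -/

section ComplexModel

variable {n : ℕ}

/-- The embedding of the complex sphere in the boundary of the unit ball of `ℂⁿ`. -/
def complexEmb (s : USphere ℂ n) : Matrix (Fin n) Unit ℂ := vecCol fun i => s.1 i

theorem complexEmb_conjTranspose_mul_self (s : USphere ℂ n) :
    (complexEmb s)ᴴ * complexEmb s = 1 := vecCol_conjTranspose_mul_self s

theorem continuous_complexEmb : Continuous (complexEmb (n := n)) :=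
  continuous_vecCol.comp <| continuous_pi fun i => by fun_prop

theorem det_one_sub_smul_complexEmb (r t : ℝ) (s u : USphere ℂ n) :
    (1 - (t • complexEmb u)ᴴ * (r • complexEmb s)).det *
      (1 - (r • complexEmb s)ᴴ * (t • complexEmb u)).det =
        ((radialKernel (r * t) s u ^ 2 : ℝ) : ℂ) := by
  rw [← conj_det_one_sub (r • complexEmb s), Complex.mul_conj', complexEmb, complexEmb,
    det_one_sub_smul_vecCol, radialKernel]
  push_cast
  rfl

variable {g : (Matrix (Fin n ⊕ Unit) (Fin n ⊕ Unit) ℂ)ˣ}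

theorem mobius_complexEmb (hg : Preserves (g : Matrix (Fin n ⊕ Unit) (Fin n ⊕ Unit) ℂ))
    (s : USphere ℂ n) : mobius g.1 (complexEmb s) = complexEmb (sphereAct g hg s) :=
  mobius_vecCol (sDen_ne_zero g hg _ (sphere_sum s))

theorem det_mDen_mul_conj_zero_pos
    (hP : Preserves (g : Matrix (Fin n ⊕ Unit) (Fin n ⊕ Unit) ℂ)) :
    0 < (mDen g.1 (0 : Matrix (Fin n) Unit ℂ)).det *
      conj (mDen g.1 (0 : Matrix (Fin n) Unit ℂ)).det := by
  have h1 := ((isUnit_iff_isUnit_det _).mp (isUnit_mDen g.1 hP 0 zero_mem_matBall)).ne_zero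
  rw [Complex.mul_conj']
  have h2 := norm_pos_iff.mpr h1
  exact_mod_cast pow_pos h2 2

/-- The two balls contribute `cs + d` and its conjugate, so the phase cancels and `|cs + d|²`
remains. -/
theorem complexEmb_covariance (hP : Preserves (g : Matrix (Fin n ⊕ Unit) (Fin n ⊕ Unit) ℂ))
    {z z' : Matrix (Fin n) Unit ℂ} (hz : z ∈ matBall (Fin n) Unit)
    (hz' : z' ∈ matBall (Fin n) Unit) (s : USphere ℂ n) :
    (mDen g.1 z).det * conj (mDen g.1 z').det * ((sphereFactor g s ^ 2 : ℝ) : ℂ) *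
      ((1 - (complexEmb (sphereAct g hP s))ᴴ * mobius g.1 z).det *
        (1 - (mobius g.1 z')ᴴ * complexEmb (sphereAct g hP s)).det) =
      (1 - (complexEmb s)ᴴ * z).det * (1 - z'ᴴ * complexEmb s).det := by
  have h0 := sDen_ne_zero g hP _ (sphere_sum s)
  have h2 : (mDen g.1 (complexEmb s)).det = sDen g.1 fun i => s.1 i := det_mDen_vecCol _ _
  have h3 : IsUnit (mDen g.1 (complexEmb s)) := isUnit_mDen_vecCol h0
  have h4 := det_mobius_covariance hP h3 (isUnit_mDen _ hP _ hz)
  have h5 := det_mobius_covariance hP (isUnit_mDen _ hP _ hz') h3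
  have h6 : ((sphereFactor g s ^ 2 : ℝ) : ℂ) =
      (sDen g.1 fun i => s.1 i) * conj (sDen g.1 fun i => s.1 i) := by
    rw [Complex.mul_conj']
    push_cast
    rfl
  rw [← h4, ← h5, h2, h6, mobius_complexEmb hP]
  ring

theorem re_det_one_sub_pos' {z w : Matrix (Fin n) Unit ℂ} (hz : z ∈ matBall (Fin n) Unit)
    (hw : (1 - wᴴ * w).PosSemidef) : 0 < (1 - zᴴ * w).det.re := by
  rw [← conj_det_one_sub, Complex.conj_re]
  exact re_det_one_sub_pos hz hw

/-- Transposition trades the conjugate of `z` for that of `w`. This exhibits `h` as holomorphic in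
the second variable once that variable is conjugated. -/
theorem det_one_sub_map_conj (w z : Matrix (Fin n) Unit ℂ) :
    (1 - (z.map conj)ᴴ * w).det = (1 - (w.map conj)ᴴ * z).det := by
  rw [← det_transpose]
  congr 1
  ext i j
  simp [Matrix.mul_apply, mul_comm]

theorem continuous_prodMap_mobius
    (hP : Preserves (g : Matrix (Fin n ⊕ Unit) (Fin n ⊕ Unit) ℂ)) :
    Continuous fun z : ((matBall (Fin n) Unit) ×ˢ (matBall (Fin n) Unit) :
        Set (Matrix (Fin n) Unit ℂ × Matrix (Fin n) Unit ℂ)) =>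
      (mobius g.1 z.1.1, mobius g.1 z.1.2) := by
  have h1 : Continuous fun z : ((matBall (Fin n) Unit) ×ˢ (matBall (Fin n) Unit) :
      Set (Matrix (Fin n) Unit ℂ × Matrix (Fin n) Unit ℂ)) =>
      (⟨z.1.1, z.2.1⟩ : matBall (Fin n) Unit) :=
    (continuous_fst.comp continuous_subtype_val).subtype_mk _
  have h2 : Continuous fun z : ((matBall (Fin n) Unit) ×ˢ (matBall (Fin n) Unit) :
      Set (Matrix (Fin n) Unit ℂ × Matrix (Fin n) Unit ℂ)) =>
      (⟨z.1.2, z.2.2⟩ : matBall (Fin n) Unit) :=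
    (continuous_snd.comp continuous_subtype_val).subtype_mk _
  have h3 := (continuous_mobius hP).comp h1
  have h4 := (continuous_mobius hP).comp h2
  simp only [Function.comp_def] at h3 h4
  exact h3.prodMk h4

theorem continuous_det_mDen_mul_conj (g : Matrix (Fin n ⊕ Unit) (Fin n ⊕ Unit) ℂ) :
    Continuous fun z : Matrix (Fin n) Unit ℂ × Matrix (Fin n) Unit ℂ =>
      (mDen g z.1).det * conj (mDen g z.2).det := by
  have h1 : Continuous fun z : Matrix (Fin n) Unit ℂ => (mDen g z).det :=
    (continuous_mDen _).matrix_det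
  exact (h1.comp continuous_fst).mul (Complex.continuous_conj.comp (h1.comp continuous_snd))

theorem continuous_det_mul_det :
    Continuous fun p : (Matrix (Fin n) Unit ℂ × Matrix (Fin n) Unit ℂ) ×
        (Matrix (Fin n) Unit ℂ × Matrix (Fin n) Unit ℂ) =>
      (1 - p.2.1ᴴ * p.1.1).det * (1 - p.1.2ᴴ * p.2.2).det := by
  have h1 := continuous_det_one_sub (p := Fin n) (q := Unit)
  have h2 : Continuous fun p : (Matrix (Fin n) Unit ℂ × Matrix (Fin n) Unit ℂ) ×
      (Matrix (Fin n) Unit ℂ × Matrix (Fin n) Unit ℂ) => (p.1.1, p.2.1) := by fun_prop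
  have h3 : Continuous fun p : (Matrix (Fin n) Unit ℂ × Matrix (Fin n) Unit ℂ) ×
      (Matrix (Fin n) Unit ℂ × Matrix (Fin n) Unit ℂ) => (p.2.2, p.1.2) := by fun_prop
  have h4 := h1.comp h2
  have h5 := h1.comp h3
  simp only [Function.comp_def] at h4 h5
  exact h4.mul h5

theorem prod_mobius_covariance (hP : Preserves (g : Matrix (Fin n ⊕ Unit) (Fin n ⊕ Unit) ℂ))
    {z w : Matrix (Fin n) Unit ℂ × Matrix (Fin n) Unit ℂ}
    (hz : z ∈ matBall (Fin n) Unit ×ˢ matBall (Fin n) Unit)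
    (hw : w ∈ matBall (Fin n) Unit ×ˢ matBall (Fin n) Unit) :
    (mDen g.1 z.1).det * conj (mDen g.1 z.2).det *
      conj ((mDen g.1 w.1).det * conj (mDen g.1 w.2).det) *
      ((1 - (mobius g.1 w.1)ᴴ * mobius g.1 z.1).det *
        (1 - (mobius g.1 z.2)ᴴ * mobius g.1 w.2).det) =
      (1 - w.1ᴴ * z.1).det * (1 - z.2ᴴ * w.2).det := by
  rw [← det_mobius_covariance hP (isUnit_mDen _ hP _ hw.1) (isUnit_mDen _ hP _ hz.1),
    ← det_mobius_covariance hP (isUnit_mDen _ hP _ hz.2) (isUnit_mDen _ hP _ hw.2), map_mul,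
    Complex.conj_conj]
  ring

theorem det_mul_det_mem_slitPlane {z w : Matrix (Fin n) Unit ℂ × Matrix (Fin n) Unit ℂ}
    (hz : z ∈ matBall (Fin n) Unit ×ˢ matBall (Fin n) Unit)
    (hw : w ∈ closure (matBall (Fin n) Unit ×ˢ matBall (Fin n) Unit)) :
    (1 - w.1ᴴ * z.1).det * (1 - z.2ᴴ * w.2).det ∈ Complex.slitPlane := by
  rw [closure_prod_eq] at hw
  exact mul_mem_slitPlane_of_re_pos
    (re_det_one_sub_pos hz.1 (posSemidef_of_mem_closure hw.1))
    (re_det_one_sub_pos' hz.2 (posSemidef_of_mem_closure hw.2))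

attribute [local instance] Matrix.normedAddCommGroup Matrix.normedSpace

theorem differentiable_det_mul_det_map_conj (w w' : Matrix (Fin n) Unit ℂ) :
    Differentiable ℂ fun z : Matrix (Fin n) Unit ℂ × Matrix (Fin n) Unit ℂ =>
      (1 - wᴴ * z.1).det * (1 - (z.2.map conj)ᴴ * w').det := by
  simp only [det_one_sub_map_conj]
  have h1 := differentiable_det_one_sub w
  have h2 := differentiable_det_one_sub (w'.map conj)
  exact (h1.comp differentiable_fst).mul (h2.comp differentiable_snd)

/-- The kernel is the Schur product of the ball kernel and the transposed ball kernel. The power of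
the product splits because both factors have positive real part. -/
theorem posSemidef_det_mul_det_cpow {ν : ℝ} (hν : 0 < ν) :
    (Matrix.of fun z w : ((matBall (Fin n) Unit) ×ˢ (matBall (Fin n) Unit) :
        Set (Matrix (Fin n) Unit ℂ × Matrix (Fin n) Unit ℂ)) =>
      ((1 - w.1.1ᴴ * z.1.1).det * (1 - z.1.2ᴴ * w.1.2).det) ^ (-ν : ℂ)).PosSemidef := by
  have h1 := (posSemidef_det_cpow_unit (p := Fin n) hν).submatrix
    fun z : ((matBall (Fin n) Unit) ×ˢ (matBall (Fin n) Unit) :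
      Set (Matrix (Fin n) Unit ℂ × Matrix (Fin n) Unit ℂ)) => (⟨z.1.1, z.2.1⟩ : matBall (Fin n) Unit)
  have h2 := (posSemidef_det_cpow_unit (p := Fin n) hν).transpose.submatrix
    fun z : ((matBall (Fin n) Unit) ×ˢ (matBall (Fin n) Unit) :
      Set (Matrix (Fin n) Unit ℂ × Matrix (Fin n) Unit ℂ)) => (⟨z.1.2, z.2.2⟩ : matBall (Fin n) Unit)
  convert posSemidef_hadamard h1 h2 using 1
  ext z w
  exact mul_cpow_of_re_pos (re_det_one_sub_pos z.2.1 w.2.1.posSemidef)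
    (re_det_one_sub_pos' z.2.2 w.2.2.posSemidef) _

theorem isAlgebraic_complexModel (n : ℕ) :
    (complexModel n).IsAlgebraic (radialKernel (F := ℂ) (n := n)) 2 := by
  have hP : ∀ g : (complexModel n).H, Preserves g.1.1 := fun g => (mem_of_mem_idComponent g.2).1
  have hu : ∀ (g : (complexModel n).H) {z : Matrix (Fin n) Unit ℂ}, z ∈ matBall (Fin n) Unit →
    IsUnit (mDen g.1.1 z) := fun g z hz => isUnit_mDen _ (hP g) _ hz
  have hone : ∀ z : Matrix (Fin n) Unit ℂ, mobius 1 z = z := mobius_one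
  have hzero : ∀ z z' : Matrix (Fin n) Unit ℂ, (1 - (0 : Matrix (Fin n) Unit ℂ)ᴴ * z).det *
    (1 - z'ᴴ * (0 : Matrix (Fin n) Unit ℂ)).det = 1 := fun z z' => by simp
  have hdet : ∀ (g g' : (complexModel n).H) {z : Matrix (Fin n) Unit ℂ},
      z ∈ matBall (Fin n) Unit → (mDen (g.1.1 * g'.1.1) z).det =
        (mDen g.1.1 (mobius g'.1.1 z)).det * (mDen g'.1.1 z).det := fun g g' z hz => by
    rw [mDen_mul _ _ (hu g' hz), det_mul]
  have hconj : ∀ z w : Matrix (Fin n) Unit ℂ × Matrix (Fin n) Unit ℂ,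
      conj ((1 - w.1ᴴ * z.1).det * (1 - z.2ᴴ * w.2).det) =
        (1 - z.1ᴴ * w.1).det * (1 - w.2ᴴ * z.2).det := fun z w => by
    rw [map_mul, conj_det_one_sub, conj_det_one_sub]
  have hcoord : ∀ z : Matrix (Fin n) Unit ℂ, (z.map conj).map conj = z := fun z => by
    ext i j; simp
  have hcont : Continuous fun z : Matrix (Fin n) Unit ℂ => z.map conj :=
    continuous_id.matrix_map Complex.continuous_conj
  exact
  { smul_mem := fun r hr hr1 z hz =>
      ⟨smul_mem_matBall hr hr1 hz.1, smul_mem_matBall hr hr1 hz.2⟩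
    zero_mem := ⟨zero_mem_matBall, zero_mem_matBall⟩
    actD_one := fun z => Subtype.ext (Prod.ext (hone z.1.1) (hone z.1.2))
    actD_mul := fun g g' z => Subtype.ext <|
      Prod.ext (mobius_mul _ _ (hu g' z.2.1)) (mobius_mul _ _ (hu g' z.2.2))
    continuous_actD := fun g => (continuous_prodMap_mobius (hP g)).subtype_mk _
    facD_mul := fun g g' z => by
      refine (congrArg₂ (fun a b => a * conj b) (hdet g g' z.2.1) (hdet g g' z.2.2)).trans ?_
      simp only [map_mul]
      exact mul_mul_mul_comm _ _ _ _
    continuous_facD := fun g =>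
      (continuous_det_mDen_mul_conj g.1.1).comp continuous_subtype_val
    facD_zero_pos := fun g => det_mDen_mul_conj_zero_pos (hP g)
    h_act := fun g z w => prod_mobius_covariance (hP g) z.2 w.2
    actS_one := fun s => sphereAct_one (hP 1) s
    actS_mul := fun g g' s => sphereAct_mul (hP g) (hP g') (hP (g * g')) s
    facS_pos := fun g s => sphereFactor_pos (hP g) s
    facS_one := fun s => sphereFactor_one s
    facS_mul := fun g g' s => sphereFactor_mul (hP g') s
    boundary_act := fun g z s => complexEmb_covariance (hP g) z.2.1 z.2.2 s
    smul_emb_mem := fun r hr hr1 s =>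
      ⟨smul_mem_matBall_of_isometry hr hr1 (complexEmb_conjTranspose_mul_self s),
        smul_mem_matBall_of_isometry hr hr1 (complexEmb_conjTranspose_mul_self s)⟩
    continuous_emb := continuous_complexEmb.prodMk continuous_complexEmb
    continuous_h := continuous_det_mul_det
    slit := fun z hz w hw => det_mul_det_mem_slitPlane hz hw
    conj_h := hconj
    h_zero := fun z => hzero z.1 z.2
    h_smul_emb := fun r hr hr1 t ht ht1 s u => det_one_sub_smul_complexEmb r t s u
    k_nonneg := radialKernel_nonneg
    continuous_coord := continuous_fst.prodMk (hcont.comp continuous_snd)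
    coord_coord := fun z => Prod.ext rfl (hcoord z.2)
    differentiable_h := fun w => differentiable_det_mul_det_map_conj w.1 w.2 }

end ComplexModel

/-! ### The quaternionic case. -/

section QuaternionModel

variable {n : ℕ}

/-- The embedding of the quaternionic sphere in the boundary of the matrix ball. -/
def quatEmb (s : USphere ℍ[ℝ] n) : Matrix (Fin n × Fin 2) (Fin 2) ℂ := quatCol fun i => s.1 i

theorem quatEmb_conjTranspose_mul_self (s : USphere ℍ[ℝ] n) : (quatEmb s)ᴴ * quatEmb s = 1 :=
  quatCol_conjTranspose_mul_self s

theorem continuous_quatEmb : Continuous (quatEmb (n := n)) :=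
  continuous_quatCol.comp <| continuous_pi fun i => by fun_prop

theorem det_one_sub_smul_quatEmb (r t : ℝ) (s u : USphere ℍ[ℝ] n) :
    (1 - (t • quatEmb u)ᴴ * (r • quatEmb s)).det = ((radialKernel (r * t) s u ^ 2 : ℝ) : ℂ) :=
  det_one_sub_smul_quatCol r t s.1 u.1

variable {g : (Matrix (Fin n ⊕ Unit) (Fin n ⊕ Unit) ℍ[ℝ])ˣ}

theorem mobius_quatEmb (hg : Preserves (g : Matrix (Fin n ⊕ Unit) (Fin n ⊕ Unit) ℍ[ℝ]))
    (s : USphere ℍ[ℝ] n) : mobius (quatCplx g.1) (quatEmb s) = quatEmb (sphereAct g hg s) :=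
  mobius_quatCol (sDen_ne_zero g hg _ (sphere_sum s))

theorem det_mDen_quatCplx_zero_pos
    (hP : Preserves (g : Matrix (Fin n ⊕ Unit) (Fin n ⊕ Unit) ℍ[ℝ])) :
    0 < (mDen (quatCplx g.1) (0 : Matrix (Fin n × Fin 2) (Fin 2) ℂ)).det := by
  have h1 : (0 : Matrix (Fin n × Fin 2) (Fin 2) ℂ) =
      quatCol fun i => (0 : EuclideanSpace ℍ[ℝ] (Fin n)) i := by
    ext i j; simp [quatCol]
  have h2 : 0 < ‖sDen g.1 fun i => (0 : EuclideanSpace ℍ[ℝ] (Fin n)) i‖ :=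
    sDen_pos_of_norm_le hP (by simp)
  rw [h1, mDen_quatCol, det_quatMat]
  exact_mod_cast pow_pos h2 2

theorem quatEmb_covariance (hP : Preserves (g : Matrix (Fin n ⊕ Unit) (Fin n ⊕ Unit) ℍ[ℝ]))
    {z : Matrix (Fin n × Fin 2) (Fin 2) ℂ} (hz : z ∈ matBall (Fin n × Fin 2) (Fin 2))
    (s : USphere ℍ[ℝ] n) :
    (mDen (quatCplx g.1) z).det * ((sphereFactor g s ^ 2 : ℝ) : ℂ) *
      (1 - (quatEmb (sphereAct g hP s))ᴴ * mobius (quatCplx g.1) z).det =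
        (1 - (quatEmb s)ᴴ * z).det := by
  have h0 := sDen_ne_zero g hP _ (sphere_sum s)
  have h2 : (mDen (quatCplx g.1) (quatEmb s)).det = ((sphereFactor g s ^ 2 : ℝ) : ℂ) := by
    rw [quatEmb, mDen_quatCol, det_quatMat]
    rfl
  have h4 := det_mobius_covariance (preserves_quatCplx _ hP) (isUnit_mDen_quatCol h0)
    (isUnit_mDen _ (preserves_quatCplx _ hP) _ hz)
  change _ * conj (mDen (quatCplx g.1) (quatEmb s)).det *
    (1 - (mobius (quatCplx g.1) (quatEmb s))ᴴ * mobius (quatCplx g.1) z).det = (1 - (quatEmb s)ᴴ * z).det at h4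
  rwa [h2, Complex.conj_ofReal, mobius_quatEmb hP] at h4

theorem isAlgebraic_quaternionModel (n : ℕ) :
    (quaternionModel n).IsAlgebraic (radialKernel (F := ℍ[ℝ]) (n := n)) 2 := by
  have hP : ∀ g : (quaternionModel n).H, Preserves g.1.1 := fun g => mem_of_mem_idComponent g.2
  have hPc : ∀ g : (quaternionModel n).H, Preserves (quatCplx g.1.1) := fun g =>
    preserves_quatCplx _ (hP g)
  have hone : ∀ z : Matrix (Fin n × Fin 2) (Fin 2) ℂ, mobius (quatCplx 1) z = z := fun z => by
    rw [quatCplx_one, mobius_one]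
  have hzero : ∀ z : Matrix (Fin n × Fin 2) (Fin 2) ℂ,
    (1 - (0 : Matrix (Fin n × Fin 2) (Fin 2) ℂ)ᴴ * z).det = 1 := fun z => by simp
  exact
  { smul_mem := fun r hr hr1 z hz => smul_mem_matBall hr hr1 hz
    zero_mem := zero_mem_matBall
    actD_one := fun z => Subtype.ext (hone z.1)
    actD_mul := fun g g' z => Subtype.ext <| by
      refine (congrArg (fun m => mobius m _) (quatCplx_mul g.1.1 g'.1.1)).trans ?_
      exact mobius_mul _ _ (isUnit_mDen _ (hPc g') _ z.2)
    continuous_actD := fun g => (continuous_mobius (hPc g)).subtype_mk _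
    facD_mul := fun g g' z => by
      refine (congrArg (fun m => (mDen m _).det) (quatCplx_mul g.1.1 g'.1.1)).trans ?_
      exact (congrArg det (mDen_mul _ _ (isUnit_mDen _ (hPc g') _ z.2))).trans (det_mul _ _)
    continuous_facD := fun g => ((continuous_mDen _).comp continuous_subtype_val).matrix_det
    facD_zero_pos := fun g => det_mDen_quatCplx_zero_pos (hP g)
    h_act := fun g z w => det_mobius_covariance (hPc g) (isUnit_mDen _ (hPc g) _ w.2)
      (isUnit_mDen _ (hPc g) _ z.2)
    actS_one := fun s => sphereAct_one (hP 1) s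
    actS_mul := fun g g' s => sphereAct_mul (hP g) (hP g') (hP (g * g')) s
    facS_pos := fun g s => sphereFactor_pos (hP g) s
    facS_one := fun s => sphereFactor_one s
    facS_mul := fun g g' s => sphereFactor_mul (hP g') s
    boundary_act := fun g z s => quatEmb_covariance (hP g) z.2 s
    smul_emb_mem := fun r hr hr1 s =>
      smul_mem_matBall_of_isometry hr hr1 (quatEmb_conjTranspose_mul_self s)
    continuous_emb := continuous_quatEmb
    continuous_h := continuous_det_one_sub
    slit := fun z hz w hw => det_one_sub_mem_slitPlane hz (posSemidef_of_mem_closure hw)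
    conj_h := fun z w => conj_det_one_sub z w
    h_zero := hzero
    h_smul_emb := fun r hr hr1 t ht ht1 s u => det_one_sub_smul_quatEmb r t s u
    k_nonneg := radialKernel_nonneg
    continuous_coord := continuous_id
    coord_coord := fun z => rfl
    differentiable_h := fun w => differentiable_det_one_sub w }

end QuaternionModel

/-! ### Criticality of the interior kernels. -/

section SphereKernel

variable {F : Type} [NormedDivisionRing F] [NormedAlgebra ℝ F] [StarRing F] [NormSqStar F]
  [ContinuousStar F] {n : ℕ} [FiniteDimensional ℝ F] [MeasurableSpace F] [BorelSpace F]

theorem isCriticalFamily_radialKernel (μ : Measure (EuclideanSpace F (Fin n)))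
    [μ.IsAddHaarMeasure] (hn : 0 < n) {m ρ : ℝ} (hm : 0 < m) (hρ0 : 0 ≤ ρ)
    (hρ : 2 * ρ + 2 = Module.finrank ℝ (EuclideanSpace F (Fin n)) + Module.finrank ℝ F) :
    IsCriticalFamily μ.toSphere (sphereKernel (F := F)) radialKernel m ρ where
  continuous_k := continuous_radialKernel
  k_zero := radialKernel_zero
  k_one := radialKernel_one
  kn_le _ hr hr1 s u := sphereKernel_le hr hr1 s u
  kn_pos h := ae_sphereKernel_pos μ hn (hm.trans h) hρ
  integrable_kn h := integrable_sphereKernel μ hn hρ hm h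
  lt_of_bounded := fun ⟨_, hC⟩ => lt_of_bounded_radialKernel μ hn hρ0 hρ hm hC

end SphereKernel

/-! ### Assembly of the three cases. -/

section Covariance

variable {n : ℕ}

theorem isCovariant_realModel {ν : ℝ} (hn : 0 < n) (hν : 0 < ν) :
    (realModel n).IsCovariant (radialKernel (F := ℝ) (n := n)) ν ν ((n - 1) / 2) := by
  -- The relation `2ρ + 2 = dim 𝔽ⁿ + dim 𝔽` reads `n + 1` here, and `2n + 2` and `4n + 4` in the
  -- other two cases.
  have hρ : 2 * ((n - 1) / 2 : ℝ) + 2 =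
      Module.finrank ℝ (EuclideanSpace ℝ (Fin n)) + Module.finrank ℝ ℝ := by
    rw [finrank_euclideanSpace_real, Module.finrank_self]
    push_cast
    ring
  have hn' : (1 : ℝ) ≤ n := by exact_mod_cast hn
  have hact : ∀ (g : (realModel n).H) (f : C(USphere ℝ n, ℂ)),
      ∫ u, ((sphereFactor g.1 u ^ (-(2 * ((n - 1) / 2 : ℝ))) : ℝ) : ℂ) *
          f (sphereAct g.1 (mem_of_mem_idComponent g.2).1 u) ∂(volume : Measure (EuclideanSpace ℝ (Fin n))).toSphere =
        ∫ u, f u ∂(volume : Measure (EuclideanSpace ℝ (Fin n))).toSphere := fun g f => by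
    have h1 := integral_sphereAct (F := ℝ) hn (mem_of_mem_idComponent g.2).1
      (volume : Measure (EuclideanSpace ℝ (Fin n))) hρ f
    exact h1
  have hk : IsCriticalFamily (volume : Measure (EuclideanSpace ℝ (Fin n))).toSphere sphereKernel
      radialKernel ν ((n - 1) / 2 : ℝ) := by
    have h1 := isCriticalFamily_radialKernel (F := ℝ) (volume : Measure (EuclideanSpace ℝ (Fin n))) hn
      hν (by linarith) hρ
    exact h1
  exact (isAlgebraic_realModel n).isCovariant (by simp) hν
    (inferInstanceAs (SecondCountableTopology (USphere ℝ n))) (posSemidef_det_cpow_unit hν)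
    hact hk

theorem isCovariant_complexModel {ν : ℝ} (hn : 0 < n) (hν : 0 < ν) :
    (complexModel n).IsCovariant (radialKernel (F := ℂ) (n := n)) ν (2 * ν) n := by
  have hρ : 2 * (n : ℝ) + 2 =
      Module.finrank ℝ (EuclideanSpace ℂ (Fin n)) + Module.finrank ℝ ℂ := by
    rw [finrank_euclideanSpace_real, Complex.finrank_real_complex]
    push_cast
    ring
  have hν2 : 0 < 2 * ν := by linarith
  have hact : ∀ (g : (complexModel n).H) (f : C(USphere ℂ n, ℂ)),
      ∫ u, ((sphereFactor g.1 u ^ (-(2 * (n : ℝ))) : ℝ) : ℂ) *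
          f (sphereAct g.1 (mem_of_mem_idComponent g.2).1 u) ∂(volume : Measure (EuclideanSpace ℂ (Fin n))).toSphere =
        ∫ u, f u ∂(volume : Measure (EuclideanSpace ℂ (Fin n))).toSphere := fun g f => by
    have h1 := integral_sphereAct (F := ℂ) hn (mem_of_mem_idComponent g.2).1
      (volume : Measure (EuclideanSpace ℂ (Fin n))) hρ f
    exact h1
  have hk : IsCriticalFamily (volume : Measure (EuclideanSpace ℂ (Fin n))).toSphere sphereKernel
      radialKernel (2 * ν) (n : ℝ) := by
    have h1 := isCriticalFamily_radialKernel (F := ℂ) (volume : Measure (EuclideanSpace ℂ (Fin n))) hn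
      hν2 (by positivity) hρ
    exact h1
  exact (isAlgebraic_complexModel n).isCovariant (by simp) hν2
    (inferInstanceAs (SecondCountableTopology (USphere ℂ n))) (posSemidef_det_mul_det_cpow hν)
    hact hk

theorem isCovariant_quaternionModel {ν : ℝ} (hn : 0 < n) (hν : 1 < ν) :
    (quaternionModel n).IsCovariant (radialKernel (F := ℍ[ℝ]) (n := n)) ν (2 * ν) (2 * n + 1) := by
  have hρ : 2 * (2 * n + 1 : ℝ) + 2 =
      Module.finrank ℝ (EuclideanSpace ℍ[ℝ] (Fin n)) + Module.finrank ℝ ℍ[ℝ] := by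
    rw [finrank_euclideanSpace_real, Quaternion.finrank_eq_four]
    push_cast
    ring
  have hν2 : 0 < 2 * ν := by linarith
  have hact : ∀ (g : (quaternionModel n).H) (f : C(USphere ℍ[ℝ] n, ℂ)),
      ∫ u, ((sphereFactor g.1 u ^ (-(2 * (2 * n + 1 : ℝ))) : ℝ) : ℂ) *
          f (sphereAct g.1 (mem_of_mem_idComponent g.2) u) ∂(volume : Measure (EuclideanSpace ℍ[ℝ] (Fin n))).toSphere =
        ∫ u, f u ∂(volume : Measure (EuclideanSpace ℍ[ℝ] (Fin n))).toSphere := fun g f => by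
    have h1 := integral_sphereAct (F := ℍ[ℝ]) hn (mem_of_mem_idComponent g.2)
      (volume : Measure (EuclideanSpace ℍ[ℝ] (Fin n))) hρ f
    exact h1
  have hk : IsCriticalFamily (volume : Measure (EuclideanSpace ℍ[ℝ] (Fin n))).toSphere sphereKernel
      radialKernel (2 * ν) (2 * n + 1 : ℝ) := by
    have h1 := isCriticalFamily_radialKernel (F := ℍ[ℝ]) (volume : Measure (EuclideanSpace ℍ[ℝ] (Fin n))) hn
      hν2 (by positivity) hρ
    exact h1
  exact (isAlgebraic_quaternionModel n).isCovariant (by simp) hν2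
    (inferInstanceAs (SecondCountableTopology (USphere ℍ[ℝ] n))) (posSemidef_det_cpow_fin_two hν)
    hact hk

theorem exists_isCovariant_model (F : BaseField) {n : ℕ} (hn : 1 ≤ n) {ν : ℝ}
    (hν : wallach F < ν) :
    ∃ k, (model F n).IsCovariant k ν (mu F ν) (rho F n) := by
  cases F with
  | real => exact ⟨_, isCovariant_realModel hn hν⟩
  | complex => exact ⟨_, isCovariant_complexModel hn hν⟩
  | quaternion => exact ⟨_, isCovariant_quaternionModel hn hν⟩

end Covariance

end RankOne

end

theorem theorem4 (F : RankOne.BaseField) (n : ℕ) (hn : 1 ≤ n)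
    (M : RankOne.Model) (hM : M = RankOne.model F n)
    (ν μ ρ : ℝ) (hν : RankOne.wallach F < ν) (hμ : μ = RankOne.mu F ν)
    (hρ : ρ = RankOne.rho F n) :
    -- `h(z, w)^{-ν}` is positive definite, so that it is the kernel of a Hilbert space `H_ν`
    (Matrix.of (M.kernel ν)).PosSemidef ∧
    ∀ (Hν : Type) [NormedAddCommGroup Hν] [InnerProductSpace ℂ Hν] [CompleteSpace Hν]
      [RKHS ℂ Hν M.D ℂ],
      (∀ z w, RKHS.kernel Hν z w 1 = M.kernel ν z w) →
      -- the unitary representation `U_ν` of `H` on `H_ν`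
      ∃ U : M.H →* (Hν ≃ₗᵢ[ℂ] Hν),
        (∀ g φ z, U g φ z = M.facD g⁻¹ z ^ (-ν : ℂ) * φ (M.actD g⁻¹ z)) ∧
        -- `J_ν 1` lies in `H_ν` exactly when `μ < ρ`
        ((∃ φ : Hν, ∀ z, φ z = M.J ν 1 z) ↔ μ < ρ) ∧
        -- for these `ν`, the adjoint of the restriction operator `R` is `J_ν`
        (μ < ρ →
          -- the Hilbert spaces `π_{2ρ-μ}` and `π_μ` exist
          Nonempty (M.UpperSeries μ) ∧ Nonempty (M.LowerSeries μ) ∧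
          ∀ (E' : M.UpperSeries μ) (E : M.LowerSeries μ),
            -- the unitary representations `π_{2ρ-μ}` and `π_μ` of `H`
            ∃ (π' : M.H →* (E'.carrier ≃ₗᵢ[ℂ] E'.carrier))
              (π : M.H →* (E.carrier ≃ₗᵢ[ℂ] E.carrier))
              -- the identification of the dual space of `π_μ` with `π_{2ρ-μ}`
              (Δ : E'.carrier ≃ₗᵢ⋆[ℂ] StrongDual ℂ E.carrier)
              -- the restriction operator and its adjoint
              (R : Hν →L[ℂ] E.carrier) (J : E'.carrier →L[ℂ] Hν),
              (∀ g f, π' g (E'.ι f) = E'.ι (M.ps (2 * ρ - μ) g f)) ∧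
              (∀ g (f : M.lowerSpace μ), ∃ hf : M.ps μ g f ∈ M.lowerSpace μ,
                π g (E.ι f) = E.ι ⟨M.ps μ g f, hf⟩) ∧
              -- the norm of `π_μ` is inverse to the one of `π_{2ρ-μ}` under `Λ_μ`
              (∀ f f' : C(M.S, ℂ), (∀ s, f s = M.knappStein μ f' s) →
                ∃ hf : f ∈ M.lowerSpace μ, ‖E.ι ⟨f, hf⟩‖ = ‖E'.ι f'‖) ∧
              -- the identification is given by the invariant pairing in `L²(S)`
              (∀ (f : M.lowerSpace μ) f', Δ (E'.ι f') (E.ι f) = M.pairing f f') ∧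
              (∀ g x x', Δ (π' g x') (π g x) = Δ x' x) ∧
              -- `R` is the unique bounded extension of the restriction of functions to `S`
              (∀ R' : Hν →L[ℂ] E.carrier,
                (∀ (φ : Hν) f, M.IsRestriction φ f →
                  ∃ hf : f ∈ M.lowerSpace μ, R' φ = E.ι ⟨f, hf⟩) ↔ R' = R) ∧
              (∀ g φ, R (U g φ) = π g (R φ)) ∧
              -- `J` is the adjoint of `R`, is the integral operator `J_ν`, and intertwines
              (∀ x' φ, inner ℂ (J x') φ = Δ x' (R φ)) ∧
              (∀ f z, J (E'.ι f) z = M.J ν f z) ∧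
              (∀ g x', J (π' g x') = U g (J x'))) := by
  obtain ⟨k, hc⟩ := RankOne.exists_isCovariant_model F hn hν
  subst hM hμ hρ
  refine ⟨hc.psd, fun Hν _ _ _ _ hK => ?_⟩
  obtain ⟨U, hU⟩ := hc.exists_unitary hK
  exact ⟨U, hU, hc.J_one_mem_iff hK, fun hμ => hc.exists_complementarySeries hK hμ U hU⟩
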